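/- A (Euclidean) cone surface is a closed surface $S$ with a finite set $\Sigma\subset S$ of singularities and an atlas on $S^\ast=S\smallsetminus\Sigma$ whose transition functions are (locally) orientation-preserving isometries of the plane, such that each point of $\Sigma$ is a cone point of the flat metric (cone angle $2\pi$ is allowed). It is a translation surface if the transition functions are translations. $\mathrm{Isom}(S)$ is the group of isometries of $S$ preserving $\Sigma$; they may reverse orientation. A regular $n$-gon decomposition ($n\ge 3$) of $S$ is a collection $\mathcal P$ of (possibly self-glued) flat regular $n$-gons in $S$ that have disjoint interiors, cover $S$, meet edge-to-edge, and whose vertices are exactly the points of $\Sigma$. A flag is a triple $(P,e,v)$ with $P\in\mathcal P$, $e$ a side of the polygon $P$, and $v$ an endpoint of the side $e$. (Sides and endpoints are those of the polygon $P$ itself before any gluing.) The surface $S$ with $\mathcal P$ is called Platonic if $S$ is connected and $\mathrm{Isom}(S)$ acts transitively on flags. The unfolding $\tilde S\to S$ is the completion of the connected covering of $S^\ast$ associated to the kernel of the parallel transport homomorphism $\pi_1(S^\ast)\to \mathrm{SO}(2,\mathbb R)$, with singular set $\tilde\Sigma$ the preimage of $\Sigma$. It is a translation surface, well defined up to rotation,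 whenever parallel transport has finite image, as is the case for every surface with a regular $n$-gon decomposition. The lifts of the polygons in $\mathcal P$ form the lifted decomposition $\tilde{\mathcal P}$. For even $n$, $\Pi_n$ is the translation surface obtained from a regular $n$-gon with two horizontal sides by gluing opposite sides by translation. For odd $n$, $\Pi_n$ is obtained from two regular $n$-gons, one with a horizontal bottom side and one with a horizontal top side, by gluing each side of the first to the parallel side of the second by translation. Its singular set is the set of vertices. Theorem. Let $D$ be a Platonic surface with regular $n$-gon decomposition $\mathcal P$, let $\tilde D$ be its unfolding, and let $\tilde{\mathcal P}$ be the lifted decomposition. Then: 1. $\tilde{\mathcal P}$ is a regular $n$-gon decomposition of $\tilde D$, and $\tilde D$ with $\tilde{\mathcal P}$ is a Platonic surface. 2. There is a natural covering $\pi_\Pi:\tilde D\to\Pi_n$, that is, a branched covering that is unbranched away from the singular set of $\Pi_n$, for which the preimage of the singular set of $\Pi_n$ is $\tilde\Sigma$, whose derivative is a constant similarity $z\mapsto cz$ ($c\in\mathbb C\smallsetminus\{0\}$), and which maps each polygon of $\tilde{\mathcal P}$ onto a polygon of $\Pi_n$. 3. Every such natural covering $\pi_\Pi$ is regular: its group of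 deck transformations acts transitively on each fibre. -/

import Mathlib

open Set Filter Topology

noncomputable section

/-! ### Euclidean cone surfaces and translation surfaces -/

/-- A space with a chosen singular set and a family of charts to the plane `ℂ`
(the bare data of a flat structure). -/
structure FlatAtlas (S : Type*) [TopologicalSpace S] where
  /-- the singular set -/
  sing : Set S
  /-- the charts of the complement of the singular set -/
  charts : Set (OpenPartialHomeomorph S ℂ)

/-- `x` is a cone singularity of some angle `θ > 0`: a punctured neighbourhood of `x` is isometric to
a punctured neighbourhood of the apex of the Euclidean cone of angle `θ`. The map `p` is the
(infinite cyclic) covering of the punctured neighbourhood by logarithmic polar coordinates: `p w` is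
the point at distance `exp (re w)` from `x` and at angle `im w`, which is read modulo `θ`, so that
`exp w` is, up to an isometry, the position of `p w` in any flat chart. -/
def FlatAtlas.IsConePoint {S : Type*} [TopologicalSpace S] (D : FlatAtlas S) (x : S) : Prop :=
  ∃ (θ r : ℝ) (p : ℂ → S), 0 < θ ∧
    ContinuousOn p {w | w.re < r} ∧
    (∀ w : ℂ, w.re < r → p w ∉ D.sing) ∧
    (∀ w : ℂ, w.re < r → ∀ φ ∈ D.charts, p w ∈ φ.source →
      ∃ a b : ℂ, ‖a‖ = 1 ∧ ∀ᶠ w' in 𝓝 w, φ (p w') = a * Complex.exp w' + b) ∧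
    (∀ w w' : ℂ, w.re < r → w'.re < r →
      (p w = p w' ↔ ∃ m : ℤ, w' - w = (m : ℂ) * (θ : ℂ) * Complex.I)) ∧
    Tendsto p (comap Complex.re atBot) (𝓝 x) ∧
    insert x (p '' {w | w.re < r}) ∈ 𝓝 x

/-- `D` is a Euclidean cone surface structure on `S`: `S` is closed, the singular set is finite, the
charts cover its complement, transition functions are locally restrictions of orientation
preserving isometries `z ↦ a z + b`, `|a| = 1`, of the plane, and the singular points are cone
points (possibly of angle `2π`). These conditions make `S` a closed topological surface. -/
structure FlatAtlas.IsConeSurface {S : Type*} [TopologicalSpace S] (D : FlatAtlas S) : Prop where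
  compact : CompactSpace S
  hausdorff : T2Space S
  finite_sing : D.sing.Finite
  source_subset : ∀ φ ∈ D.charts, φ.source ⊆ D.singᶜ
  cover : ∀ x ∉ D.sing, ∃ φ ∈ D.charts, x ∈ φ.source
  transition : ∀ φ ∈ D.charts, ∀ ψ ∈ D.charts, ∀ x ∈ φ.source ∩ ψ.source,
    ∃ a b : ℂ, ‖a‖ = 1 ∧ ∀ᶠ y in 𝓝 x, ψ y = a * φ y + b
  cone : ∀ x ∈ D.sing, D.IsConePoint x

/-- A translation surface: a cone surface all of whose transition functions are translations. -/
structure FlatAtlas.IsTranslationSurface {S : Type*} [TopologicalSpace S] (D : FlatAtlas S) :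
    Prop where
  isConeSurface : D.IsConeSurface
  translation : ∀ φ ∈ D.charts, ∀ ψ ∈ D.charts, ∀ x ∈ φ.source ∩ ψ.source,
    ∃ b : ℂ, ∀ᶠ y in 𝓝 x, ψ y = φ y + b

/-- An isometry of a cone surface (as a surface with singular set), possibly orientation reversing:
a homeomorphism that preserves the singular set and is an isometry of the plane in local charts. -/
structure FlatAtlas.IsIsometry {S : Type*} [TopologicalSpace S] (D : FlatAtlas S) (g : S ≃ₜ S) :
    Prop where
  map_sing : ∀ x, g x ∈ D.sing ↔ x ∈ D.sing
  isometry : ∀ x ∉ D.sing, ∀ φ ∈ D.charts, x ∈ φ.source → ∀ ψ ∈ D.charts, g x ∈ ψ.source →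
    ∃ A : ℂ ≃ᵢ ℂ, ∀ᶠ y in 𝓝 x, ψ (g y) = A (φ y)

/-! ### Parallel transport and the unfolding -/

/-- `v` is a parallel vector field along the path `γ`; `v t φ` is the expression of the tangent
vector at `γ t` in the chart `φ` (only relevant if `φ` is a chart of `D` around `γ t`). -/
structure FlatAtlas.IsParallelAlong {S : Type*} [TopologicalSpace S] (D : FlatAtlas S)
    (γ : C(unitInterval, S)) (v : unitInterval → OpenPartialHomeomorph S ℂ → ℂ) : Prop where
  /-- vectors transform by the derivative of the transition functions -/
  change : ∀ t, ∀ φ ∈ D.charts, ∀ ψ ∈ D.charts, γ t ∈ φ.source → γ t ∈ ψ.source →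
    ∀ a b : ℂ, (∀ᶠ y in 𝓝 (γ t), ψ y = a * φ y + b) → v t ψ = a * v t φ
  /-- in a flat chart the field is locally constant -/
  locally_const : ∀ t, ∀ φ ∈ D.charts, γ t ∈ φ.source → ∀ᶠ s in 𝓝 t, v s φ = v t φ

/-- Parallel transport around the loop `γ` of the complement of the singular set is the rotation
`z ↦ a z`. -/
def FlatAtlas.HasParallelTransport {S : Type*} [TopologicalSpace S] (D : FlatAtlas S)
    (γ : C(unitInterval, S)) (a : ℂ) : Prop :=
  ∀ v, D.IsParallelAlong γ v → ∀ φ ∈ D.charts, γ 0 ∈ φ.source → v 1 φ = a * v 0 φ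

/-- `p : S' → S` exhibits the translation surface `D'` as the unfolding of the cone surface `D` with
finite parallel transport group: away from the singular sets `p` is a locally isometric covering map,
it is the connected covering associated to the kernel of parallel transport (a path that projects
to a loop is itself closed precisely if parallel transport around the loop is trivial), and `S'` is
completed by one singular point at each of its ends, these being the points over the singular set
of `D`. -/
structure IsUnfolding {S S' : Type*} [TopologicalSpace S] [TopologicalSpace S']
    (D : FlatAtlas S) (D' : FlatAtlas S') (p : C(S', S)) : Prop where
  connected : ConnectedSpace S'
  isTranslationSurface : D'.IsTranslationSurface
  preimage_sing : p ⁻¹' D.sing = D'.sing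
  covering : IsCoveringMapOn p D.singᶜ
  isometry : ∀ x ∉ D'.sing, ∀ φ' ∈ D'.charts, x ∈ φ'.source → ∀ φ ∈ D.charts, p x ∈ φ.source →
    ∃ a b : ℂ, ‖a‖ = 1 ∧ ∀ᶠ y in 𝓝 x, φ (p y) = a * φ' y + b
  closed_iff : ∀ γ : C(unitInterval, S'), (∀ t, γ t ∉ D'.sing) → p (γ 0) = p (γ 1) →
    (γ 0 = γ 1 ↔ D.HasParallelTransport (p.comp γ) 1)

/-! ### Regular polygon decompositions -/

/-- The vertices, in counterclockwise order, of the regular `n`-gon inscribed in the unit circle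
whose side from vertex `0` to vertex `1` is horizontal and at the bottom. -/
def polyVertex (n : ℕ) (k : ZMod n) : ℂ :=
  Complex.exp (((-(Real.pi / 2) + (2 * (k.val : ℝ) - 1) * Real.pi / n : ℝ) : ℂ) * Complex.I)

/-- The (closed, filled) regular `n`-gon. -/
def regPoly (n : ℕ) : Set ℂ := convexHull ℝ (range (polyVertex n))

/-- The `k`-th side of the regular `n`-gon. -/
def polySide (n : ℕ) (k : ZMod n) : Set ℂ := segment ℝ (polyVertex n k) (polyVertex n (k + 1))

/-- The midpoint of the `k`-th side; it is an outward normal vector of that side. -/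
def polyMid (n : ℕ) (k : ZMod n) : ℂ := midpoint ℝ (polyVertex n k) (polyVertex n (k + 1))

/-- The family `P` is a regular `n`-gon decomposition of the cone surface `D`. Polygons are allowed
to be glued to themselves, so a polygon of the surface is given by an orientation preserving
parametrization by the closed regular `n`-gon, which is injective on the interior. -/
structure FlatAtlas.IsRegularDecomposition {S : Type*} [TopologicalSpace S] (D : FlatAtlas S)
    (n : ℕ) {ι : Type*} (P : ι → C(regPoly n, S)) : Prop where
  three_le : 3 ≤ n
  /-- each member is a regular `n`-gon of the flat metric, of circumradius `s` -/
  polygon : ∀ i, ∃ s : ℝ, 0 < s ∧ ∀ z : regPoly n, P i z ∉ D.sing →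
    ∀ φ ∈ D.charts, P i z ∈ φ.source →
      ∃ a b : ℂ, ‖a‖ = s ∧ ∀ᶠ w : regPoly n in 𝓝 z, φ (P i w) = a * (w : ℂ) + b
  /-- the interiors of the polygons are embedded and disjoint from all the rest -/
  interior_disjoint : ∀ i j (z w : regPoly n), (z : ℂ) ∈ interior (regPoly n) →
    P i z = P j w → i = j ∧ z = w
  cover : ∀ x, ∃ i z, P i z = x
  /-- the vertices of the polygons are the singular points -/
  vertices : ∀ i (z : regPoly n), P i z ∈ D.sing ↔ (z : ℂ) ∈ range (polyVertex n)
  /-- polygons meet edge-to-edge: each side of a polygon is matched along its whole length with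
  another side of a polygon, in the opposite boundary direction -/
  edge_to_edge : ∀ i k, ∃ j l, (j, l) ≠ (i, k) ∧ ∀ t ∈ Icc (0 : ℝ) 1, ∀ z w : regPoly n,
    (z : ℂ) = AffineMap.lineMap (polyVertex n k) (polyVertex n (k + 1)) t →
    (w : ℂ) = AffineMap.lineMap (polyVertex n (l + 1)) (polyVertex n l) t → P i z = P j w

/-- A flag: a polygon, a side of this polygon, and an endpoint of this side. -/
structure PolyFlag (n : ℕ) (ι : Type*) where
  poly : ι
  side : ZMod n
  vert : ZMod n
  incident : vert = side ∨ vert = side + 1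

/-- The polygons parametrized by `f` and by `h` agree up to the symmetry `A` of the regular `n`-gon:
`f = h ∘ A`. -/
def AgreeUpTo {S : Type*} [TopologicalSpace S] {n : ℕ} (A : ℂ ≃ᵢ ℂ) (f h : C(regPoly n, S)) : Prop :=
  A '' regPoly n = regPoly n ∧ ∀ z w : regPoly n, (w : ℂ) = A z → f z = h w

/-- The homeomorphism `g` carries the flag `F` to the flag `F'`. -/
def MapsFlag {S : Type*} [TopologicalSpace S] {n : ℕ} {ι : Type*} (P : ι → C(regPoly n, S))
    (g : S ≃ₜ S) (F F' : PolyFlag n ι) : Prop :=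
  ∃ A : ℂ ≃ᵢ ℂ, AgreeUpTo A ((g : C(S, S)).comp (P F.poly)) (P F'.poly) ∧
    A '' polySide n F.side = polySide n F'.side ∧
    A (polyVertex n F.vert) = polyVertex n F'.vert

/-- A Platonic surface: a connected cone surface with a regular `n`-gon decomposition on whose flags
the isometries act transitively. -/
structure FlatAtlas.IsPlatonic {S : Type*} [TopologicalSpace S] (D : FlatAtlas S)
    (n : ℕ) {ι : Type*} (P : ι → C(regPoly n, S)) : Prop where
  connected : ConnectedSpace S
  isConeSurface : D.IsConeSurface
  decomposition : D.IsRegularDecomposition n P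
  transitive : ∀ F F' : PolyFlag n ι, ∃ g : S ≃ₜ S, D.IsIsometry g ∧ MapsFlag P g F F'

/-- The lifted decomposition: all lifts along `p` of the polygons of `P`. -/
def liftedDecomposition {S S' : Type*} [TopologicalSpace S] [TopologicalSpace S'] {n : ℕ}
    {ι : Type*} (p : C(S', S)) (P : ι → C(regPoly n, S)) :
    {f : C(regPoly n, S') // ∃ i, p.comp f = P i} → C(regPoly n, S') :=
  fun f => f.1

/-! ### The translation surfaces `Π_n` -/

/-- The number of polygons of `Π_n`. -/
def veechCount (n : ℕ) : ℕ := if Even n then 1 else 2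

/-- Polygon `j` of `Π_n` is `veechSign j • regPoly n`: polygon `0` is the regular `n`-gon with a
horizontal side at the bottom, polygon `1` (for odd `n`) has its horizontal side at the top. -/
def veechSign {n : ℕ} (j : Fin (veechCount n)) : ℂ := (-1) ^ (j : ℕ)

/-- The gluing of the polygons of `Π_n`, where `(j, z)` stands for the point `veechSign j * z` of
polygon `j`: a side is glued, by translation, to the parallel side with opposite outward normal
(the opposite side of the same polygon if `n` is even, a side of the other polygon if `n` is odd). -/
def veechGlue (n : ℕ) (x y : Fin (veechCount n) × regPoly n) : Prop :=
  ∃ k l : ZMod n, (x.2 : ℂ) ∈ polySide n k ∧ (y.2 : ℂ) ∈ polySide n l ∧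
    veechSign y.1 * polyMid n l = -(veechSign x.1 * polyMid n k) ∧
    veechSign y.1 * (y.2 : ℂ) - veechSign x.1 * (x.2 : ℂ) =
      veechSign y.1 * polyMid n l - veechSign x.1 * polyMid n k

/-- The underlying space of `Π_n`, with the quotient topology. -/
abbrev VeechSurface (n : ℕ) : Type := Quot (veechGlue n)

/-- The polygons of `Π_n`, parametrized by the regular `n`-gon. -/
def veechPoly (n : ℕ) (j : Fin (veechCount n)) : C(regPoly n, VeechSurface n) where
  toFun z := Quot.mk _ (j, z)
  continuous_toFun := continuous_quot_mk.comp (Continuous.prodMk_right j)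

/-- The translation structure of `Π_n`: the singular points are the vertices, and the charts are all
those which on each polygon `veechSign j • regPoly n` are locally translations. -/
def veechAtlas (n : ℕ) : FlatAtlas (VeechSurface n) where
  sing := {x | ∃ j, ∃ z : regPoly n, (z : ℂ) ∈ range (polyVertex n) ∧ veechPoly n j z = x}
  charts := {φ | (∀ j, ∀ z : regPoly n, (z : ℂ) ∈ range (polyVertex n) →
        veechPoly n j z ∉ φ.source) ∧
      ∀ j, ∀ z : regPoly n, veechPoly n j z ∈ φ.source →
        ∃ b : ℂ, ∀ᶠ w : regPoly n in 𝓝 z, φ (veechPoly n j w) = veechSign j * (w : ℂ) + b}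

/-! ### Coverings -/

/-- `q` is a translation covering of translation surfaces up to a dilation: a branched covering
whose branch points are singular points of the target, such that the preimage of the singular set
is the singular set, and whose derivative is everywhere one similarity `z ↦ c z` of the plane. -/
structure IsDilationCovering {S T : Type*} [TopologicalSpace S] [TopologicalSpace T]
    (D : FlatAtlas S) (E : FlatAtlas T) (q : C(S, T)) : Prop where
  surjective : Function.Surjective q
  covering : IsCoveringMapOn q E.singᶜ
  preimage_sing : q ⁻¹' E.sing = D.sing
  derivative : ∃ c : ℂ, c ≠ 0 ∧ ∀ x ∉ D.sing, ∀ φ ∈ D.charts, x ∈ φ.source →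
    (∃ ψ ∈ E.charts, q x ∈ ψ.source) ∧
    ∀ ψ ∈ E.charts, q x ∈ ψ.source → ∃ b : ℂ, ∀ᶠ y in 𝓝 x, ψ (q y) = c * φ y + b

/-- `q` is a natural covering of `Π_n` by the translation surface `D` with the regular `n`-gon
decomposition `P`: it also maps each polygon of `P` to a polygon of `Π_n`. -/
structure IsNaturalCovering {S : Type*} [TopologicalSpace S] (D : FlatAtlas S) {n : ℕ} {ι : Type*}
    (P : ι → C(regPoly n, S)) (q : C(S, VeechSurface n)) : Prop where
  isDilationCovering : IsDilationCovering D (veechAtlas n) q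
  polygons : ∀ i, ∃ (j : Fin (veechCount n)) (A : ℂ ≃ᵢ ℂ),
    AgreeUpTo A (q.comp (P i)) (veechPoly n j)

/-- A (branched) covering is regular if its deck transformations act transitively on each fibre. -/
def IsRegularCovering {S T : Type*} [TopologicalSpace S] [TopologicalSpace T] (q : C(S, T)) : Prop :=
  ∀ x y, q x = q y → ∃ g : S ≃ₜ S, (∀ z, q (g z) = q z) ∧ g x = y

end

/-! Lifting polygons. A polygon without its vertices is convex, so it lifts through the covering.
The lift extends to the vertices, because a vertex has connected punctured neighbourhoods in the
polygon and the fibres over singular points are finite. The lifted polygons form a tiling of the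
unfolding (`IsUnfolding.exists_isTiling`).

Lifting isometries. Since the unfolding belongs to the kernel of parallel transport, a point is
determined by the germ of the projection in translation coordinates
(`IsUnfolding.eq_of_map_move_eq`). A local lift of an isometry with a given linear part therefore
continues along paths to a result that depends only on the endpoint, which gives global lifts with a
prescribed value at one regular point. Lifting an isometry that moves one flag to another, with the
right value at one centre, proves the first part by uniqueness of polygon lifts.

The covering of `Π_n`. Two polygons that share a regular point have opposite outward normals there
(`IsTiling.normal_eq_neg`), exactly as glued sides of `Π_n` do. Hence, after one similarity, every
polygon is parallel to a polygon of `Π_n`, and the resulting maps on polygons agree along common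
sides (`IsTiling.exists_map_veech`). Extension to singular points again uses limits along connected
punctured neighbourhoods. That cone points have such neighbourhoods is not immediate from their
definition, which controls only one radius; the polygons exclude the degenerate case
(`IsTiling.not_outer`).

Regularity. A natural covering is a rotation on each polygon. If `x` and `y` have the same image,
then polygons at `x` and `y` can be found that occupy the same point of the same polygon of `Π_n`.
Flag transitivity supplies an isometry carrying one to the other with the right rotation. It
commutes with the covering on one polygon, hence everywhere by unique continuation. -/

noncomputable section

/-! ### Geometry of the regular polygon -/

section RegularPolygon

set_option linter.unusedSectionVars false

variable {n : ℕ} [NeZero n]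

/-- The rotation by `k` steps of the regular `n`-gon, as a unit complex number. -/
def polyRot (n : ℕ) [NeZero n] (k : ZMod n) : ℂ := ZMod.stdAddChar k

/-- The outward unit normal of the `k`-th side. -/
def polyNormal (n : ℕ) [NeZero n] (k : ZMod n) : ℂ := -Complex.I * polyRot n k

/-- The angle between the normal of a side and the direction of its endpoints. -/
def polyAngle (n : ℕ) : ℝ := Real.pi / n

/-- The signed distance of a point to the line through the origin parallel to the `k`-th side. -/
def polyHeight (n : ℕ) [NeZero n] (k : ZMod n) : ℂ →ₗ[ℝ] ℝ :=
  Complex.reLm ∘ₗ LinearMap.mulLeft ℝ ((starRingEnd ℂ) (polyNormal n k))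

lemma polyRot_add (k l : ZMod n) : polyRot n (k + l) = polyRot n k * polyRot n l :=
  AddChar.map_add_eq_mul _ _ _

@[simp] lemma polyRot_zero : polyRot n 0 = 1 := AddChar.map_zero_eq_one _

lemma norm_polyRot (k : ZMod n) : ‖polyRot n k‖ = 1 := by
  rw [polyRot, ZMod.stdAddChar_apply]; exact Circle.norm_coe _

lemma polyRot_ne_zero (k : ZMod n) : polyRot n k ≠ 0 := by
  rw [← norm_ne_zero_iff, norm_polyRot]; exact one_ne_zero

lemma polyRot_intCast (m : ℤ) :
    polyRot n (m : ZMod n) = Complex.exp ((2 * Real.pi * m / n : ℝ) * Complex.I) := by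
  rw [polyRot, ZMod.stdAddChar_coe]; congr 1; push_cast; ring

lemma polyRot_injective : Function.Injective (polyRot n) := ZMod.injective_stdAddChar

lemma polyRot_neg (k : ZMod n) : polyRot n (-k) = (starRingEnd ℂ) (polyRot n k) := by
  have h := Complex.mul_conj (polyRot n k)
  rw [Complex.normSq_eq_norm_sq, norm_polyRot] at h
  have h2 : polyRot n k * polyRot n (-k) = 1 := by rw [← polyRot_add]; simp
  exact mul_left_cancel₀ (polyRot_ne_zero k) (by rw [h2, h]; simp)

lemma polyRot_mul_neg (k : ZMod n) : polyRot n k * polyRot n (-k) = 1 := by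
  rw [← polyRot_add]; simp

lemma norm_polyNormal (k : ZMod n) : ‖polyNormal n k‖ = 1 := by
  simp [polyNormal, norm_polyRot]

lemma polyNormal_ne_zero (k : ZMod n) : polyNormal n k ≠ 0 := by
  rw [← norm_ne_zero_iff, norm_polyNormal]; exact one_ne_zero

lemma polyNormal_add (k l : ZMod n) : polyNormal n (k + l) = polyRot n l * polyNormal n k := by
  simp only [polyNormal, polyRot_add]; ring

lemma polyNormal_injective : Function.Injective (polyNormal n) := by
  intro k l h
  exact polyRot_injective (mul_left_cancel₀ (by simp) h)

lemma polyHeight_apply (k : ZMod n) (z : ℂ) :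
    polyHeight n k z = ((starRingEnd ℂ) (polyNormal n k) * z).re := rfl

lemma continuous_polyHeight (k : ZMod n) : Continuous (polyHeight n k) :=
  LinearMap.continuous_of_finiteDimensional _

lemma conj_polyNormal_mul (k : ZMod n) (z : ℂ) :
    (starRingEnd ℂ) (polyNormal n k) * (polyNormal n k * z) = z := by
  rw [← mul_assoc, mul_comm ((starRingEnd ℂ) _), Complex.mul_conj, Complex.normSq_eq_norm_sq,
    norm_polyNormal]; simp

lemma polyHeight_normal_mul (k : ZMod n) (z : ℂ) : polyHeight n k (polyNormal n k * z) = z.re := by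
  rw [polyHeight_apply, conj_polyNormal_mul]

/-- The definition of `polyVertex` uses the representative `k.val`; another one changes the exponent
by a multiple of `2πi`. Free choice of the representative turns addition in `ZMod n` into rotation.
-/
lemma polyVertex_intCast (m : ℤ) : polyVertex n (m : ZMod n) =
    Complex.exp (((-(Real.pi / 2) + (2 * (m : ℝ) - 1) * Real.pi / n : ℝ) : ℂ) * Complex.I) := by
  have hn : (n : ℂ) ≠ 0 := Nat.cast_ne_zero.2 (NeZero.ne n)
  have hv := ZMod.val_intCast (n := n) m
  obtain ⟨q, hq⟩ : ∃ q : ℤ, (((m : ZMod n).val : ℕ) : ℤ) = m - n * q :=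
    ⟨m / n, by rw [hv]; have := Int.emod_add_mul_ediv m n; linarith⟩
  have hq' : (((m : ZMod n).val : ℕ) : ℂ) = m - n * q := by exact_mod_cast hq
  rw [polyVertex, Complex.exp_eq_exp_iff_exists_int]
  refine ⟨-q, ?_⟩
  push_cast
  rw [hq']
  field_simp
  ring

lemma polyVertex_eq (k : ZMod n) :
    polyVertex n k = polyNormal n k * Complex.exp ((-polyAngle n : ℝ) * Complex.I) := by
  obtain ⟨m, rfl⟩ := ZMod.intCast_surjective k
  have hI : -Complex.I = Complex.exp ((-(Real.pi / 2) : ℝ) * Complex.I) := by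
    rw [Complex.exp_mul_I, ← Complex.ofReal_cos, ← Complex.ofReal_sin]; simp
  rw [polyVertex_intCast, polyNormal, polyRot_intCast, hI, ← Complex.exp_add, ← Complex.exp_add]
  congr 1
  rw [polyAngle]
  push_cast
  ring

lemma polyVertex_succ (k : ZMod n) :
    polyVertex n (k + 1) = polyNormal n k * Complex.exp ((polyAngle n : ℝ) * Complex.I) := by
  obtain ⟨m, rfl⟩ := ZMod.intCast_surjective k
  have h1 : (1 : ZMod n) = ((1 : ℤ) : ZMod n) := by simp
  rw [polyVertex_eq, polyNormal_add, h1, polyRot_intCast, mul_comm (Complex.exp _), mul_assoc,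
    ← Complex.exp_add]
  congr 2
  rw [polyAngle]
  push_cast
  ring

lemma polyVertex_add (k l : ZMod n) : polyVertex n (k + l) = polyRot n l * polyVertex n k := by
  rw [polyVertex_eq, polyVertex_eq, polyNormal_add, mul_assoc]

lemma norm_polyVertex (k : ZMod n) : ‖polyVertex n k‖ = 1 := by
  rw [polyVertex_eq, norm_mul, norm_polyNormal, Complex.norm_exp_ofReal_mul_I, one_mul]

lemma polyVertex_ne_zero (k : ZMod n) : polyVertex n k ≠ 0 := by
  rw [← norm_ne_zero_iff, norm_polyVertex]; exact one_ne_zero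

lemma polyVertex_injective : Function.Injective (polyVertex n) := by
  intro k l h
  rw [polyVertex_eq, polyVertex_eq] at h
  exact polyNormal_injective (mul_right_cancel₀ (Complex.exp_ne_zero _) h)

/-- A parametrization of the line through the `k`-th side, by `[-1, 1]` on the side. -/
lemma polySide_param (k : ZMod n) (t : ℝ) :
    AffineMap.lineMap (polyVertex n k) (polyVertex n (k + 1)) t =
      polyNormal n k * ⟨Real.cos (polyAngle n), (2 * t - 1) * Real.sin (polyAngle n)⟩ := by
  rw [polyVertex_eq, polyVertex_succ, AffineMap.lineMap_apply_module, Complex.exp_mul_I,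
    Complex.exp_mul_I, ← Complex.ofReal_cos, ← Complex.ofReal_sin, ← Complex.ofReal_cos,
    ← Complex.ofReal_sin, Complex.real_smul, Complex.real_smul, Real.cos_neg, Real.sin_neg]
  have : (⟨Real.cos (polyAngle n), (2 * t - 1) * Real.sin (polyAngle n)⟩ : ℂ) =
      Real.cos (polyAngle n) + (2 * t - 1 : ℝ) * Real.sin (polyAngle n) * Complex.I := by
    apply Complex.ext <;> simp [-Complex.ofReal_cos, -Complex.ofReal_sin]
  rw [this]
  push_cast
  ring

lemma polyMid_eq (k : ZMod n) : polyMid n k = polyNormal n k * (Real.cos (polyAngle n) : ℂ) := by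
  rw [polyMid, midpoint, polySide_param]
  congr 1
  apply Complex.ext
  · simp [-Complex.ofReal_cos]
  · simp [-Complex.ofReal_cos]

lemma polyMid_add (k l : ZMod n) : polyMid n (k + l) = polyRot n l * polyMid n k := by
  rw [polyMid_eq, polyMid_eq, polyNormal_add, mul_assoc]

lemma polyHeight_vertex_self (k : ZMod n) :
    polyHeight n k (polyVertex n k) = Real.cos (polyAngle n) := by
  rw [polyVertex_eq, polyHeight_normal_mul, Complex.exp_ofReal_mul_I_re, Real.cos_neg]

lemma polyHeight_vertex_succ (k : ZMod n) :
    polyHeight n k (polyVertex n (k + 1)) = Real.cos (polyAngle n) := by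
  rw [polyVertex_succ, polyHeight_normal_mul, Complex.exp_ofReal_mul_I_re]

lemma polyAngle_pos : 0 < polyAngle n :=
  div_pos Real.pi_pos (Nat.cast_pos.2 (NeZero.pos n))

lemma polyHeight_vertex (k : ZMod n) (j : ℕ) :
    polyHeight n k (polyVertex n (k + j)) = Real.cos ((2 * j - 1) * polyAngle n) := by
  rw [polyVertex_add, polyVertex_eq, mul_left_comm, polyHeight_normal_mul]
  have := polyRot_intCast (n := n) j
  rw [Int.cast_natCast] at this
  rw [this, ← Complex.exp_add, ← add_mul, ← Complex.ofReal_add, Complex.exp_ofReal_mul_I_re]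
  congr 1
  rw [polyAngle]
  push_cast
  ring

lemma eq_add_natCast (k l : ZMod n) : ∃ j : ℕ, j < n ∧ l = k + j :=
  ⟨(l - k).val, ZMod.val_lt _, by simp⟩

/-- Vertex `k + j` lies at angle `(2 * j - 1) * π / n` from the `k`-th normal. For `2 ≤ j ≤ n - 1`
this is strictly between `π / n` and `2π - π / n`, where the cosine is below `cos (π / n)`. -/
lemma polyHeight_vertex_lt (k l : ZMod n) (h1 : l ≠ k) (h2 : l ≠ k + 1) :
    polyHeight n k (polyVertex n l) < Real.cos (polyAngle n) := by
  obtain ⟨j, hj, rfl⟩ := eq_add_natCast k l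
  have hj0 : j ≠ 0 := by rintro rfl; simp at h1
  have hj1 : j ≠ 1 := by rintro rfl; simp at h2
  rw [polyHeight_vertex]
  have ha := polyAngle_pos (n := n)
  have hn : (n : ℝ) * polyAngle n = Real.pi := by
    rw [polyAngle]; field_simp [NeZero.ne n]
  have h2j : (2 : ℝ) ≤ j := by exact_mod_cast (by omega : 2 ≤ j)
  have hjn : (j : ℝ) + 1 ≤ n := by exact_mod_cast hj
  rcases le_or_gt ((2 * (j : ℝ) - 1) * polyAngle n) Real.pi with h | h
  · refine Real.cos_lt_cos_of_nonneg_of_le_pi ha.le h ?_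
    nlinarith
  · rw [← Real.cos_two_pi_sub]
    refine Real.cos_lt_cos_of_nonneg_of_le_pi ha.le (by linarith) ?_
    rw [← hn]
    nlinarith

lemma polyHeight_vertex_le (k l : ZMod n) :
    polyHeight n k (polyVertex n l) ≤ Real.cos (polyAngle n) := by
  by_cases h1 : l = k
  · rw [h1, polyHeight_vertex_self]
  by_cases h2 : l = k + 1
  · rw [h2, polyHeight_vertex_succ]
  exact (polyHeight_vertex_lt k l h1 h2).le

lemma cos_polyAngle_pos (hn : 3 ≤ n) : 0 < Real.cos (polyAngle n) := by
  refine Real.cos_pos_of_mem_Ioo ⟨by linarith [polyAngle_pos (n := n), Real.pi_pos], ?_⟩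
  rw [polyAngle]
  exact div_lt_div_of_pos_left Real.pi_pos two_pos (by exact_mod_cast hn)

lemma sin_polyAngle_pos (hn : 3 ≤ n) : 0 < Real.sin (polyAngle n) := by
  refine Real.sin_pos_of_pos_of_lt_pi polyAngle_pos ?_
  rw [polyAngle]
  exact div_lt_self Real.pi_pos (by exact_mod_cast (by omega : 1 < n))

lemma cos_polyAngle_lt_one (hn : 3 ≤ n) : Real.cos (polyAngle n) < 1 := by
  nlinarith [Real.sin_sq_add_cos_sq (polyAngle n), sin_polyAngle_pos hn, cos_polyAngle_pos hn]

/-- Every point of the plane lies in the cone spanned by two consecutive vertices. -/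
lemma exists_mem_sector (hn : 3 ≤ n) (z : ℂ) : ∃ (k : ZMod n) (a b : ℝ), 0 ≤ a ∧ 0 ≤ b ∧
    z = a * polyVertex n k + b * polyVertex n (k + 1) := by
  have ha := polyAngle_pos (n := n)
  have hs := sin_polyAngle_pos hn
  have hc := cos_polyAngle_pos hn
  have hs2 : 0 < Real.sin (2 * polyAngle n) := by rw [Real.sin_two_mul]; positivity
  have h2 : 2 * polyAngle n ≤ Real.pi := by
    rw [polyAngle]
    have : (2 : ℝ) ≤ n := by exact_mod_cast (by omega : 2 ≤ n)
    have hn0 : (0 : ℝ) < n := by linarith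
    rw [mul_div_assoc', div_le_iff₀ hn0]
    nlinarith [Real.pi_pos]
  -- `τ` is the argument of `z`, counted from vertex `0` in units of the central angle `2π / n`. Its
  -- integer part selects the sector, and `ψ` is the remaining angle; the coefficients come from the
  -- law of sines.
  set τ : ℝ := (z.arg + Real.pi / 2 + polyAngle n) / (2 * polyAngle n) with hτ
  set ψ : ℝ := 2 * polyAngle n * Int.fract τ with hψ
  have hψ0 : 0 ≤ ψ := mul_nonneg (by linarith) (Int.fract_nonneg _)
  have hψ1 : ψ ≤ 2 * polyAngle n := by
    have := (Int.fract_lt_one τ).le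
    nlinarith
  refine ⟨(⌊τ⌋ : ZMod n), ‖z‖ * (Real.sin (2 * polyAngle n - ψ) / Real.sin (2 * polyAngle n)),
    ‖z‖ * (Real.sin ψ / Real.sin (2 * polyAngle n)),
    mul_nonneg (norm_nonneg _) (div_nonneg (Real.sin_nonneg_of_nonneg_of_le_pi (by linarith)
      (by linarith)) hs2.le), mul_nonneg (norm_nonneg _) (div_nonneg
      (Real.sin_nonneg_of_nonneg_of_le_pi hψ0 (by linarith)) hs2.le), ?_⟩
  have e0 : polyVertex n (⌊τ⌋ : ZMod n) =
      Complex.exp (((-(Real.pi / 2) + (2 * (⌊τ⌋ : ℝ) - 1) * polyAngle n : ℝ) : ℂ) * Complex.I) := by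
    rw [polyVertex_intCast]; congr 3; rw [polyAngle]; ring
  have e1 : polyVertex n ((⌊τ⌋ : ZMod n) + 1) = polyVertex n (⌊τ⌋ : ZMod n) *
      Complex.exp ((2 * polyAngle n : ℝ) * Complex.I) := by
    rw [polyVertex_succ, polyVertex_eq, mul_assoc, ← Complex.exp_add]
    congr 2
    push_cast
    ring
  have harg : z.arg = (-(Real.pi / 2) + (2 * (⌊τ⌋ : ℝ) - 1) * polyAngle n) + ψ := by
    have h : τ * (2 * polyAngle n) = z.arg + Real.pi / 2 + polyAngle n := by
      rw [hτ]; field_simp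
    have h' := Int.floor_add_fract τ
    rw [hψ]
    linear_combination (-h) - (2 * polyAngle n) * h'
  have key : Complex.exp (ψ * Complex.I) =
      (Real.sin (2 * polyAngle n - ψ) / Real.sin (2 * polyAngle n) : ℝ) +
      (Real.sin ψ / Real.sin (2 * polyAngle n) : ℝ) *
        Complex.exp ((2 * polyAngle n : ℝ) * Complex.I) := by
    have hs2' := hs2.ne'
    apply Complex.ext
    · rw [Complex.add_re, Complex.re_ofReal_mul, Complex.ofReal_re, Complex.exp_ofReal_mul_I_re,
        Complex.exp_ofReal_mul_I_re, Real.sin_sub]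
      field_simp
      ring
    · rw [Complex.add_im, Complex.im_ofReal_mul, Complex.ofReal_im, Complex.exp_ofReal_mul_I_im,
        Complex.exp_ofReal_mul_I_im]
      field_simp
      ring
  conv_lhs => rw [← Complex.norm_mul_exp_arg_mul_I z, harg, Complex.ofReal_add, add_mul,
    Complex.exp_add, ← e0, key]
  rw [e1]
  push_cast
  ring

/-- The sum is invariant under the rotation by one step, which is not the identity. -/
lemma sum_polyVertex (hn : 3 ≤ n) : ∑ k : ZMod n, polyVertex n k = 0 := by
  have h : polyRot n 1 * ∑ k : ZMod n, polyVertex n k = ∑ k : ZMod n, polyVertex n k := by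
    rw [Finset.mul_sum]
    simp_rw [← polyVertex_add]
    exact Equiv.sum_comp (Equiv.addRight (1 : ZMod n)) (polyVertex n)
  have h1 : polyRot n 1 ≠ 1 := by
    rw [← polyRot_zero (n := n)]
    have : Fact (1 < n) := ⟨by omega⟩
    exact fun e => one_ne_zero (polyRot_injective e)
  by_contra h0
  exact h1 (mul_right_cancel₀ h0 (by rw [h, one_mul]))

lemma convex_regPoly : Convex ℝ (regPoly n) := convex_convexHull _ _

lemma polyVertex_mem (k : ZMod n) : polyVertex n k ∈ regPoly n :=
  subset_convexHull _ _ (mem_range_self k)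

lemma polySide_subset (k : ZMod n) : polySide n k ⊆ regPoly n :=
  convex_regPoly.segment_subset (polyVertex_mem _) (polyVertex_mem _)

lemma zero_mem_regPoly (hn : 3 ≤ n) : (0 : ℂ) ∈ regPoly n := by
  have h := (convex_regPoly (n := n)).sum_mem (t := Finset.univ) (w := fun _ : ZMod n => (n : ℝ)⁻¹)
    (z := polyVertex n) (fun _ _ => by positivity)
    (by simp [ZMod.card, NeZero.ne n]) (fun k _ => polyVertex_mem k)
  rwa [← Finset.smul_sum, sum_polyVertex hn, smul_zero] at h

lemma polyHeight_le_of_mem {z : ℂ} (hz : z ∈ regPoly n) (k : ZMod n) :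
    polyHeight n k z ≤ Real.cos (polyAngle n) := by
  have : regPoly n ⊆ polyHeight n k ⁻¹' Iic (Real.cos (polyAngle n)) :=
    convexHull_min (by rintro _ ⟨l, rfl⟩; exact polyHeight_vertex_le k l)
      ((convex_Iic _).linear_preimage _)
  exact this hz

lemma polyHeight_combo (k j : ZMod n) (a b : ℝ) :
    polyHeight n k (a * polyVertex n j + b * polyVertex n (j + 1)) =
      a * polyHeight n k (polyVertex n j) + b * polyHeight n k (polyVertex n (j + 1)) := by
  simp only [← Complex.real_smul, map_add, map_smul, smul_eq_mul]

/-- The regular polygon is the intersection of the half planes of its sides. -/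
lemma mem_regPoly_iff (hn : 3 ≤ n) (z : ℂ) :
    z ∈ regPoly n ↔ ∀ k, polyHeight n k z ≤ Real.cos (polyAngle n) := by
  refine ⟨polyHeight_le_of_mem, fun h => ?_⟩
  obtain ⟨k, a, b, ha, hb, rfl⟩ := exists_mem_sector hn z
  -- In its sector the inequality of side `k` reads `a + b ≤ 1`, so the point is a convex
  -- combination of two vertices and the centre.
  have hk := h k
  rw [polyHeight_combo, polyHeight_vertex_self, polyHeight_vertex_succ] at hk
  have hc := cos_polyAngle_pos hn
  have hab : a + b ≤ 1 := by
    by_contra hab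
    nlinarith [not_le.1 hab]
  have := (convex_regPoly (n := n)).sum_mem (t := Finset.univ) (w := ![a, b, 1 - a - b])
    (z := ![polyVertex n k, polyVertex n (k + 1), 0]) ?_ ?_ ?_
  · simpa [Fin.sum_univ_three] using this
  · intro i _; fin_cases i <;> simp <;> linarith
  · simp [Fin.sum_univ_three]
  · intro i _; fin_cases i
    · exact polyVertex_mem _
    · exact polyVertex_mem _
    · exact zero_mem_regPoly hn

lemma isCompact_regPoly : IsCompact (regPoly n) := (finite_range _).isCompact_convexHull ℝ

instance : CompactSpace (regPoly n) := isCompact_iff_compactSpace.1 isCompact_regPoly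

lemma norm_le_of_mem_regPoly {z : ℂ} (hz : z ∈ regPoly n) : ‖z‖ ≤ 1 := by
  have : regPoly n ⊆ Metric.closedBall 0 1 :=
    convexHull_min (by rintro _ ⟨l, rfl⟩; simp [norm_polyVertex]) (convex_closedBall _ _)
  simpa using this hz

/-- The points of a polygon on its circumscribed circle are the vertices. -/
lemma mem_range_polyVertex_iff {z : ℂ} (hz : z ∈ regPoly n) :
    z ∈ range (polyVertex n) ↔ ‖z‖ = 1 := by
  refine ⟨by rintro ⟨k, rfl⟩; exact norm_polyVertex k, fun h => ?_⟩
  -- Extreme points of a convex hull are among its generators, and by strict convexity of the disc a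
  -- point of norm one is extreme.
  apply extremePoints_convexHull_subset (𝕜 := ℝ)
  rw [mem_extremePoints_iff_left]
  refine ⟨hz, fun x hx y hy hxy => ?_⟩
  by_contra hne
  have hxy' : x ≠ y := by
    rintro rfl
    rw [openSegment_same] at hxy
    exact hne hxy.symm
  have := openSegment_subset_ball_of_ne (E := ℂ) (z := 0) (r := 1)
    (by simpa using norm_le_of_mem_regPoly hx)
    (by simpa using norm_le_of_mem_regPoly hy) hxy' hxy
  simp [h] at this

lemma notMem_range_polyVertex_iff {z : ℂ} (hz : z ∈ regPoly n) :
    z ∉ range (polyVertex n) ↔ ‖z‖ < 1 := by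
  rw [mem_range_polyVertex_iff hz, lt_iff_le_and_ne]
  exact ⟨fun h => ⟨norm_le_of_mem_regPoly hz, h⟩, fun h => h.2⟩

/-- Where one inequality is an equality, every step along the outward normal leaves the polygon;
conversely, the strict inequalities define an open set. -/
lemma interior_regPoly (hn : 3 ≤ n) :
    interior (regPoly n) = {z | ∀ k, polyHeight n k z < Real.cos (polyAngle n)} := by
  apply Subset.antisymm
  · intro z hz k
    refine lt_of_le_of_ne (polyHeight_le_of_mem (interior_subset hz) k) fun he => ?_
    have hc : Tendsto (fun t : ℝ => z + t * polyNormal n k) (𝓝 0) (𝓝 z) := by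
      have : Continuous fun t : ℝ => z + t * polyNormal n k := by fun_prop
      simpa using this.tendsto 0
    have h1 : ∀ᶠ t : ℝ in 𝓝[>] 0, z + t * polyNormal n k ∈ regPoly n :=
      (hc.mono_left nhdsWithin_le_nhds) (mem_interior_iff_mem_nhds.1 hz)
    obtain ⟨t, ht, ht0⟩ := (h1.and self_mem_nhdsWithin).exists
    have := polyHeight_le_of_mem ht k
    rw [map_add, he, mul_comm, polyHeight_normal_mul, Complex.ofReal_re] at this
    have ht0' : (0 : ℝ) < t := ht0
    linarith
  · refine interior_maximal (fun z hz => (mem_regPoly_iff hn z).2 fun k => (hz k).le) ?_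
    rw [Set.ofPred_forall]
    exact isOpen_iInter_of_finite fun k =>
      isOpen_lt (continuous_polyHeight k) continuous_const

lemma polyHeight_of_mem_polySide {z : ℂ} {k : ZMod n} (hz : z ∈ polySide n k) :
    polyHeight n k z = Real.cos (polyAngle n) := by
  rw [polySide, segment_eq_image_lineMap] at hz
  obtain ⟨t, -, rfl⟩ := hz
  rw [polySide_param, polyHeight_normal_mul]

/-- In a sector the point has weights `a + b ≤ 1` on two vertices. No vertex exceeds the height `cos
(π / n)`, so equality forces `a + b = 1`, and each vertex of positive weight attains this height and
is an endpoint of side `k`. -/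
lemma mem_polySide_iff (hn : 3 ≤ n) {z : ℂ} (hz : z ∈ regPoly n) (k : ZMod n) :
    z ∈ polySide n k ↔ polyHeight n k z = Real.cos (polyAngle n) := by
  refine ⟨polyHeight_of_mem_polySide, fun h => ?_⟩
  have hc := cos_polyAngle_pos hn
  obtain ⟨j, a, b, ha, hb, rfl⟩ := exists_mem_sector hn z
  have hj := polyHeight_le_of_mem hz j
  rw [polyHeight_combo] at h hj
  rw [polyHeight_vertex_self, polyHeight_vertex_succ] at hj
  have hab : a + b ≤ 1 := by
    by_contra hab
    nlinarith [not_le.1 hab]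
  have h1 := polyHeight_vertex_le k j
  have h2 := polyHeight_vertex_le k (j + 1)
  have hab1 : a + b = 1 := by
    by_contra hne
    nlinarith [lt_of_le_of_ne hab hne]
  have : Fact (1 < n) := ⟨by omega⟩
  have hv : ∀ l : ZMod n, polyHeight n k (polyVertex n l) = Real.cos (polyAngle n) →
      l = k ∨ l = k + 1 := by
    intro l hl
    by_contra hne
    push Not at hne
    exact (polyHeight_vertex_lt k l hne.1 hne.2).ne hl
  have hend : ∀ l : ZMod n, (l = k ∨ l = k + 1) → polyVertex n l ∈ polySide n k := by
    rintro l (rfl | rfl)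
    · exact left_mem_segment _ _ _
    · exact right_mem_segment _ _ _
  have hseg : ∀ l : ZMod n, (l = k ∨ l = k + 1) → ((l + 1) = k ∨ (l + 1) = k + 1) →
      a * polyVertex n l + b * polyVertex n (l + 1) ∈ polySide n k := by
    intro l hl hl1
    have := (convex_segment (𝕜 := ℝ) (polyVertex n k) (polyVertex n (k + 1))) (hend l hl)
      (hend _ hl1) ha hb hab1
    simpa [polySide] using this
  rcases ha.eq_or_lt with rfl | ha0
  · have hb1 : b = 1 := by linarith
    subst hb1
    simp only [zero_mul, zero_add, one_mul] at h
    simpa using hend _ (hv _ h)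
  rcases hb.eq_or_lt with rfl | hb0
  · have ha1 : a = 1 := by linarith
    subst ha1
    simp only [zero_mul, add_zero, one_mul] at h
    simpa using hend _ (hv _ h)
  refine hseg j (hv j ?_) (hv _ ?_)
  · by_contra hne
    nlinarith [lt_of_le_of_ne h1 hne]
  · by_contra hne
    nlinarith [lt_of_le_of_ne h2 hne]

lemma exists_mem_polySide (hn : 3 ≤ n) {z : ℂ} (hz : z ∈ regPoly n)
    (hi : z ∉ interior (regPoly n)) : ∃ k, z ∈ polySide n k := by
  rw [interior_regPoly hn] at hi
  simp only [mem_ofPred_eq, not_forall, not_lt] at hi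
  obtain ⟨k, hk⟩ := hi
  exact ⟨k, (mem_polySide_iff hn hz k).2 (le_antisymm (polyHeight_le_of_mem hz k) hk)⟩

lemma notMem_interior_of_mem_polySide (hn : 3 ≤ n) {z : ℂ} {k : ZMod n} (hz : z ∈ polySide n k) :
    z ∉ interior (regPoly n) := by
  rw [interior_regPoly hn]
  intro h
  exact (h k).ne (polyHeight_of_mem_polySide hz)

lemma zmod_one_ne_zero (hn : 3 ≤ n) : (1 : ZMod n) ≠ 0 := by
  have : Fact (1 < n) := ⟨by omega⟩
  exact one_ne_zero

lemma zmod_two_ne_zero (hn : 3 ≤ n) : (1 + 1 : ZMod n) ≠ 0 := by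
  intro h
  have h2 : ((2 : ℕ) : ZMod n) = 0 := by rw [← h]; push_cast; norm_num
  rw [ZMod.natCast_eq_zero_iff] at h2
  exact absurd (Nat.le_of_dvd two_pos h2) (by omega)

/-- Two sides meet only at vertices. -/
lemma polySide_unique (hn : 3 ≤ n) {z : ℂ} (hv : z ∉ range (polyVertex n)) {k l : ZMod n}
    (hk : z ∈ polySide n k) (hl : z ∈ polySide n l) : k = l := by
  have hk' := hk
  rw [polySide, segment_eq_image_lineMap] at hk'
  obtain ⟨t, ⟨ht0, ht1⟩, rfl⟩ := hk'
  have ht0' : 0 < t := lt_of_le_of_ne ht0 (by rintro rfl; simp at hv)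
  have ht1' : t < 1 := lt_of_le_of_ne ht1 (by rintro rfl; simp at hv)
  have h := polyHeight_of_mem_polySide hl
  rw [AffineMap.lineMap_apply_module, map_add, map_smul, map_smul, smul_eq_mul, smul_eq_mul] at h
  have h1 := polyHeight_vertex_le l k
  have h2 := polyHeight_vertex_le l (k + 1)
  -- A relatively interior point of side `k` has maximal height over side `l` only if both endpoints
  -- have. Then `k` and `k + 1` both lie in `{l, l + 1}`, which for `n ≥ 3` forces `k = l`.
  have hj : ∀ j : ZMod n, polyHeight n l (polyVertex n j) = Real.cos (polyAngle n) →
      j = l ∨ j = l + 1 := by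
    intro j hj
    by_contra hne
    push Not at hne
    exact (polyHeight_vertex_lt l j hne.1 hne.2).ne hj
  rcases hj k (by by_contra hne; nlinarith [lt_of_le_of_ne h1 hne]) with rfl | rfl
  · rfl
  rcases hj _ (by by_contra hne; nlinarith [lt_of_le_of_ne h2 hne]) with h | h
  · exact absurd (add_left_cancel (a := l) (by rw [← add_assoc, h, add_zero])) (zmod_two_ne_zero hn)
  · exact absurd (by simpa using h) (zmod_one_ne_zero hn)

lemma rot_mem_regPoly (l : ZMod n) {z : ℂ} (hz : z ∈ regPoly n) :
    polyRot n l * z ∈ regPoly n := by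
  have : regPoly n ⊆ LinearMap.mulLeft ℝ (polyRot n l) ⁻¹' regPoly n := by
    refine convexHull_min ?_ (convex_regPoly.linear_preimage _)
    rintro _ ⟨k, rfl⟩
    change polyRot n l * polyVertex n k ∈ regPoly n
    rw [← polyVertex_add]
    exact polyVertex_mem _
  exact this hz

lemma rot_mem_polySide (k l : ZMod n) {z : ℂ} (hz : z ∈ polySide n k) :
    polyRot n l * z ∈ polySide n (k + l) := by
  rw [polySide, segment_eq_image_lineMap] at hz ⊢
  obtain ⟨t, ht, rfl⟩ := hz
  refine ⟨t, ht, ?_⟩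
  rw [polySide_param, polySide_param, polyNormal_add, mul_assoc]

lemma rot_mem_range_polyVertex_iff (l : ZMod n) (z : ℂ) :
    polyRot n l * z ∈ range (polyVertex n) ↔ z ∈ range (polyVertex n) := by
  constructor
  · rintro ⟨k, hk⟩
    refine ⟨k + -l, ?_⟩
    rw [polyVertex_add, hk, ← mul_assoc, mul_comm (polyRot n (-l)), polyRot_mul_neg, one_mul]
  · rintro ⟨k, rfl⟩
    exact ⟨k + l, polyVertex_add k l⟩

lemma mem_interior_of_norm_lt (hn : 3 ≤ n) {z : ℂ} (hz : ‖z‖ < Real.cos (polyAngle n)) :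
    z ∈ interior (regPoly n) := by
  rw [interior_regPoly hn]
  intro k
  refine lt_of_le_of_lt ((Complex.re_le_norm _).trans ?_) hz
  rw [LinearMap.mulLeft_apply, norm_mul, RCLike.norm_conj, norm_polyNormal, one_mul]

lemma zero_mem_interior (hn : 3 ≤ n) : (0 : ℂ) ∈ interior (regPoly n) :=
  mem_interior_of_norm_lt hn (by simpa using cos_polyAngle_pos hn)

/-- Near a non-vertex point of the `k`-th side, the polygon is the half plane of that side. -/
lemma eventually_mem_interior_iff (hn : 3 ≤ n) {z : ℂ} {k : ZMod n} (hz : z ∈ polySide n k)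
    (hv : z ∉ range (polyVertex n)) :
    ∀ᶠ t : ℂ in 𝓝 0, (z + t ∈ interior (regPoly n) ↔ polyHeight n k t < 0) ∧
      (z + t ∈ regPoly n ↔ polyHeight n k t ≤ 0) := by
  have hk := polyHeight_of_mem_polySide hz
  have hzm := polySide_subset k hz
  -- The inequalities of the other sides are strict at `z` and persist nearby; only that of side `k`
  -- remains.
  have h1 : ∀ l, l ≠ k → ∀ᶠ t : ℂ in 𝓝 0, polyHeight n l (z + t) < Real.cos (polyAngle n) := by
    intro l hl
    have hlt : polyHeight n l (z + 0) < Real.cos (polyAngle n) := by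
      rw [add_zero]
      refine lt_of_le_of_ne (polyHeight_le_of_mem hzm l) fun he => hl ?_
      exact polySide_unique hn hv ((mem_polySide_iff hn hzm l).2 he) hz
    have hcont : Continuous fun t : ℂ => polyHeight n l (z + t) :=
      (continuous_polyHeight l).comp (by fun_prop)
    exact hcont.continuousAt.eventually_lt continuousAt_const hlt
  have h2 : ∀ᶠ t : ℂ in 𝓝 0, ∀ l, l ≠ k →
      polyHeight n l (z + t) < Real.cos (polyAngle n) := by
    rw [eventually_all]
    intro l
    by_cases hl : l = k
    · simp [hl]
    · simpa [hl] using h1 l hl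
  filter_upwards [h2] with t ht
  rw [interior_regPoly hn, mem_regPoly_iff hn]
  constructor
  · refine ⟨fun h => ?_, fun h l => ?_⟩
    · have := h k
      rw [map_add, hk] at this
      linarith
    · by_cases hl : l = k
      · rw [hl, map_add, hk]; linarith
      · exact ht l hl
  · refine ⟨fun h => ?_, fun h l => ?_⟩
    · have := h k
      rw [map_add, hk] at this
      linarith
    · by_cases hl : l = k
      · rw [hl, map_add, hk]; linarith
      · exact (ht l hl).le

lemma polyMid_mem_polySide (k : ZMod n) : polyMid n k ∈ polySide n k := midpoint_mem_segment _ _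

lemma norm_polyMid (hn : 3 ≤ n) (k : ZMod n) : ‖polyMid n k‖ = Real.cos (polyAngle n) := by
  rw [polyMid_eq, norm_mul, norm_polyNormal, one_mul, Complex.norm_real, Real.norm_eq_abs,
    abs_of_pos (cos_polyAngle_pos hn)]

lemma polyMid_notMem_range (hn : 3 ≤ n) (k : ZMod n) : polyMid n k ∉ range (polyVertex n) := by
  rw [notMem_range_polyVertex_iff (polySide_subset k (polyMid_mem_polySide k)), norm_polyMid hn]
  exact cos_polyAngle_lt_one hn

end RegularPolygon

/-! ### Topological preliminaries -/

section Topological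

set_option linter.unusedSectionVars false

variable {X Y Z : Type*} [TopologicalSpace X] [TopologicalSpace Y] [TopologicalSpace Z]

/-- Along a filter with a basis of connected sets, a function that approaches a finite set
converges to one of its points. -/
lemma exists_tendsto_of_tendsto_nhdsSet_finite [T2Space Y] {l : Filter X} [l.NeBot]
    (hl : ∀ s ∈ l, ∃ t ∈ l, t ⊆ s ∧ IsPreconnected t) {F : X → Y} {s : Set X} (hs : s ∈ l)
    (hF : ContinuousOn F s) {K : Set Y} (hK : K.Finite) (h : Tendsto F l (𝓝ˢ K)) :
    ∃ y ∈ K, Tendsto F l (𝓝 y) := by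
  obtain ⟨U, hU, hd⟩ := hK.t2_separation
  have hUK : (⋃ y ∈ K, U y) ∈ 𝓝ˢ K :=
    (isOpen_biUnion fun y _ => (hU y).2).mem_nhdsSet.2
      fun y hy => mem_biUnion hy (hU y).1
  -- The neighbourhoods `U y` are disjoint, so the connected set `t` is mapped into a single one;
  -- its `y` is the limit.
  obtain ⟨t, ht, hts, htc⟩ := hl _ (inter_mem hs (h hUK))
  obtain ⟨a, ha⟩ := Filter.nonempty_of_mem ht
  obtain ⟨y, hy, hay⟩ := mem_iUnion₂.1 (hts ha).2
  have hopen : IsOpen (⋃ y' ∈ K \ {y}, U y') := isOpen_biUnion fun y _ => (hU y).2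
  have hdis : Disjoint (U y) (⋃ y' ∈ K \ {y}, U y') := by
    rw [disjoint_iUnion₂_right]
    exact fun y' hy' => hd hy hy'.1 (Ne.symm hy'.2)
  have hFt : F '' t ⊆ U y := by
    refine (htc.image F (hF.mono fun x hx => (hts hx).1)).subset_left_of_subset_union (hU y).2
      hopen hdis ?_ ⟨F a, mem_image_of_mem F ha, hay⟩
    rintro _ ⟨x, hx, rfl⟩
    obtain ⟨y', hy', hx'⟩ := mem_iUnion₂.1 (hts hx).2
    by_cases he : y' = y
    · exact Or.inl (he ▸ hx')
    · exact Or.inr (mem_biUnion (show y' ∈ K \ {y} from ⟨hy', he⟩) hx')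
  refine ⟨y, hy, tendsto_nhds.2 fun V hV hyV => ?_⟩
  have hVK : V ∪ (⋃ y' ∈ K \ {y}, U y') ∈ 𝓝ˢ K := by
    refine (hV.union hopen).mem_nhdsSet.2 fun y' hy' => ?_
    by_cases he : y' = y
    · exact Or.inl (he ▸ hyV)
    · exact Or.inr (mem_biUnion (show y' ∈ K \ {y} from ⟨hy', he⟩) (hU y').1)
  filter_upwards [ht, h hVK] with x hx hx'
  refine hx'.resolve_right fun h' => ?_
  exact disjoint_left.1 hdis (hFt (mem_image_of_mem F hx)) h'

/-- For a closed map every neighbourhood of a fibre contains the preimage of a neighbourhood of the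
base point. Together with finiteness of the fibre this produces limits of lifts at singular points.
-/
lemma IsClosedMap.tendsto_nhdsSet_preimage {p : Y → Z} (hp : IsClosedMap p) {l : Filter X}
    {F : X → Y} {z : Z} (h : Tendsto (p ∘ F) l (𝓝 z)) : Tendsto F l (𝓝ˢ (p ⁻¹' {z})) :=
  (tendsto_comap_iff.2 h).mono_right (isClosedMap_iff_comap_nhds_le.1 hp)

/-- Removing a closed set of points with connected punctured neighbourhoods from a connected space
leaves a connected set. -/
lemma isPreconnected_compl_of_punctured_nhds [PreconnectedSpace X] {F : Set X} (hF : IsClosed F)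
    (h : ∀ x ∈ F, ∃ U : Set X, IsPreconnected U ∧ U.Nonempty ∧ U ⊆ Fᶜ ∧ insert x U ∈ 𝓝 x) :
    IsPreconnected Fᶜ := by
  choose! U hUc hUn hUF hUx using h
  rw [isPreconnected_iff_subset_of_disjoint]
  intro u v hu hv huv hdis
  -- A separation of the complement extends over `F`: a point of `F` joins the side containing its
  -- connected set `U x`, and the enlarged sides stay open.
  have key : ∀ w : Set X, IsOpen w → IsOpen ((Fᶜ ∩ w) ∪ {x | x ∈ F ∧ U x ⊆ w}) := by
    intro w hw
    rw [isOpen_iff_mem_nhds]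
    rintro x (hx | ⟨hxF, hx⟩)
    · exact mem_of_superset ((hF.isOpen_compl.inter hw).mem_nhds hx) subset_union_left
    · refine mem_of_superset (hUx x hxF) (insert_subset (Or.inr ⟨hxF, hx⟩) fun y hy => ?_)
      exact Or.inl ⟨hUF x hxF hy, hx hy⟩
  set A := (Fᶜ ∩ u) ∪ {x | x ∈ F ∧ U x ⊆ u} with hA
  set B := (Fᶜ ∩ v) ∪ {x | x ∈ F ∧ U x ⊆ v} with hB
  have hAB : A ∪ B = univ := by
    refine eq_univ_of_forall fun x => ?_
    by_cases hx : x ∈ F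
    · have := isPreconnected_iff_subset_of_disjoint.1 (hUc x hx) u v hu hv
        ((hUF x hx).trans huv) (subset_eq_empty (inter_subset_inter_left _ (hUF x hx)) hdis)
      rcases this with h' | h'
      · exact Or.inl (Or.inr ⟨hx, h'⟩)
      · exact Or.inr (Or.inr ⟨hx, h'⟩)
    · rcases huv hx with h' | h'
      · exact Or.inl (Or.inl ⟨hx, h'⟩)
      · exact Or.inr (Or.inl ⟨hx, h'⟩)
  have hABd : A ∩ B = ∅ := by
    rw [eq_empty_iff_forall_notMem]
    rintro x ⟨hx1 | ⟨hxF, hx1⟩, hx2 | ⟨hxF', hx2⟩⟩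
    · exact notMem_empty x (hdis ▸ ⟨hx1.1, hx1.2, hx2.2⟩)
    · exact hx1.1 hxF'
    · exact hx2.1 hxF
    · obtain ⟨y, hy⟩ := hUn x hxF
      exact notMem_empty y (hdis ▸ ⟨hUF x hxF hy, hx1 hy, hx2 hy⟩)
  rcases isPreconnected_iff_subset_of_disjoint.1 isPreconnected_univ A B (key u hu) (key v hv)
    hAB.ge (by rw [univ_inter, hABd]) with h' | h'
  · exact Or.inl fun x hx => ((h' (mem_univ x)).resolve_right fun h => hx h.1).2
  · exact Or.inr fun x hx => ((h' (mem_univ x)).resolve_right fun h => hx h.1).2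

/-- A function that is continuous off a finite set and has limits at its points can be corrected
there to a continuous function. -/
lemma exists_continuousMap_of_tendsto [T1Space X] {F : Set X} (hF : F.Finite) {f : X → Y}
    (hf : ContinuousOn f Fᶜ) (h : ∀ x ∈ F, ∃ y, Tendsto f (𝓝[≠] x) (𝓝 y)) :
    ∃ g : C(X, Y), EqOn g f Fᶜ := by
  classical
  choose L hL using h
  set g : X → Y := fun x => if hx : x ∈ F then L x hx else f x with hg
  have hgf : EqOn g f Fᶜ := fun x hx => dif_neg hx
  refine ⟨⟨g, continuous_iff_continuousAt.2 fun x => ?_⟩, hgf⟩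
  by_cases hx : x ∈ F
  · rw [continuousAt_iff_punctured_nhds]
    have : g x = L x hx := dif_pos hx
    rw [this]
    refine (hL x hx).congr' ?_
    have h1 : (F \ {x})ᶜ ∈ 𝓝 x :=
      (hF.subset sdiff_subset).isClosed.isOpen_compl.mem_nhds (by simp)
    filter_upwards [mem_nhdsWithin_of_mem_nhds h1, self_mem_nhdsWithin] with y hy hyx
    exact (hgf fun hyF => hy ⟨hyF, hyx⟩).symm
  · have hn : Fᶜ ∈ 𝓝 x := hF.isClosed.isOpen_compl.mem_nhds hx
    exact (hf.continuousAt hn).congr (mem_of_superset hn fun y hy => (hgf hy).symm)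

/-- To check a local property at `x` in a space covered by finitely many compact pieces, it
suffices to check it on each piece. -/
lemma eventually_nhds_of_finite_cover {J K : Type*} [Finite J] [TopologicalSpace K]
    [CompactSpace K] [T2Space X] (f : J → C(K, X)) (hf : ∀ x, ∃ i z, f i z = x) {P : X → Prop}
    {x : X} (h : ∀ i z, f i z = x → ∀ᶠ z' in 𝓝 z, P (f i z')) : ∀ᶠ x' in 𝓝 x, P x' := by
  set Φ : (Σ _ : J, K) → X := fun a => f a.1 a.2 with hΦ
  have hc : Continuous Φ := continuous_sigma fun i => (f i).continuous
  have h1 : ∀ᶠ a in 𝓝ˢ (Φ ⁻¹' {x}), P (Φ a) := by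
    rw [eventually_nhdsSet_iff_forall]
    rintro ⟨i, z⟩ hz
    rw [Sigma.nhds_mk, eventually_map]
    exact h i z hz
  have h2 := isClosedMap_iff_comap_nhds_le.1 hc.isClosedMap h1
  obtain ⟨U, hU, hUP⟩ := mem_comap.1 h2
  filter_upwards [hU] with y hy
  obtain ⟨i, z, rfl⟩ := hf y
  exact hUP (show (⟨i, z⟩ : Σ _ : J, K) ∈ Φ ⁻¹' U from hy)

/-- The quotient of a compact Hausdorff space by a closed relation is Hausdorff. -/
lemma Topology.IsQuotientMap.t2Space_of_isClosed [CompactSpace X] [T2Space X] {f : X → Y}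
    (hf : IsQuotientMap f) (h : IsClosed {a : X × X | f a.1 = f a.2}) : T2Space Y := by
  have hcl : IsClosedMap f := by
    intro C hC
    rw [← hf.isClosed_preimage]
    have : f ⁻¹' (f '' C) = Prod.snd '' ({a : X × X | f a.1 = f a.2} ∩ Prod.fst ⁻¹' C) := by
      ext x
      constructor
      · rintro ⟨y, hy, hxy⟩
        exact ⟨(y, x), ⟨hxy, hy⟩, rfl⟩
      · rintro ⟨⟨y, x'⟩, ⟨hxy, hy⟩, rfl⟩
        exact ⟨y, hy, hxy⟩
    rw [this]
    exact ((h.inter (hC.preimage continuous_fst)).isCompact.image continuous_snd).isClosed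
  have hfib : ∀ y, IsClosed (f ⁻¹' {y}) := by
    intro y
    obtain ⟨x, rfl⟩ := hf.surjective y
    have : f ⁻¹' {f x} = (fun x' => (x', x)) ⁻¹' {a : X × X | f a.1 = f a.2} := rfl
    rw [this]
    exact h.preimage (by fun_prop)
  rw [t2Space_iff_disjoint_nhds]
  intro y y' hne
  rw [← disjoint_comap_iff hf.surjective]
  refine Disjoint.mono (isClosedMap_iff_comap_nhds_le.1 hcl) (isClosedMap_iff_comap_nhds_le.1 hcl)
    (SeparatedNhds.disjoint_nhdsSet (SeparatedNhds.of_isCompact_isCompact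
      (hfib y).isCompact (hfib y').isCompact ?_))
  exact Disjoint.preimage f (by simpa using hne)

end Topological

/-! ### Translations and developments in a translation atlas -/

/-- The charts of `D` cover the complement of the singular set, and change by translations. -/
structure FlatAtlas.IsTranslational {S : Type*} [TopologicalSpace S] (D : FlatAtlas S) : Prop where
  source_subset : ∀ φ ∈ D.charts, φ.source ⊆ D.singᶜ
  cover : ∀ x ∉ D.sing, ∃ φ ∈ D.charts, x ∈ φ.source
  translation : ∀ φ ∈ D.charts, ∀ ψ ∈ D.charts, ∀ x ∈ φ.source ∩ ψ.source,
    ∃ b : ℂ, ∀ᶠ y in 𝓝 x, ψ y = φ y + b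

section Move

variable {S X Y : Type*} [TopologicalSpace S] [TopologicalSpace X] [TopologicalSpace Y]

lemma FlatAtlas.IsTranslationSurface.isTranslational {D : FlatAtlas S}
    (h : D.IsTranslationSurface) : D.IsTranslational :=
  ⟨h.isConeSurface.source_subset, h.isConeSurface.cover, h.translation⟩

open Classical in
/-- The point at position `t` from `x` in a chart at `x`; only relevant for small `t`. -/
def FlatAtlas.move (D : FlatAtlas S) (x : S) (t : ℂ) : S :=
  if h : ∃ φ ∈ D.charts, x ∈ φ.source then h.choose.symm (h.choose x + t) else x

/-- Near `ξ`, the map `F` to the translation surface is developed by the map `δ` to the plane. -/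
def FlatAtlas.DevAt (D : FlatAtlas S) (F : X → S) (δ : X → ℂ) (ξ : X) : Prop :=
  ∀ᶠ y in 𝓝 ξ, F y = D.move (F ξ) (δ y - δ ξ)

variable {D : FlatAtlas S}

namespace FlatAtlas.IsTranslational

variable (hT : D.IsTranslational) {x : S}

include hT

lemma isClosed_sing : IsClosed D.sing := by
  rw [← isOpen_compl_iff, isOpen_iff_mem_nhds]
  intro x hx
  obtain ⟨φ, hφ, hxφ⟩ := hT.cover x hx
  exact mem_of_superset (φ.open_source.mem_nhds hxφ) (hT.source_subset φ hφ)

lemma exists_move_eq (hx : x ∉ D.sing) :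
    ∃ φ ∈ D.charts, x ∈ φ.source ∧ ∀ t, D.move x t = φ.symm (φ x + t) := by
  have h := hT.cover x hx
  refine ⟨h.choose, h.choose_spec.1, h.choose_spec.2, fun t => ?_⟩
  rw [FlatAtlas.move, dif_pos h]

lemma move_zero (hx : x ∉ D.sing) : D.move x 0 = x := by
  obtain ⟨φ, hφ, hxφ, h⟩ := hT.exists_move_eq hx
  rw [h, add_zero, φ.left_inv hxφ]

lemma tendsto_move (hx : x ∉ D.sing) : Tendsto (D.move x) (𝓝 0) (𝓝 x) := by
  obtain ⟨φ, hφ, hxφ, h⟩ := hT.exists_move_eq hx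
  have h1 : Tendsto (fun t : ℂ => φ x + t) (𝓝 0) (𝓝 (φ x)) := by
    have : Continuous fun t : ℂ => φ x + t := by fun_prop
    simpa using this.tendsto 0
  have := (φ.tendsto_symm hxφ).comp h1
  exact this.congr fun t => (h t).symm

lemma chart_eventuallyEq {φ ψ : OpenPartialHomeomorph S ℂ} (hφ : φ ∈ D.charts)
    (hψ : ψ ∈ D.charts) (hxφ : x ∈ φ.source) (hxψ : x ∈ ψ.source) :
    ∀ᶠ y in 𝓝 x, ψ y - ψ x = φ y - φ x := by
  obtain ⟨b, hb⟩ := hT.translation φ hφ ψ hψ x ⟨hxφ, hxψ⟩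
  filter_upwards [hb] with y hy
  rw [hy, hb.self_of_nhds]; ring

lemma chart_move {φ : OpenPartialHomeomorph S ℂ} (hφ : φ ∈ D.charts) (hxφ : x ∈ φ.source) :
    ∀ᶠ t in 𝓝 (0 : ℂ), D.move x t ∈ φ.source ∧ φ (D.move x t) = φ x + t := by
  have hx := hT.source_subset φ hφ hxφ
  obtain ⟨ψ, hψ, hxψ, h⟩ := hT.exists_move_eq hx
  have h1 : Tendsto (fun t : ℂ => ψ x + t) (𝓝 0) (𝓝 (ψ x)) := by
    have : Continuous fun t : ℂ => ψ x + t := by fun_prop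
    simpa using this.tendsto 0
  filter_upwards [(hT.tendsto_move hx).eventually (hT.chart_eventuallyEq hφ hψ hxφ hxψ),
    (hT.tendsto_move hx).eventually (φ.open_source.mem_nhds hxφ),
    h1.eventually (ψ.open_target.mem_nhds (ψ.map_source hxψ))] with t h1 h2 h3
  refine ⟨h2, ?_⟩
  rw [h t, ψ.right_inv h3] at h1
  rw [h t]
  linear_combination -h1

lemma move_chart {φ : OpenPartialHomeomorph S ℂ} (hφ : φ ∈ D.charts) (hxφ : x ∈ φ.source) :
    ∀ᶠ y in 𝓝 x, D.move x (φ y - φ x) = y := by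
  have hx := hT.source_subset φ hφ hxφ
  obtain ⟨ψ, hψ, hxψ, h⟩ := hT.exists_move_eq hx
  filter_upwards [hT.chart_eventuallyEq hφ hψ hxφ hxψ, ψ.open_source.mem_nhds hxψ] with y h1 h2
  rw [h, ← h1, add_sub_cancel, ψ.left_inv h2]

/-- This translates statements about points near `x` into statements about small displacements,
without a choice of chart. -/
lemma map_move_nhds (hx : x ∉ D.sing) : map (D.move x) (𝓝 0) = 𝓝 x := by
  apply le_antisymm (hT.tendsto_move hx)
  obtain ⟨φ, hφ, hxφ⟩ := hT.cover x hx
  intro s hs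
  have h1 : Tendsto (fun y => φ y - φ x) (𝓝 x) (𝓝 0) :=
    tendsto_sub_nhds_zero_iff.2 (φ.continuousAt hxφ)
  filter_upwards [h1.eventually hs, hT.move_chart hφ hxφ] with y hy hy'
  rwa [hy'] at hy

lemma eventually_move_notMem (hx : x ∉ D.sing) : ∀ᶠ t in 𝓝 (0 : ℂ), D.move x t ∉ D.sing :=
  (hT.tendsto_move hx).eventually (hT.isClosed_sing.isOpen_compl.mem_nhds hx)

lemma move_move (hx : x ∉ D.sing) : ∀ᶠ s in 𝓝 (0 : ℂ), ∀ᶠ t in 𝓝 (0 : ℂ),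
    D.move (D.move x s) t = D.move x (s + t) := by
  obtain ⟨φ, hφ, hxφ⟩ := hT.cover x hx
  have h := hT.chart_move hφ hxφ
  filter_upwards [h, eventually_eventually_nhds.2 h] with s hs hs'
  have h1 : Tendsto (fun t : ℂ => s + t) (𝓝 0) (𝓝 s) := by
    have : Continuous fun t : ℂ => s + t := by fun_prop
    simpa using this.tendsto 0
  filter_upwards [hT.chart_move hφ hs.1, h1.eventually hs'] with t ht1 ht2
  refine φ.injOn ht1.1 ht2.1 ?_
  rw [ht1.2, ht2.2, hs.2]; ring

lemma devAt_of_chart {F : X → S} {δ : X → ℂ} {ξ : X} {φ : OpenPartialHomeomorph S ℂ}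
    (hφ : φ ∈ D.charts) (hxφ : F ξ ∈ φ.source) (hF : ContinuousAt F ξ) {b : ℂ}
    (h : ∀ᶠ y in 𝓝 ξ, φ (F y) = δ y + b) : D.DevAt F δ ξ := by
  filter_upwards [hF.eventually (hT.move_chart hφ hxφ), h] with y h1 h2
  have h0 := h.self_of_nhds
  rw [← h1, h2, h0]
  congr 1
  ring

end FlatAtlas.IsTranslational

namespace FlatAtlas.DevAt

variable {F G : X → S} {δ δ' : X → ℂ} {ξ : X}

lemma chart (h : D.DevAt F δ ξ) (hT : D.IsTranslational) (hδ : ContinuousAt δ ξ)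
    {φ : OpenPartialHomeomorph S ℂ} (hφ : φ ∈ D.charts) (hxφ : F ξ ∈ φ.source) :
    ∀ᶠ y in 𝓝 ξ, F y ∈ φ.source ∧ φ (F y) = φ (F ξ) + (δ y - δ ξ) := by
  have h1 : Tendsto (fun y => δ y - δ ξ) (𝓝 ξ) (𝓝 0) := tendsto_sub_nhds_zero_iff.2 hδ
  filter_upwards [h, h1.eventually (hT.chart_move hφ hxφ)] with y hy hy'
  rwa [hy]

lemma comp (h : D.DevAt F δ ξ) {u : Y → X} {η : Y} (hu : ContinuousAt u η) (hη : u η = ξ) :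
    D.DevAt (F ∘ u) (δ ∘ u) η := by
  subst hη
  exact hu.eventually h

lemma congr (h : D.DevAt F δ ξ) (hδ : ∀ᶠ y in 𝓝 ξ, δ' y - δ' ξ = δ y - δ ξ) :
    D.DevAt F δ' ξ := by
  filter_upwards [h, hδ] with y h1 h2
  rw [h1, h2]

lemma eventuallyEq (h : D.DevAt F δ ξ) (h' : D.DevAt G δ ξ) (he : F ξ = G ξ) :
    ∀ᶠ y in 𝓝 ξ, F y = G y := by
  filter_upwards [h, h'] with y h1 h2
  rw [h1, h2, he]

lemma eventually (h : D.DevAt F δ ξ) (hT : D.IsTranslational) (hx : F ξ ∉ D.sing)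
    (hδ : Continuous δ) : ∀ᶠ y in 𝓝 ξ, D.DevAt F δ y := by
  have h1 : Tendsto (fun y => δ y - δ ξ) (𝓝 ξ) (𝓝 0) := tendsto_sub_nhds_zero_iff.2 hδ.continuousAt
  filter_upwards [h1.eventually (hT.move_move hx), eventually_eventually_nhds.2 h]
    with y hy hy'
  have h2 : Tendsto (fun z => δ z - δ y) (𝓝 y) (𝓝 0) := tendsto_sub_nhds_zero_iff.2 hδ.continuousAt
  filter_upwards [h2.eventually hy, hy'] with z hz hz'
  rw [hy'.self_of_nhds, hz, hz']
  congr 1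
  ring

end FlatAtlas.DevAt

/-- Unique continuation: two maps with the same development agree everywhere if they agree at one
point. -/
lemma eq_of_devAt [T2Space S] [PreconnectedSpace X] {F G : X → S} (hF : Continuous F)
    (hG : Continuous G) {δ : X → ℂ} (hFδ : ∀ ξ, D.DevAt F δ ξ) (hGδ : ∀ ξ, D.DevAt G δ ξ) {ξ : X}
    (h : F ξ = G ξ) : F = G := by
  have hc : IsClopen {y | F y = G y} :=
    ⟨isClosed_eq hF hG, isOpen_iff_mem_nhds.2 fun y hy => (hFδ y).eventuallyEq (hGδ y) hy⟩
  funext y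
  exact (eq_univ_iff_forall.1 (hc.eq_univ ⟨ξ, h⟩) y :)

end Move

/-! ### Lifting polygons to the unfolding -/

section PolygonLifts

set_option linter.unusedSectionVars false

variable {n : ℕ} [NeZero n]

/-- The regular polygon without its vertices. -/
def polyCore (n : ℕ) : Set ℂ := regPoly n ∩ Metric.ball 0 1

lemma convex_polyCore : Convex ℝ (polyCore n) := convex_regPoly.inter (convex_ball _ _)

lemma zero_mem_polyCore (hn : 3 ≤ n) : (0 : ℂ) ∈ polyCore n := ⟨zero_mem_regPoly hn, by simp⟩

lemma mem_polyCore_iff (z : regPoly n) : (z : ℂ) ∈ polyCore n ↔ (z : ℂ) ∉ range (polyVertex n) := by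
  rw [notMem_range_polyVertex_iff z.2, polyCore, mem_inter_iff, mem_ball_zero_iff]
  exact and_iff_right z.2

lemma isPreconnected_preimage_val {s : Set ℂ} (hs : Convex ℝ s) :
    IsPreconnected (Subtype.val ⁻¹' s : Set (regPoly n)) := by
  rw [← IsInducing.subtypeVal.isPreconnected_image, Subtype.image_preimage_coe]
  exact (convex_regPoly.inter hs).isPreconnected

lemma finite_vertices : {z : regPoly n | (z : ℂ) ∈ range (polyVertex n)}.Finite :=
  (finite_range (polyVertex n)).preimage Subtype.val_injective.injOn

/-- Every point of the polygon is a limit of non-vertices, even along a segment from the centre. -/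
lemma exists_mem_polyCore_nhds (hn : 3 ≤ n) (z : regPoly n) {s : Set (regPoly n)} (hs : s ∈ 𝓝 z) :
    ∃ w ∈ s, (w : ℂ) ∈ polyCore n ∧ ((z : ℂ) ≠ 0 → w ≠ z) := by
  have hmem : ∀ t : ℝ, t ∈ Ico (0 : ℝ) 1 → (t : ℂ) * z ∈ polyCore n := by
    intro t ht
    refine ⟨?_, ?_⟩
    · have := convex_regPoly.smul_mem_of_zero_mem (zero_mem_regPoly hn) z.2 ⟨ht.1, ht.2.le⟩
      rwa [Complex.real_smul] at this
    · rw [mem_ball_zero_iff, norm_mul, Complex.norm_real, Real.norm_of_nonneg ht.1]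
      have := norm_le_of_mem_regPoly z.2
      nlinarith [norm_nonneg (z : ℂ), ht.1, ht.2]
  have hcont : Tendsto (fun t : ℝ => (t : ℂ) * z) (𝓝 1) (𝓝 (z : ℂ)) := by
    have : Continuous fun t : ℝ => (t : ℂ) * z := by fun_prop
    simpa using this.tendsto 1
  obtain ⟨u, hu, hus⟩ := (mem_nhds_subtype _ z s).1 hs
  have h1 : ∀ᶠ t : ℝ in 𝓝[<] 1, (t : ℂ) * z ∈ u := (hcont.mono_left nhdsWithin_le_nhds) hu
  have h2 : ∀ᶠ t : ℝ in 𝓝[<] 1, t ∈ Ico (0 : ℝ) 1 := by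
    filter_upwards [self_mem_nhdsWithin, nhdsWithin_le_nhds (lt_mem_nhds one_pos)] with t h1 h2
    exact ⟨h2.le, h1⟩
  obtain ⟨t, ht1, ht2⟩ := (h1.and h2).exists
  refine ⟨⟨_, (hmem t ht2).1⟩, hus ht1, hmem t ht2, fun hz he => ?_⟩
  have h3 : (t : ℂ) * z = z := congrArg Subtype.val he
  have h4 : (t : ℂ) = 1 := mul_right_cancel₀ hz (by rw [h3, one_mul])
  exact ht2.2.ne (by exact_mod_cast h4)

lemma exists_near_ne (hn : 3 ≤ n) (z : regPoly n) {s : Set (regPoly n)} (hs : s ∈ 𝓝 z) :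
    ∃ w ∈ s, w ≠ z := by
  by_cases hz : (z : ℂ) = 0
  · have h0 : regPoly n ∈ 𝓝 (z : ℂ) := by
      rw [hz]; exact mem_interior_iff_mem_nhds.1 (zero_mem_interior hn)
    obtain ⟨u, hu, hus⟩ := (mem_nhds_subtype _ z s).1 hs
    have h1 : ∀ᶠ w in 𝓝[≠] (z : ℂ), w ∈ u ∩ regPoly n :=
      mem_nhdsWithin_of_mem_nhds (inter_mem hu h0)
    obtain ⟨w, hw, hne⟩ := (h1.and self_mem_nhdsWithin).exists
    exact ⟨⟨w, hw.2⟩, hus hw.1, fun h => hne (congrArg Subtype.val h)⟩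
  · obtain ⟨w, hw, -, hne⟩ := exists_mem_polyCore_nhds hn z hs
    exact ⟨w, hw, hne hz⟩

lemma eq_of_eqOn_polyCore (hn : 3 ≤ n) {S : Type*} [TopologicalSpace S] [T2Space S]
    {F G : C(regPoly n, S)} (h : ∀ z : regPoly n, (z : ℂ) ∈ polyCore n → F z = G z) : F = G := by
  have hd : Dense {z : regPoly n | (z : ℂ) ∈ polyCore n} := fun z =>
    mem_closure_iff_nhds.2 fun s hs => by
      obtain ⟨w, hw, hw', -⟩ := exists_mem_polyCore_nhds hn z hs
      exact ⟨w, hw, hw'⟩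
  exact ContinuousMap.coe_injective (Continuous.ext_on hd F.continuous G.continuous h)

/-- A ball around the vertex meets the polygon without its vertices in a convex set, which is a
punctured neighbourhood because the other vertices are finitely many. -/
lemma punctured_nhds_preconnected (z : regPoly n) {s : Set (regPoly n)} (hs : s ∈ 𝓝[≠] z)
    (hz : (z : ℂ) ∈ range (polyVertex n)) : ∃ t ∈ 𝓝[≠] z, t ⊆ s ∧ IsPreconnected t := by
  obtain ⟨ε, hε, hεs⟩ := Metric.mem_nhdsWithin_iff.1 hs
  have hf : ({w : regPoly n | (w : ℂ) ∈ range (polyVertex n)} \ {z})ᶜ ∈ 𝓝 z :=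
    (finite_vertices.subset sdiff_subset).isClosed.isOpen_compl.mem_nhds (by simp)
  refine ⟨Subtype.val ⁻¹' (polyCore n ∩ Metric.ball (z : ℂ) ε), ?_, ?_,
    isPreconnected_preimage_val (convex_polyCore.inter (convex_ball _ _))⟩
  · filter_upwards [mem_nhdsWithin_of_mem_nhds hf, self_mem_nhdsWithin,
      mem_nhdsWithin_of_mem_nhds (Metric.ball_mem_nhds z hε)] with w h1 h2 h3
    exact ⟨(mem_polyCore_iff w).2 fun h => h1 ⟨h, h2⟩, h3⟩
  · rintro w ⟨hw, hw'⟩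
    refine hεs ⟨hw', fun h => ?_⟩
    have h' : w = z := h
    rw [h'] at hw
    exact (mem_polyCore_iff z).1 hw hz

variable {S S' : Type*} [TopologicalSpace S] [TopologicalSpace S'] {D : FlatAtlas S}
  {D' : FlatAtlas S'} {p : C(S', S)}

namespace IsUnfolding

variable (hp : IsUnfolding D D' p)

include hp

lemma t2Space : T2Space S' := hp.isTranslationSurface.isConeSurface.hausdorff

lemma compactSpace : CompactSpace S' := hp.isTranslationSurface.isConeSurface.compact

lemma map_mem_sing_iff (x : S') : p x ∈ D.sing ↔ x ∈ D'.sing := by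
  rw [← hp.preimage_sing]; rfl

/-- Polygons lift uniquely to the unfolding. -/
lemma existsUnique_lift [T2Space S] (hn : 3 ≤ n) {F : C(regPoly n, S)}
    (hF : ∀ z, F z ∈ D.sing ↔ (z : ℂ) ∈ range (polyVertex n)) {z₀ : regPoly n}
    (hz₀ : (z₀ : ℂ) ∈ polyCore n) {x : S'} (hx : p x = F z₀) :
    ∃! f : C(regPoly n, S'), p.comp f = F ∧ f z₀ = x := by
  have := hp.t2Space
  have := hp.compactSpace
  -- Without its vertices the polygon is convex, so its map to the complement of the singular set
  -- lifts through the covering.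
  have : ContractibleSpace (polyCore n) := convex_polyCore.contractibleSpace ⟨z₀, hz₀⟩
  have : LocallyPathConnectedSpace (polyCore n) := convex_polyCore.locallyPathConnectedSpace
  let incl : C(polyCore n, regPoly n) := ⟨fun z => ⟨z, z.2.1⟩, by fun_prop⟩
  have hFc : ∀ z, F.comp incl z ∈ D.singᶜ := fun z h =>
    (mem_polyCore_iff (incl z)).1 z.2 ((hF _).1 h)
  obtain ⟨f₀, ⟨hf₀x, hf₀⟩, huniq⟩ := hp.covering.existsUnique_continuousMap_lifts
    (F.comp incl) (a₀ := ⟨z₀, hz₀⟩) (e₀ := x) hx hFc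
  have hpf₀ : ∀ z, p (f₀ z) = F (incl z) := fun z => congrFun hf₀ z
  classical
  set f₁ : regPoly n → S' := fun z => if h : (z : ℂ) ∈ polyCore n then f₀ ⟨z, h⟩ else x with hf₁
  have hf₁v : ∀ z : regPoly n, ∀ h : (z : ℂ) ∈ polyCore n, f₁ z = f₀ ⟨z, h⟩ := fun z h => dif_pos h
  set V : Set (regPoly n) := {z | (z : ℂ) ∈ range (polyVertex n)} with hV
  have hVc : ∀ z : regPoly n, z ∈ Vᶜ ↔ (z : ℂ) ∈ polyCore n := fun z => (mem_polyCore_iff z).symm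
  have hcont : ContinuousOn f₁ Vᶜ := by
    rw [continuousOn_iff_continuous_domRestrict]
    have : Vᶜ.domRestrict f₁ = fun z : ↥Vᶜ => f₀ ⟨z.1, (hVc z.1).1 z.2⟩ := by
      funext z; exact hf₁v z.1 ((hVc z.1).1 z.2)
    rw [this]
    exact f₀.continuous.comp (by fun_prop)
  have hlim : ∀ z ∈ V, ∃ y, Tendsto f₁ (𝓝[≠] z) (𝓝 y) := by
    intro z hz
    have : (𝓝[≠] z).NeBot := by
      rw [← mem_closure_iff_nhdsWithin_neBot, mem_closure_iff_nhds]
      intro s hs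
      obtain ⟨w, hw, hne⟩ := exists_near_ne hn z hs
      exact ⟨w, hw, hne⟩
    have hVn : Vᶜ ∈ 𝓝[≠] z := by
      have hf : (V \ {z})ᶜ ∈ 𝓝 z :=
        (finite_vertices.subset sdiff_subset).isClosed.isOpen_compl.mem_nhds (by simp)
      filter_upwards [mem_nhdsWithin_of_mem_nhds hf, self_mem_nhdsWithin] with w h1 h2
      exact fun h => h1 ⟨h, h2⟩
    -- The fibre over the image of a vertex consists of singular points and is finite; since the
    -- punctured neighbourhoods of the vertex are connected, the lift converges to one point of it.
    have hfin : (p ⁻¹' {F z}).Finite := by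
      refine hp.isTranslationSurface.isConeSurface.finite_sing.subset fun y hy => ?_
      rw [← hp.map_mem_sing_iff, show p y = F z from hy]
      exact (hF z).2 hz
    have hpf₁ : Tendsto (p ∘ f₁) (𝓝[≠] z) (𝓝 (F z)) := by
      refine ((F.continuous.tendsto z).mono_left nhdsWithin_le_nhds).congr' ?_
      filter_upwards [hVn] with w hw
      rw [Function.comp_apply, hf₁v w ((hVc w).1 hw), hpf₀]
      rfl
    obtain ⟨y, -, hy⟩ := exists_tendsto_of_tendsto_nhdsSet_finite
      (fun s hs => punctured_nhds_preconnected z hs hz) hVn hcont hfin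
      (p.continuous.isClosedMap.tendsto_nhdsSet_preimage hpf₁)
    exact ⟨y, hy⟩
  obtain ⟨f, hf⟩ := exists_continuousMap_of_tendsto finite_vertices hcont hlim
  have hff₀ : ∀ z : regPoly n, ∀ h : (z : ℂ) ∈ polyCore n, f z = f₀ ⟨z, h⟩ := fun z h => by
    rw [hf ((hVc z).2 h), hf₁v z h]
  refine ⟨f, ⟨eq_of_eqOn_polyCore hn fun z hz => ?_, ?_⟩, ?_⟩
  · rw [ContinuousMap.comp_apply, hff₀ z hz, hpf₀]
    rfl
  · rw [hff₀ z₀ hz₀, hf₀x]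
  · rintro g ⟨hg, hgx⟩
    refine eq_of_eqOn_polyCore hn fun z hz => ?_
    have := huniq (g.comp incl) ⟨hgx, by rw [← hg]; rfl⟩
    rw [hff₀ z hz, ← this]
    rfl

end IsUnfolding

/-- A family of regular polygons in a translation surface that covers the complement of the
singular set; `a i` is the derivative of the `i`-th polygon. -/
structure IsTiling (D : FlatAtlas S) (n : ℕ) {J : Type*} (f : J → C(regPoly n, S)) (a : J → ℂ) :
    Prop where
  three_le : 3 ≤ n
  dev : ∀ i (z : regPoly n), (z : ℂ) ∈ polyCore n → D.DevAt (f i) (fun w => a i * w) z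
  norm_eq : ∃ s > 0, ∀ i, ‖a i‖ = s
  interior_disjoint : ∀ i j (z w : regPoly n), (z : ℂ) ∈ interior (regPoly n) →
    f i z = f j w → i = j ∧ z = w
  cover : ∀ x ∉ D.sing, ∃ i z, f i z = x
  vertices : ∀ i (z : regPoly n), f i z ∈ D.sing ↔ (z : ℂ) ∈ range (polyVertex n)
  edge_to_edge : ∀ i k, ∃ j l, (j, l) ≠ (i, k) ∧ ∀ t ∈ Icc (0 : ℝ) 1, ∀ z w : regPoly n,
    (z : ℂ) = AffineMap.lineMap (polyVertex n k) (polyVertex n (k + 1)) t →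
    (w : ℂ) = AffineMap.lineMap (polyVertex n (l + 1)) (polyVertex n l) t → f i z = f j w

namespace IsTiling

variable {J : Type*} {f : J → C(regPoly n, S)} {a : J → ℂ} (hf : IsTiling D n f a)

include hf

lemma notMem_sing {i : J} {z : regPoly n} (hz : (z : ℂ) ∈ polyCore n) : f i z ∉ D.sing := by
  rw [hf.vertices, ← mem_polyCore_iff]; exact hz

lemma a_ne_zero (i : J) : a i ≠ 0 := by
  obtain ⟨s, hs, h⟩ := hf.norm_eq
  rw [← norm_ne_zero_iff, h i]; exact hs.ne'

end IsTiling

/-- The derivative of a polygon in a translation surface is unique. -/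
lemma devAt_mul_unique (hn : 3 ≤ n) (hT : D.IsTranslational) {f : C(regPoly n, S)}
    {z : regPoly n} (hz : f z ∉ D.sing) {a b : ℂ} (ha : D.DevAt f (fun w => a * w) z)
    (hb : D.DevAt f (fun w => b * w) z) : a = b := by
  obtain ⟨φ, hφ, hzφ⟩ := hT.cover _ hz
  obtain ⟨w, ⟨h1, h2⟩, hne⟩ := exists_near_ne hn z
    ((ha.chart hT (by fun_prop) hφ hzφ).and (hb.chart hT (by fun_prop) hφ hzφ))
  have h3 := h1.2.symm.trans h2.2
  have h4 : (a - b) * ((w : ℂ) - z) = 0 := by linear_combination h3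
  rcases mul_eq_zero.1 h4 with h | h
  · exact sub_eq_zero.1 h
  · exact absurd (Subtype.ext (sub_eq_zero.1 h)) hne

/-- If the derivative of a polygon exists everywhere off the vertices then it is constant. -/
lemma exists_devAt_mul (hn : 3 ≤ n) (hT : D.IsTranslational) {f : C(regPoly n, S)}
    (hv : ∀ z : regPoly n, (z : ℂ) ∈ polyCore n → f z ∉ D.sing) {s : ℝ}
    (h : ∀ z : regPoly n, (z : ℂ) ∈ polyCore n → ∃ a : ℂ, ‖a‖ = s ∧
      D.DevAt f (fun w => a * w) z) :
    ∃ a : ℂ, ‖a‖ = s ∧ ∀ z : regPoly n, (z : ℂ) ∈ polyCore n → D.DevAt f (fun w => a * w) z := by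
  choose! a ha hdev using h
  have h0 : ((⟨0, zero_mem_regPoly hn⟩ : regPoly n) : ℂ) ∈ polyCore n := zero_mem_polyCore hn
  refine ⟨a ⟨0, zero_mem_regPoly hn⟩, ha _ h0, fun z hz => ?_⟩
  have : a ⟨0, zero_mem_regPoly hn⟩ = a z := by
    refine (isPreconnected_preimage_val (convex_polyCore (n := n))).induction₂
      (fun x y => a x = a y) (fun x hx => ?_) (fun _ _ _ _ _ _ h1 h2 => h1.trans h2)
      (fun _ _ _ _ h => h.symm) h0 hz
    filter_upwards [mem_nhdsWithin_of_mem_nhds ((hdev x hx).eventually hT (hv x hx) (by fun_prop)),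
      self_mem_nhdsWithin] with y hy hyc
    exact devAt_mul_unique hn hT (hv y hyc) hy (hdev y hyc)
  rw [this]
  exact hdev z hz

end PolygonLifts

/-! ### The lifted polygons as a tiling of the unfolding. -/

section LiftedTiling

set_option linter.unusedSectionVars false

variable {n : ℕ} [NeZero n] {S S' ι : Type*} [TopologicalSpace S] [TopologicalSpace S']
  {D : FlatAtlas S} {D' : FlatAtlas S'} {p : C(S', S)} {P : ι → C(regPoly n, S)}

/-- A symmetry of the polygon, as a self-map of the polygon. -/
def polySymm {A : ℂ ≃ᵢ ℂ} (hA : A '' regPoly n = regPoly n) : C(regPoly n, regPoly n) where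
  toFun z := ⟨A z, hA.le (mem_image_of_mem A z.2)⟩
  continuous_toFun := (A.continuous.comp continuous_subtype_val).subtype_mk _

/-- The polygons of a Platonic surface all have the same circumradius. -/
lemma FlatAtlas.IsPlatonic.exists_radius (hD : D.IsPlatonic n P) : ∃ s : ℝ, 0 < s ∧
    ∀ i, ∀ z : regPoly n, P i z ∉ D.sing → ∀ φ ∈ D.charts, P i z ∈ φ.source →
      ∃ a b : ℂ, ‖a‖ = s ∧ ∀ᶠ w : regPoly n in 𝓝 z, φ (P i w) = a * (w : ℂ) + b := by
  have hn := hD.decomposition.three_le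
  choose s hs hs' using hD.decomposition.polygon
  have := hD.connected
  obtain ⟨i₀, -, -⟩ := hD.decomposition.cover (Classical.arbitrary S)
  have heq : ∀ j, s j = s i₀ := by
    intro j
    let z₀ : regPoly n := ⟨0, zero_mem_regPoly hn⟩
    have hz₀ : (z₀ : ℂ) ∈ polyCore n := zero_mem_polyCore hn
    obtain ⟨g, hg, A, ⟨hA, hAg⟩, -, -⟩ := hD.transitive ⟨i₀, 0, 0, Or.inl rfl⟩ ⟨j, 0, 0, Or.inl rfl⟩
    have hgA : ∀ z, g (P i₀ z) = P j (polySymm hA z) := fun z => hAg z (polySymm hA z) rfl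
    have h0 : P i₀ z₀ ∉ D.sing := by
      rw [hD.decomposition.vertices, ← mem_polyCore_iff]; exact hz₀
    have h1 : P j (polySymm hA z₀) ∉ D.sing := by
      rw [← hgA, hg.map_sing]; exact h0
    obtain ⟨φ, hφ, hxφ⟩ := hD.isConeSurface.cover _ h0
    obtain ⟨ψ, hψ, hxψ⟩ := hD.isConeSurface.cover _ h1
    obtain ⟨a, b, ha, hab⟩ := hs' i₀ z₀ h0 φ hφ hxφ
    obtain ⟨a', b', ha', hab'⟩ := hs' j _ h1 ψ hψ hxψ
    obtain ⟨G, hG⟩ := hg.isometry _ h0 φ hφ hxφ ψ hψ (by rw [hgA]; exact hxψ)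
    -- Both `G` and `A` preserve distances, so two distinct nearby points suffice to compare `‖a‖`
    -- with `‖a'‖`.
    have hev : ∀ᶠ w : regPoly n in 𝓝 z₀, G (a * w + b) = a' * A w + b' := by
      filter_upwards [hab, (P i₀).continuous.continuousAt.eventually hG,
        (polySymm hA).continuous.continuousAt.eventually hab'] with w h1 h2 h3
      rw [hgA, h3, h1] at h2
      exact h2.symm
    obtain ⟨w, hw, hne⟩ := exists_near_ne hn z₀ hev
    have h2 := hev.self_of_nhds
    have h3 := G.dist_eq (a * w + b) (a * z₀ + b)
    rw [hw, h2, dist_eq_norm, dist_eq_norm, add_sub_add_right_eq_sub, add_sub_add_right_eq_sub,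
      ← mul_sub, ← mul_sub, norm_mul, norm_mul, ← dist_eq_norm, ← dist_eq_norm, A.dist_eq] at h3
    have h4 : dist (w : ℂ) z₀ ≠ 0 := dist_ne_zero.2 fun h => hne (Subtype.ext h)
    rw [← ha', ← ha]
    exact mul_right_cancel₀ h4 h3
  exact ⟨s i₀, hs i₀, fun i => heq i ▸ hs' i⟩

namespace IsUnfolding

variable (hp : IsUnfolding D D' p) (hD : D.IsPlatonic n P)

include hp hD

lemma exists_lift {i : ι} {z₀ : regPoly n} (hz₀ : (z₀ : ℂ) ∈ polyCore n) {x : S'}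
    (hx : p x = P i z₀) : ∃ f : {f : C(regPoly n, S') // ∃ i, p.comp f = P i},
      p.comp f.1 = P i ∧ f.1 z₀ = x := by
  have := hD.isConeSurface.hausdorff
  obtain ⟨f, ⟨h1, h2⟩, -⟩ := hp.existsUnique_lift hD.decomposition.three_le
    (hD.decomposition.vertices i) hz₀ hx
  exact ⟨⟨f, i, h1⟩, h1, h2⟩

lemma lift_ext {F : C(regPoly n, S)} (hF : ∀ z, F z ∈ D.sing ↔ (z : ℂ) ∈ range (polyVertex n))
    {f g : C(regPoly n, S')} (hf : p.comp f = F) (hg : p.comp g = F) {z₀ : regPoly n}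
    (hz₀ : (z₀ : ℂ) ∈ polyCore n) (h : f z₀ = g z₀) : f = g := by
  have := hD.isConeSurface.hausdorff
  exact (hp.existsUnique_lift hD.decomposition.three_le hF hz₀
    (x := g z₀) (by rw [← hg]; rfl)).unique ⟨hf, h⟩ ⟨hg, rfl⟩

lemma lift_mem_sing_iff (f : {f : C(regPoly n, S') // ∃ i, p.comp f = P i}) (z : regPoly n) :
    liftedDecomposition p P f z ∈ D'.sing ↔ (z : ℂ) ∈ range (polyVertex n) := by
  obtain ⟨i, hi⟩ := f.2
  rw [← hp.map_mem_sing_iff, ← hD.decomposition.vertices i z, ← hi]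
  rfl

/-- A chart of `D`, composed with `p` and turned back by the derivative of `p`, is a translation
coordinate upstairs. Polygons described in charts of `D` can thus be developed in `D'`. -/
lemma exists_chart_derivative {x : S'} (hx : x ∉ D'.sing) {φ : OpenPartialHomeomorph S ℂ}
    (hφ : φ ∈ D.charts) (hxφ : p x ∈ φ.source) : ∃ a : ℂ, ‖a‖ = 1 ∧
      D'.DevAt (fun y => y) (fun y => a⁻¹ * φ (p y)) x := by
  obtain ⟨φ', hφ', hxφ'⟩ := hp.isTranslationSurface.isConeSurface.cover x hx
  obtain ⟨a, b, ha, hab⟩ := hp.isometry x hx φ' hφ' hxφ' φ hφ hxφ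
  have ha0 : a ≠ 0 := by rw [← norm_ne_zero_iff, ha]; exact one_ne_zero
  refine ⟨a, ha, hp.isTranslationSurface.isTranslational.devAt_of_chart hφ' hxφ' continuousAt_id
    (b := -(a⁻¹ * b)) ?_⟩
  filter_upwards [hab] with y hy
  rw [hy]
  field_simp
  ring

lemma exists_devAt_lift {s : ℝ} (hs : ∀ i, ∀ z : regPoly n, P i z ∉ D.sing →
      ∀ φ ∈ D.charts, P i z ∈ φ.source →
      ∃ a b : ℂ, ‖a‖ = s ∧ ∀ᶠ w : regPoly n in 𝓝 z, φ (P i w) = a * (w : ℂ) + b)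
    (f : {f : C(regPoly n, S') // ∃ i, p.comp f = P i}) :
    ∃ a : ℂ, ‖a‖ = s ∧ ∀ z : regPoly n, (z : ℂ) ∈ polyCore n →
      D'.DevAt (liftedDecomposition p P f) (fun w => a * w) z := by
  have hv : ∀ z : regPoly n, (z : ℂ) ∈ polyCore n → liftedDecomposition p P f z ∉ D'.sing :=
    fun z hz => by rw [hp.lift_mem_sing_iff hD, ← mem_polyCore_iff]; exact hz
  refine exists_devAt_mul hD.decomposition.three_le hp.isTranslationSurface.isTranslational hv
    fun z hz => ?_
  obtain ⟨i, hi⟩ := f.2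
  have hpf : ∀ w, p (liftedDecomposition p P f w) = P i w := fun w => by rw [← hi]; rfl
  have hzs : P i z ∉ D.sing := by rw [← hpf, hp.map_mem_sing_iff]; exact hv z hz
  obtain ⟨φ, hφ, hxφ⟩ := hD.isConeSurface.cover _ hzs
  obtain ⟨a, b, ha, hab⟩ := hs i z hzs φ hφ hxφ
  obtain ⟨a', ha', hdev⟩ := hp.exists_chart_derivative hD (hv z hz) hφ (by rw [hpf]; exact hxφ)
  refine ⟨a'⁻¹ * a, by rw [norm_mul, norm_inv, ha', ha]; simp, ?_⟩
  have h1 := hdev.comp (u := liftedDecomposition p P f) (η := z)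
    (liftedDecomposition p P f).continuous.continuousAt rfl
  refine FlatAtlas.DevAt.congr (δ := (fun y => a'⁻¹ * φ (p y)) ∘ liftedDecomposition p P f) h1 ?_
  filter_upwards [hab] with w hw
  simp only [Function.comp_apply, hpf]
  rw [hw, hab.self_of_nhds]
  ring

/-- The lifts of the polygons tile the unfolding. -/
lemma exists_isTiling : ∃ a, IsTiling D' n (liftedDecomposition p P) a := by
  have hn := hD.decomposition.three_le
  obtain ⟨s, hs, hs'⟩ := hD.exists_radius
  choose a ha hdev using hp.exists_devAt_lift hD hs'
  have hlift : ∀ f : {f : C(regPoly n, S') // ∃ i, p.comp f = P i}, ∀ i, p.comp f.1 = P i →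
      ∀ w, p (liftedDecomposition p P f w) = P i w := fun f i hi w => by rw [← hi]; rfl
  refine ⟨a, hn, hdev, ⟨s, hs, ha⟩, ?_, ?_, hp.lift_mem_sing_iff hD, ?_⟩
  · rintro f g z w hz h
    obtain ⟨i, hi⟩ := f.2
    obtain ⟨j, hj⟩ := g.2
    obtain ⟨rfl, rfl⟩ := hD.decomposition.interior_disjoint i j z w hz (by
      rw [← hlift f i hi, ← hlift g j hj, h])
    refine ⟨Subtype.ext (hp.lift_ext hD (hD.decomposition.vertices i) hi hj (z₀ := z) ?_ h), rfl⟩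
    rw [mem_polyCore_iff]
    rintro ⟨k, hk⟩
    exact notMem_interior_of_mem_polySide hn (left_mem_segment ℝ _ _ : _ ∈ polySide n k) (hk ▸ hz)
  · intro x hx
    obtain ⟨i, z, hz⟩ := hD.decomposition.cover (p x)
    have hzc : (z : ℂ) ∈ polyCore n := by
      rw [mem_polyCore_iff, ← hD.decomposition.vertices i z, hz, hp.map_mem_sing_iff]; exact hx
    obtain ⟨f, -, hf⟩ := hp.exists_lift hD hzc hz.symm
    exact ⟨f, z, hf⟩
  · intro f k
    obtain ⟨i, hi⟩ := f.2
    obtain ⟨j, l, hne, hglue⟩ := hD.decomposition.edge_to_edge i k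
    have hside : ∀ (k : ZMod n), ∀ t ∈ Icc (0 : ℝ) 1,
        AffineMap.lineMap (polyVertex n k) (polyVertex n (k + 1)) t ∈ regPoly n := fun k t ht =>
      polySide_subset k (by rw [polySide, segment_eq_image_lineMap]; exact mem_image_of_mem _ ht)
    have hside' : ∀ (k : ZMod n), ∀ t ∈ Icc (0 : ℝ) 1,
        AffineMap.lineMap (polyVertex n (k + 1)) (polyVertex n k) t ∈ regPoly n := fun k t ht =>
      polySide_subset k (by
        rw [polySide, segment_symm, segment_eq_image_lineMap]; exact mem_image_of_mem _ ht)
    -- `u` and `u'` run along two glued sides, in opposite boundary directions. The neighbouring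
    -- lift is pinned down at the midpoint, which is not a vertex; unique lifting extends the
    -- agreement to the open side, and continuity to its endpoints.
    let u : C(unitInterval, regPoly n) :=
      ⟨fun t => ⟨_, hside k t t.2⟩, by
        refine Continuous.subtype_mk ?_ _
        exact AffineMap.lineMap_continuous.comp continuous_subtype_val⟩
    let u' : C(unitInterval, regPoly n) :=
      ⟨fun t => ⟨_, hside' l t t.2⟩, by
        refine Continuous.subtype_mk ?_ _
        exact AffineMap.lineMap_continuous.comp continuous_subtype_val⟩
    have huu' : ∀ t, P i (u t) = P j (u' t) := fun t => hglue t t.2 _ _ rfl rfl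
    let th : unitInterval := ⟨1 / 2, by norm_num, by norm_num⟩
    have hmid : ((u' th : regPoly n) : ℂ) = polyMid n l := by
      change AffineMap.lineMap _ _ (1 / 2 : ℝ) = _
      rw [polyMid, midpoint_comm, midpoint]
      norm_num
    have hmidc : ((u' th : regPoly n) : ℂ) ∈ polyCore n := by
      rw [mem_polyCore_iff, hmid]; exact polyMid_notMem_range hn l
    obtain ⟨g, hg, hgx⟩ := hp.exists_lift hD hmidc (x := f.1 (u th)) (by
      rw [← huu']; exact hlift f i hi _)
    have hcore : ∀ t : unitInterval, t ∈ Ioo (0 : unitInterval) 1 → (u t : ℂ) ∈ polyCore n := by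
      intro t ht
      rw [mem_polyCore_iff, notMem_range_polyVertex_iff (u t).2]
      have := openSegment_subset_ball_of_ne (E := ℂ) (z := 0) (r := 1)
        (x := polyVertex n k) (y := polyVertex n (k + 1))
        (by simp [norm_polyVertex]) (by simp [norm_polyVertex])
        (fun h => zmod_one_ne_zero hn (by simpa using polyVertex_injective h))
      rw [← mem_ball_zero_iff]
      refine this ?_
      rw [openSegment_eq_image_lineMap]
      exact ⟨t, ht, rfl⟩
    have hopen : EqOn (fun t => f.1 (u t)) (fun t => g.1 (u' t)) (Ioo (0 : unitInterval) 1) := by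
      intro t ht
      have hc : IsPreconnected (Ioo (0 : unitInterval) 1) := isPreconnected_Ioo
      have hthm : th ∈ Ioo (0 : unitInterval) 1 := by
        constructor
        · change (0 : ℝ) < 1 / 2; norm_num
        · change (1 / 2 : ℝ) < 1; norm_num
      have hcov := hp.covering.isCoveringMap_restrictPreimage
      have hmem : ∀ t ∈ Ioo (0 : unitInterval) 1, f.1 (u t) ∈ p ⁻¹' D.singᶜ := by
        intro t ht
        change p (f.1 (u t)) ∉ D.sing
        rw [hp.map_mem_sing_iff]
        exact (hp.lift_mem_sing_iff hD f _).not.2 ((mem_polyCore_iff _).1 (hcore t ht))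
      have hmem' : ∀ t ∈ Ioo (0 : unitInterval) 1, g.1 (u' t) ∈ p ⁻¹' D.singᶜ := by
        intro t ht
        have := hmem t ht
        change p (f.1 (u t)) ∉ D.sing at this
        change p (g.1 (u' t)) ∉ D.sing
        rwa [show p (g.1 (u' t)) = P j (u' t) from hlift g j hg _, ← huu',
          ← hlift f i hi]
      have : PreconnectedSpace (Ioo (0 : unitInterval) 1) := Subtype.preconnectedSpace hc
      have key := hcov.eq_of_comp_eq (A := Ioo (0 : unitInterval) 1)
        (g₁ := fun t => ⟨f.1 (u t), hmem t t.2⟩) (g₂ := fun t => ⟨g.1 (u' t), hmem' t t.2⟩)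
        (by fun_prop) (by fun_prop) (by
          funext t
          refine Subtype.ext ?_
          change p (f.1 (u t)) = p (g.1 (u' t))
          rw [show p (f.1 (u t)) = P i (u t) from hlift f i hi _,
            show p (g.1 (u' t)) = P j (u' t) from hlift g j hg _, huu'])
        ⟨th, hthm⟩ (Subtype.ext hgx.symm)
      exact congrArg Subtype.val (congrFun key ⟨t, ht⟩)
    have := hp.t2Space
    have hclosed : (fun t => f.1 (u t)) = fun t => g.1 (u' t) := by
      refine Continuous.ext_on (s := Ioo (0 : unitInterval) 1) ?_ (by fun_prop) (by fun_prop) hopen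
      rw [dense_iff_closure_eq, closure_Ioo (by exact zero_ne_one)]
      exact eq_univ_of_forall fun t => ⟨t.2.1, t.2.2⟩
    refine ⟨g, l, ?_, ?_⟩
    · rintro h
      obtain ⟨rfl, rfl⟩ := Prod.mk.inj h
      refine hne ?_
      -- If the lifted sides coincided, so would the polygons below, since a centre lies in only one
      -- polygon; this contradicts the choice of the neighbour.
      have h0 : P j ⟨0, zero_mem_regPoly hn⟩ = P i ⟨0, zero_mem_regPoly hn⟩ := by
        rw [← hi, ← hg]
      rw [(hD.decomposition.interior_disjoint j i _ _ (zero_mem_interior hn) h0).1]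
    · intro t ht z w hz hw
      have h1 := congrFun hclosed ⟨t, ht⟩
      have hz' : z = u ⟨t, ht⟩ := Subtype.ext hz
      have hw' : w = u' ⟨t, ht⟩ := Subtype.ext hw
      rw [hz', hw']
      exact h1

end IsUnfolding

end LiftedTiling

/-! ### Outward normals of adjacent polygons. -/

section Adjacency

set_option linter.unusedSectionVars false

variable {n : ℕ} [NeZero n] {S : Type*} [TopologicalSpace S] {D : FlatAtlas S}

/-- A displacement `τ` in the surface is `τ / a` in the polygon. For `a ≠ 0` its height is a
positive multiple of its scalar product with `a * polyNormal n k`, the outward normal in the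
surface. -/
lemma polyHeight_div (a : ℂ) (k : ZMod n) (τ : ℂ) :
    polyHeight n k (τ / a) = ((starRingEnd ℂ) (a * polyNormal n k) * τ).re / Complex.normSq a := by
  rw [polyHeight_apply, map_mul, div_eq_mul_inv, Complex.inv_def]
  have : (starRingEnd ℂ) (polyNormal n k) * (τ * ((starRingEnd ℂ) a * ((Complex.normSq a)⁻¹ : ℝ))) =
      ((starRingEnd ℂ) a * (starRingEnd ℂ) (polyNormal n k) * τ) * ((Complex.normSq a)⁻¹ : ℝ) := by
    ring
  rw [this, Complex.re_mul_ofReal, div_eq_mul_inv]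

/-- Vectors of equal length have the same scalar product with their sum. Unless it vanishes, `-(N +
M)` thus points inwards for both outward normals `N` and `M`. -/
lemma re_conj_mul_add_self {N M : ℂ} (h : ‖N‖ = ‖M‖) :
    ((starRingEnd ℂ) N * (N + M)).re = ‖N + M‖ ^ 2 / 2 := by
  have h2 : ‖N‖ ^ 2 = ‖M‖ ^ 2 := by rw [h]
  rw [← Complex.normSq_eq_norm_sq, ← Complex.normSq_eq_norm_sq, Complex.normSq_apply,
    Complex.normSq_apply] at h2
  rw [← Complex.normSq_eq_norm_sq, Complex.normSq_apply]
  simp only [Complex.mul_re, Complex.conj_re, Complex.conj_im, Complex.add_re, Complex.add_im]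
  linarith

lemma lineMap_sub_polyMid (k : ZMod n) (t : ℝ) :
    AffineMap.lineMap (polyVertex n k) (polyVertex n (k + 1)) t - polyMid n k =
      polyNormal n k * (((2 * t - 1) * Real.sin (polyAngle n) : ℝ) * Complex.I) := by
  rw [polySide_param, polyMid_eq, ← mul_sub]
  congr 1
  apply Complex.ext <;> simp [-Complex.ofReal_cos, -Complex.ofReal_sin]

lemma lineMap_reverse_sub_polyMid (k : ZMod n) (t : ℝ) :
    AffineMap.lineMap (polyVertex n (k + 1)) (polyVertex n k) t - polyMid n k =
      -(polyNormal n k * (((2 * t - 1) * Real.sin (polyAngle n) : ℝ) * Complex.I)) := by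
  rw [← AffineMap.lineMap_apply_one_sub, lineMap_sub_polyMid]
  push_cast
  ring

namespace IsTiling

variable {J : Type*} {f : J → C(regPoly n, S)} {a : J → ℂ} (hf : IsTiling D n f a)

include hf

lemma mem_core_of_eq {i j : J} {z w : regPoly n} (h : f i z = f j w)
    (hz : (z : ℂ) ∈ polyCore n) : (w : ℂ) ∈ polyCore n := by
  rw [mem_polyCore_iff, ← hf.vertices j w, ← h]
  exact hf.notMem_sing hz

/-- The polygon near a point, in terms of translations. -/
lemma eventually_move {i : J} {z : regPoly n} (hz : (z : ℂ) ∈ polyCore n) :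
    ∀ᶠ τ : ℂ in 𝓝 0, ∀ h : (z : ℂ) + τ / a i ∈ regPoly n,
      f i ⟨z + τ / a i, h⟩ = D.move (f i z) τ := by
  obtain ⟨u, hu, hus⟩ := (mem_nhds_subtype _ z _).1 (hf.dev i z hz)
  have hc : Tendsto (fun τ : ℂ => (z : ℂ) + τ / a i) (𝓝 0) (𝓝 (z : ℂ)) := by
    have : Continuous fun τ : ℂ => (z : ℂ) + τ / a i := by fun_prop
    simpa using this.tendsto 0
  filter_upwards [hc hu] with τ hτ h
  have := hus (show (⟨(z : ℂ) + τ / a i, h⟩ : regPoly n) ∈ Subtype.val ⁻¹' u from hτ)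
  rw [mem_ofPred_eq] at this
  rw [this]
  congr 1
  have := hf.a_ne_zero i
  field_simp
  ring

/-- Two different polygon sides at the same point have opposite outward normals. -/
lemma normal_eq_neg {i j : J} {z w : regPoly n} (h : f i z = f j w) (hz : (z : ℂ) ∈ polyCore n)
    (hne : ¬(i = j ∧ z = w)) {k l : ZMod n} (hk : (z : ℂ) ∈ polySide n k)
    (hl : (w : ℂ) ∈ polySide n l) : a j * polyNormal n l = -(a i * polyNormal n k) := by
  have hw := hf.mem_core_of_eq h hz
  have hn := hf.three_le
  by_contra hN
  set N := a i * polyNormal n k with hNd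
  set M := a j * polyNormal n l with hMd
  have hnorm : ‖N‖ = ‖M‖ := by
    obtain ⟨s, -, hs⟩ := hf.norm_eq
    rw [hNd, hMd, norm_mul, norm_mul, norm_polyNormal, norm_polyNormal, hs, hs]
  have hNM : N + M ≠ 0 := fun h0 => hN (eq_neg_of_add_eq_zero_right h0)
  have hpos : 0 < ‖N + M‖ ^ 2 / 2 := by positivity
  have hiA := Complex.normSq_pos.2 (hf.a_ne_zero i)
  have hjA := Complex.normSq_pos.2 (hf.a_ne_zero j)
  have hci : Tendsto (fun τ : ℂ => τ / a i) (𝓝 0) (𝓝 0) := by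
    have : Continuous fun τ : ℂ => τ / a i := by fun_prop
    simpa using this.tendsto 0
  have hcj : Tendsto (fun τ : ℂ => τ / a j) (𝓝 0) (𝓝 0) := by
    have : Continuous fun τ : ℂ => τ / a j := by fun_prop
    simpa using this.tendsto 0
  have hcε : Tendsto (fun ε : ℝ => -(ε : ℂ) * (N + M)) (𝓝[>] 0) (𝓝 0) := by
    have : Continuous fun ε : ℝ => -(ε : ℂ) * (N + M) := by fun_prop
    simpa using (this.tendsto 0).mono_left nhdsWithin_le_nhds
  -- If the normals were not opposite, a small step along `-(N + M)` would lead from the common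
  -- point into the interiors of both polygons.
  obtain ⟨ε, ⟨h1, h2, h3, h4⟩, hε⟩ := ((hcε.eventually ((hf.eventually_move hz).and
    ((hf.eventually_move hw).and ((hci.eventually (eventually_mem_interior_iff hn hk
    ((mem_polyCore_iff z).1 hz))).and (hcj.eventually (eventually_mem_interior_iff hn hl
    ((mem_polyCore_iff w).1 hw))))))).and self_mem_nhdsWithin).exists
  have hε' : (0 : ℝ) < ε := hε
  have hN1 : polyHeight n k (-(ε : ℂ) * (N + M) / a i) < 0 := by
    rw [polyHeight_div (a i), mul_left_comm, ← Complex.ofReal_neg,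
      Complex.re_ofReal_mul, ← hNd, re_conj_mul_add_self hnorm]
    exact div_neg_of_neg_of_pos (mul_neg_of_neg_of_pos (neg_neg_of_pos hε') hpos) hiA
  have hM1 : polyHeight n l (-(ε : ℂ) * (N + M) / a j) < 0 := by
    rw [polyHeight_div (a j), mul_left_comm, ← Complex.ofReal_neg,
      Complex.re_ofReal_mul, ← hMd, add_comm N M, re_conj_mul_add_self hnorm.symm, add_comm M N]
    exact div_neg_of_neg_of_pos (mul_neg_of_neg_of_pos (neg_neg_of_pos hε') hpos) hjA
  have hzi := h3.1.2 hN1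
  have hwi := h4.2.2 hM1.le
  have heq := hf.interior_disjoint i j ⟨_, interior_subset hzi⟩ ⟨_, hwi⟩ hzi
    (by rw [h1, h2, h])
  obtain ⟨rfl, heq⟩ := heq
  refine hne ⟨rfl, Subtype.ext ?_⟩
  exact add_right_cancel (congrArg Subtype.val heq)

/-- Each side of a polygon is glued to a side of a polygon with opposite outward normal. -/
lemma exists_glued (i : J) (k : ZMod n) : ∃ j l, a j * polyNormal n l = -(a i * polyNormal n k) ∧
    ∀ z : regPoly n, (z : ℂ) ∈ polySide n k → ∃ w : regPoly n, (w : ℂ) ∈ polySide n l ∧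
      f i z = f j w ∧ a j * (w - polyMid n l) = a i * (z - polyMid n k) ∧
      ((z : ℂ) ∈ polyCore n → ¬ (i = j ∧ z = w)) := by
  have hn := hf.three_le
  obtain ⟨j, l, hne, hglue⟩ := hf.edge_to_edge i k
  have hex : ∀ z : regPoly n, (z : ℂ) ∈ polySide n k → ∃ t : ℝ, ∃ w : regPoly n,
      (w : ℂ) ∈ polySide n l ∧ f i z = f j w ∧
      (z : ℂ) = AffineMap.lineMap (polyVertex n k) (polyVertex n (k + 1)) t ∧
      (w : ℂ) = AffineMap.lineMap (polyVertex n (l + 1)) (polyVertex n l) t := by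
    intro z hz
    have hz' := hz
    rw [polySide, segment_eq_image_lineMap] at hz'
    obtain ⟨t, ht, hzt⟩ := hz'
    have hw : (AffineMap.lineMap (polyVertex n (l + 1)) (polyVertex n l) t : ℂ) ∈ polySide n l := by
      rw [polySide, segment_symm, segment_eq_image_lineMap]; exact mem_image_of_mem _ ht
    exact ⟨t, ⟨_, polySide_subset l hw⟩, hw, hglue t ht z _ hzt.symm rfl, hzt.symm, rfl⟩
  have hdiff : ∀ z w : regPoly n, (z : ℂ) ∈ polySide n k → (w : ℂ) ∈ polySide n l →
      (z : ℂ) ∈ polyCore n → ¬ (i = j ∧ z = w) := by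
    rintro z w hz hw hzc ⟨rfl, rfl⟩
    exact hne (by rw [polySide_unique hn ((mem_polyCore_iff z).1 hzc) hz hw])
  -- The midpoint is not a vertex, so the normals can be compared there. Their relation yields the
  -- position formula along the whole side, endpoints included.
  have hnormal : a j * polyNormal n l = -(a i * polyNormal n k) := by
    obtain ⟨t, w, hw, hzw, -⟩ := hex ⟨_, polySide_subset k (polyMid_mem_polySide k)⟩
      (polyMid_mem_polySide k)
    have hc : polyMid n k ∈ polyCore n :=
      (mem_polyCore_iff ⟨_, polySide_subset k (polyMid_mem_polySide k)⟩).2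
        (polyMid_notMem_range hn k)
    exact hf.normal_eq_neg hzw hc (hdiff _ _ (polyMid_mem_polySide k) hw hc)
      (polyMid_mem_polySide k) hw
  refine ⟨j, l, hnormal, fun z hz => ?_⟩
  obtain ⟨t, w, hw, hzw, hzt, hwt⟩ := hex z hz
  refine ⟨w, hw, hzw, ?_, hdiff z w hz hw⟩
  rw [hzt, hwt, lineMap_sub_polyMid, lineMap_reverse_sub_polyMid]
  linear_combination (-((((2 * t - 1) * Real.sin (polyAngle n) : ℝ) : ℂ) * Complex.I)) * hnormal

/-- Polygons that share a non-vertex point are glued there. -/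
lemma glued_of_eq {i j : J} {z w : regPoly n} (h : f i z = f j w) (hz : (z : ℂ) ∈ polyCore n)
    (hne : ¬(i = j ∧ z = w)) : ∃ k l, (z : ℂ) ∈ polySide n k ∧ (w : ℂ) ∈ polySide n l ∧
      a j * polyNormal n l = -(a i * polyNormal n k) ∧
      a j * (w - polyMid n l) = a i * (z - polyMid n k) := by
  have hn := hf.three_le
  obtain ⟨k, hk⟩ := exists_mem_polySide hn z.2 fun hi => hne (hf.interior_disjoint i j z w hi h)
  obtain ⟨l, hl⟩ := exists_mem_polySide hn w.2 fun hi => by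
    have := hf.interior_disjoint j i w z hi h.symm
    exact hne ⟨this.1.symm, this.2.symm⟩
  obtain ⟨j', l', hnormal, hglue⟩ := hf.exists_glued i k
  obtain ⟨w', hw', hzw', hpos, hne'⟩ := hglue z hk
  have h1 := hf.normal_eq_neg h hz hne hk hl
  -- The neighbour supplied by the gluing is the given one: otherwise three sides at one point would
  -- have pairwise opposite normals.
  have hww : j' = j ∧ w' = w := by
    by_contra hcon
    have h2 := hf.normal_eq_neg (hzw'.symm.trans h) (hf.mem_core_of_eq hzw' hz) hcon hw' hl
    rw [h1, hnormal, neg_neg] at h2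
    have h3 : a i * polyNormal n k = 0 := self_eq_neg.1 h2.symm
    exact mul_ne_zero (hf.a_ne_zero i) (polyNormal_ne_zero k) h3
  obtain ⟨rfl, rfl⟩ := hww
  have : l' = l := polySide_unique hn ((mem_polyCore_iff w').1 (hf.mem_core_of_eq hzw' hz)) hw' hl
  subst this
  exact ⟨k, l', hk, hl, h1, hpos⟩

end IsTiling

end Adjacency

/-! ### Cone points of translation surfaces -/

section ConeEnds

variable {S : Type*} [TopologicalSpace S] {D : FlatAtlas S}

/-- Logarithmic polar coordinates around a cone point of a translation surface, developed by
`w ↦ α * exp w`. -/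
structure FlatAtlas.IsConeEnd (D : FlatAtlas S) (x : S) (θ r : ℝ) (α : ℂ) (p : ℂ → S) : Prop where
  angle_pos : 0 < θ
  ne_zero : α ≠ 0
  dev : ∀ w : ℂ, w.re < r → D.DevAt p (fun w => α * Complex.exp w) w
  continuousOn : ContinuousOn p {w | w.re < r}
  notMem : ∀ w : ℂ, w.re < r → p w ∉ D.sing
  eq_iff : ∀ w w' : ℂ, w.re < r → w'.re < r →
    (p w = p w' ↔ ∃ m : ℤ, w' - w = (m : ℂ) * (θ : ℂ) * Complex.I)
  tendsto : Tendsto p (comap Complex.re atBot) (𝓝 x)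
  nhds : insert x (p '' {w | w.re < r}) ∈ 𝓝 x

lemma isOpen_re_lt (r : ℝ) : IsOpen {w : ℂ | w.re < r} :=
  isOpen_lt Complex.continuous_re continuous_const

lemma convex_re_lt (r : ℝ) : Convex ℝ {w : ℂ | w.re < r} := convex_halfSpace_re_lt r

lemma tendsto_exp_sub {α : ℂ} (hα : α ≠ 0) (w : ℂ) :
    map (fun w' => α * Complex.exp w' - α * Complex.exp w) (𝓝 w) = 𝓝 0 := by
  have h : HasStrictDerivAt (fun w' => α * Complex.exp w' - α * Complex.exp w)
      (α * Complex.exp w) w :=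
    ((Complex.hasStrictDerivAt_exp w).const_mul α).sub_const _
  have := h.map_nhds_eq (mul_ne_zero hα (Complex.exp_ne_zero w))
  simpa using this

/-- The cone condition allows a different rotation in each chart. In a translation atlas the
rotation of the development is locally constant, and the half plane of coordinates is connected, so
a single `α` works. -/
lemma FlatAtlas.IsTranslationSurface.exists_isConeEnd (hD : D.IsTranslationSurface) {x : S}
    (hx : x ∈ D.sing) : ∃ θ r α p, D.IsConeEnd x θ r α p := by
  have hT := hD.isTranslational
  obtain ⟨θ, r, p, hθ, hc, hns, hloc, heq, ht, hn⟩ := hD.isConeSurface.cone x hx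
  have hopen := isOpen_re_lt r
  have h1 : ∀ w : ℂ, w.re < r → ∃ a : ℂ, ‖a‖ = 1 ∧ D.DevAt p (fun w => a * Complex.exp w) w := by
    intro w hw
    obtain ⟨φ, hφ, hxφ⟩ := hT.cover _ (hns w hw)
    obtain ⟨a, b, ha, hab⟩ := hloc w hw φ hφ hxφ
    exact ⟨a, ha, hT.devAt_of_chart hφ hxφ (hc.continuousAt (hopen.mem_nhds hw)) hab⟩
  have huniq : ∀ w : ℂ, w.re < r → ∀ a b : ℂ, D.DevAt p (fun w => a * Complex.exp w) w →
      D.DevAt p (fun w => b * Complex.exp w) w → a = b := by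
    intro w hw a b ha hb
    obtain ⟨φ, hφ, hxφ⟩ := hT.cover _ (hns w hw)
    have h2 : ∀ᶠ w' in 𝓝 w, (a - b) * (Complex.exp w' - Complex.exp w) = 0 := by
      filter_upwards [ha.chart hT (by fun_prop) hφ hxφ, hb.chart hT (by fun_prop) hφ hxφ]
        with w' h1 h2
      have := h1.2.symm.trans h2.2
      linear_combination this
    by_contra hne
    have h3 : ∀ᶠ w' in 𝓝 w, Complex.exp w' - Complex.exp w = 0 := by
      filter_upwards [h2] with w' h
      exact (mul_eq_zero.1 h).resolve_left (sub_ne_zero.2 hne)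
    have h4 := tendsto_exp_sub one_ne_zero w
    simp only [one_mul] at h4
    have h5 : ∀ᶠ t : ℂ in 𝓝 0, t = 0 := by
      rw [← h4]; exact h3
    obtain ⟨t, ht, ht'⟩ := ((h5.filter_mono nhdsWithin_le_nhds :
      ∀ᶠ t : ℂ in 𝓝[≠] 0, t = 0).and self_mem_nhdsWithin).exists
    exact ht' ht
  choose! a ha hdev using h1
  have hw0 : ((r - 1 : ℝ) : ℂ).re < r := by simp
  refine ⟨θ, r, a ((r - 1 : ℝ) : ℂ), p, hθ, ?_, fun w hw => ?_, hc, hns, heq, ht, hn⟩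
  · rw [← norm_ne_zero_iff, ha _ hw0]; exact one_ne_zero
  · have : a ((r - 1 : ℝ) : ℂ) = a w := by
      refine (convex_re_lt r).isPreconnected.induction₂
        (fun w w' => a w = a w') (fun w hw => ?_) (fun _ _ _ _ _ _ h1 h2 => h1.trans h2)
        (fun _ _ _ _ h => h.symm) hw0 hw
      filter_upwards [mem_nhdsWithin_of_mem_nhds ((hdev w hw).eventually hT (hns w hw)
        (by fun_prop)), self_mem_nhdsWithin] with w' hw' hr
      exact huniq w' hr _ _ hw' (hdev w' hr)
    rw [this]
    exact hdev w hw

namespace FlatAtlas.IsConeEnd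

variable {x : S} {θ r : ℝ} {α : ℂ} {p : ℂ → S} (hC : D.IsConeEnd x θ r α p)

include hC

lemma continuousAt {w : ℂ} (hw : w.re < r) : ContinuousAt p w :=
  hC.continuousOn.continuousAt ((isOpen_re_lt r).mem_nhds hw)

lemma re_eq {w w' : ℂ} (hw : w.re < r) (hw' : w'.re < r) (h : p w = p w') : w.re = w'.re := by
  obtain ⟨m, hm⟩ := (hC.eq_iff w w' hw hw').1 h
  have := congrArg Complex.re hm
  simp at this
  linarith

lemma isOpen_image (hT : D.IsTranslational) {O : Set ℂ} (hO : IsOpen O)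
    (hOr : ∀ w ∈ O, w.re < r) : IsOpen (p '' O) := by
  rw [isOpen_iff_mem_nhds]
  rintro _ ⟨w, hw, rfl⟩
  have hr := hOr w hw
  rw [← hT.map_move_nhds (hC.notMem w hr), ← tendsto_exp_sub hC.ne_zero w, mem_map, mem_map]
  filter_upwards [hC.dev w hr, hO.mem_nhds hw] with w' h1 h2
  change D.move (p w) _ ∈ p '' O
  rw [← h1]
  exact mem_image_of_mem p h2

/-- By periodicity a strip of height `θ` suffices, which makes closed annuli around the cone point
compact. -/
lemma image_eq {s : Set ℝ} (hs : ∀ t ∈ s, t < r) :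
    p '' {w | w.re ∈ s} = p '' {w | w.re ∈ s ∧ w.im ∈ Icc 0 θ} := by
  apply Subset.antisymm
  · rintro _ ⟨w, hw, rfl⟩
    set m : ℤ := ⌊w.im / θ⌋ with hm
    have h1 := Int.floor_le (w.im / θ)
    have h2 := (Int.lt_floor_add_one (w.im / θ)).le
    rw [← hm] at h1 h2
    rw [le_div_iff₀ hC.angle_pos] at h1
    rw [div_le_iff₀ hC.angle_pos] at h2
    have hre : (w - (m : ℂ) * (θ : ℂ) * Complex.I).re = w.re := by simp
    have him : (w - (m : ℂ) * (θ : ℂ) * Complex.I).im = w.im - m * θ := by simp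
    refine ⟨w - (m : ℂ) * (θ : ℂ) * Complex.I, ⟨?_, ?_, ?_⟩, ?_⟩
    · rw [hre]; exact hw
    · rw [him]; linarith
    · rw [him]; linarith
    · refine (hC.eq_iff _ _ (by rw [hre]; exact hs _ hw) (hs _ hw)).2 ⟨m, by ring⟩
  · exact image_mono fun w hw => hw.1

lemma isCompact_image {s t : ℝ} (ht : t < r) : IsCompact (p '' {w | w.re ∈ Icc s t}) := by
  rw [hC.image_eq fun u hu => hu.2.trans_lt ht]
  refine IsCompact.image_of_continuousOn ?_ (hC.continuousOn.mono fun w hw => hw.1.2.trans_lt ht)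
  exact isCompact_Icc.reProdIm isCompact_Icc

lemma isPreconnected_image {s : Set ℝ} (hs : Convex ℝ s) (hsr : ∀ t ∈ s, t < r) :
    IsPreconnected (p '' {w | w.re ∈ s}) := by
  refine IsPreconnected.image ?_ p (hC.continuousOn.mono fun w hw => hsr _ hw)
  exact (hs.linear_preimage Complex.reLm).isPreconnected

/-- Either the small punctured disks are punctured neighbourhoods of the cone point, or the whole
outer end of the coordinates converges to it. -/
lemma nhds_or_outer [CompactSpace S] [T2Space S] (hT : D.IsTranslational) (hx : x ∈ D.sing) :
    (∀ r' < r, insert x (p '' {w | w.re < r'}) ∈ 𝓝 x) ∨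
      ∀ w : ℂ, w.re = r → Tendsto p (𝓝[{w | w.re < r}] w) (𝓝 x) := by
  refine or_iff_not_imp_left.2 fun hbad w hw => ?_
  push Not at hbad
  obtain ⟨r', hr', hbad⟩ := hbad
  -- The failing radius `r'` leaves points arbitrarily near `x` with coordinates outside it. The
  -- compact annuli from `r'` to `s` stay away from `x`, so every outer annulus comes arbitrarily
  -- near `x`.
  have hmeet : ∀ O ∈ 𝓝 x, ∀ s < r, (p '' {w | w.re ∈ Ico s r} ∩ O).Nonempty := by
    intro O hO s hs
    have hK := (hC.isCompact_image (s := r') hs).isClosed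
    have hxK : x ∉ p '' {w | w.re ∈ Icc r' s} := by
      rintro ⟨w, hw, rfl⟩
      exact hC.notMem w (hw.2.trans_lt hs) hx
    by_contra hemp
    refine hbad (mem_of_superset (inter_mem (inter_mem hO hC.nhds)
      (hK.isOpen_compl.mem_nhds hxK)) ?_)
    rintro y ⟨⟨hyO, rfl | ⟨w, hw, rfl⟩⟩, hyK⟩
    · exact mem_insert _ _
    · refine Or.inr ⟨w, ?_, rfl⟩
      by_contra hwr
      rw [mem_ofPred_eq, not_lt] at hwr
      rcases le_or_gt w.re s with h | h
      · exact hyK ⟨w, ⟨hwr, h⟩, rfl⟩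
      · exact hemp ⟨p w, ⟨w, ⟨h.le, hw⟩, rfl⟩, hyO⟩
  by_contra hnt
  obtain ⟨O, hO, hfreq⟩ : ∃ O ∈ 𝓝 x, ∃ᶠ w' in 𝓝[{w | w.re < r}] w, p w' ∉ O := by
    rw [tendsto_def] at hnt
    push Not at hnt
    obtain ⟨O, hO, h⟩ := hnt
    exact ⟨O, hO, fun h' => h (h'.mono fun w hw => not_not.1 hw)⟩
  obtain ⟨O₁, hO₁, hcl, hsub⟩ := exists_mem_nhds_isClosed_subset (inter_mem hO hC.nhds)
  -- An outer annulus is connected, meets `O₁` and leaves it, so it crosses the frontier. The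
  -- crossing points accumulate at some `p w₀` with `w₀.re < r`, which is impossible: near `p w₀`
  -- the radial coordinate stays below `s₀ < r`, but at the crossing points it tends to `r`.
  have hfront : ∀ s < r, (p '' {w | w.re ∈ Ico s r} ∩ frontier O₁).Nonempty := by
    intro s hs
    have hev : ∀ᶠ w' in 𝓝[{w | w.re < r}] w, w'.re ∈ Ico s r := by
      filter_upwards [self_mem_nhdsWithin, mem_nhdsWithin_of_mem_nhds
        ((isOpen_lt continuous_const Complex.continuous_re).mem_nhds
          (show s < w.re by rw [hw]; exact hs))] with w' h1 h2
      exact ⟨h2.le, h1⟩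
    obtain ⟨w', h1, h2⟩ := (hfreq.and_eventually hev).exists
    by_contra hemp
    have hcov : ∀ y ∈ p '' {w | w.re ∈ Ico s r}, y ∈ O₁ → y ∈ interior O₁ := by
      intro y hy hyO
      by_contra hyi
      exact hemp ⟨y, hy, by rw [hcl.frontier_eq]; exact ⟨hyO, hyi⟩⟩
    obtain ⟨y, hy, hy1, hy2⟩ := hC.isPreconnected_image (convex_Ico s r) (fun t ht => ht.2)
      (interior O₁) O₁ᶜ isOpen_interior hcl.isOpen_compl
      (fun y hy => (em (y ∈ O₁)).imp (hcov y hy) id)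
      ((hmeet O₁ hO₁ s hs).imp fun y hy => ⟨hy.1, hcov y hy.1 hy.2⟩)
      ⟨p w', mem_image_of_mem p h2, fun h => h1 (hsub h).1⟩
    exact hy2 (interior_subset hy1)
  have : Nonempty S := ⟨x⟩
  choose! y hy using hfront
  have hr : ∀ᶠ s in 𝓝[<] r, s < r := self_mem_nhdsWithin
  obtain ⟨z, hz, hclust⟩ := (isClosed_frontier (s := O₁)).isCompact.exists_mapClusterPt
    (f := 𝓝[<] r) (u := y) (by
      rw [le_principal_iff, mem_map]
      filter_upwards [hr] with s hs using (hy s hs).2)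
  have hzx : z ≠ x := by
    rintro rfl
    exact hz.2 (mem_interior_iff_mem_nhds.2 hO₁)
  obtain ⟨w₀, hw₀, rfl⟩ := (hsub (hcl.frontier_subset hz)).2.resolve_left hzx
  obtain ⟨s₀, hs₀, hs₀r⟩ := exists_between (show w₀.re < r from hw₀)
  have hN : p '' {w | w.re < s₀} ∈ 𝓝 (p w₀) :=
    (hC.isOpen_image hT (isOpen_re_lt s₀) fun w hw => lt_trans hw hs₀r).mem_nhds
      (mem_image_of_mem p hs₀)
  have hev : ∀ᶠ s in 𝓝[<] r, s₀ < s ∧ s < r := by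
    filter_upwards [hr, mem_nhdsWithin_of_mem_nhds (lt_mem_nhds hs₀r)] with s h1 h2
    exact ⟨h2, h1⟩
  obtain ⟨s, ⟨w₁, hw₁, hw₁s⟩, hs1, hs2⟩ := ((hclust.frequently hN).and_eventually hev).exists
  obtain ⟨w₂, hw₂, hw₂s⟩ := (hy s hs2).1
  have hw₁' : w₁.re < s₀ := hw₁
  have := hC.re_eq (hw₁'.trans hs₀r) hw₂.2 (hw₁s.trans hw₂s.symm)
  have := hw₂.1
  linarith

end FlatAtlas.IsConeEnd

end ConeEnds

/-! ### Continuation of polygons in polar coordinates around a cone point. -/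

section Development

set_option linter.unusedSectionVars false

/-- Continuous induction on the unit interval. -/
lemma Icc_induction {P : ℝ → Prop} (h0 : P 0)
    (hopen : ∀ t ∈ Ico (0 : ℝ) 1, P t → ∀ᶠ t' in 𝓝[>] t, P t')
    (hclosed : ∀ t ∈ Ioc (0 : ℝ) 1, (∀ t' ∈ Ico 0 t, P t') → P t) : ∀ t ∈ Icc (0 : ℝ) 1, P t := by
  set s : Set ℝ := {t | ∀ t' ∈ Icc 0 t, P t'} with hs
  have hsub : Icc (0 : ℝ) 1 ⊆ s := by
    have hs0 : (0 : ℝ) ∈ s := fun t' ht' => by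
      rw [le_antisymm ht'.2 ht'.1]; exact h0
    have hext : ∀ t ∈ Icc (0 : ℝ) 1, (∀ t' ∈ Ico 0 t, P t') → t ∈ s := by
      intro t ht h t' ht'
      rcases ht'.2.eq_or_lt with rfl | hlt
      · rcases ht'.1.eq_or_lt with rfl | hpos
        · exact h0
        · exact hclosed t' ⟨hpos, ht.2⟩ h
      · exact h t' ⟨ht'.1, hlt⟩
    refine IsClosed.Icc_subset_of_forall_mem_nhdsWithin ?_ hs0 ?_
    · rw [← isSeqClosed_iff_isClosed]
      intro u t hu hut
      have htI : t ∈ Icc (0 : ℝ) 1 := isClosed_Icc.mem_of_tendsto hut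
        (Eventually.of_forall fun k => (hu k).2)
      refine ⟨hext t htI fun t' ht' => ?_, htI⟩
      obtain ⟨k, hk⟩ := (hut.eventually (lt_mem_nhds ht'.2)).exists
      exact (hu k).1 t' ⟨ht'.1, hk.le⟩
    · intro t ht
      have h1 := hopen t ht.2 (ht.1 t ⟨ht.2.1, le_rfl⟩)
      obtain ⟨ε, hε, hεs⟩ := mem_nhdsGT_iff_exists_Ioo_subset.1 h1
      filter_upwards [Ioo_mem_nhdsGT hε] with t' ht' t'' ht''
      rcases le_or_gt t'' t with h | h
      · exact ht.1 t'' ⟨ht''.1, h⟩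
      · exact hεs ⟨h, ht''.2.trans_lt ht'.2⟩
  exact fun t ht => hsub ht t ⟨ht.1, le_rfl⟩

/-- The segment starts at `1`, so it can reach the negative real axis only along the real line, and
would pass through `0` before. -/
lemma mem_slitPlane_of_forall_lt {δ : ℂ} {t : ℝ} (ht : 0 < t)
    (h : ∀ t' ∈ Ico 0 t, 1 + (t' : ℂ) * δ ∈ Complex.slitPlane) (h0 : 1 + (t : ℂ) * δ ≠ 0) :
    1 + (t : ℂ) * δ ∈ Complex.slitPlane := by
  by_contra hn
  rw [Complex.mem_slitPlane_iff, not_or, not_lt, not_not] at hn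
  have him : t * δ.im = 0 := by simpa using hn.2
  have hre : 1 + t * δ.re ≤ 0 := by simpa using hn.1
  have hδ : δ.im = 0 := (mul_eq_zero.1 him).resolve_left ht.ne'
  have hδr : δ.re < 0 := by
    by_contra hc
    nlinarith [not_lt.1 hc]
  have hne : 1 + t * δ.re ≠ 0 := by
    intro hc
    apply h0
    apply Complex.ext
    · simpa using hc
    · simpa using hn.2
  have hlt : 1 + t * δ.re < 0 := lt_of_le_of_ne hre hne
  have h1 := h (-1 / δ.re) ⟨div_nonneg_of_nonpos (by norm_num) hδr.le, by
    rw [div_lt_iff_of_neg hδr]; linarith⟩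
  rw [Complex.mem_slitPlane_iff] at h1
  rcases h1 with h1 | h1
  · rw [Complex.add_re, Complex.re_ofReal_mul, div_mul_cancel₀ _ hδr.ne] at h1
    simp at h1
  · simp [hδ] at h1

variable {n : ℕ} [NeZero n] {S : Type*} [TopologicalSpace S] {D : FlatAtlas S}
  {J : Type*} {f : J → C(regPoly n, S)} {a : J → ℂ}

/-- A polygon that meets the polar coordinates of a cone point is developed by them. -/
lemma IsTiling.dev_cone [T2Space S] (hf : IsTiling D n f a) {x : S}
    (hx : x ∈ D.sing) {θ r : ℝ} {α : ℂ} {p : ℂ → S} (hC : D.IsConeEnd x θ r α p) {i : J}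
    {z₀ z : regPoly n} {w₀ : ℂ} (hz₀ : (z₀ : ℂ) ∈ polyCore n) (hz : (z : ℂ) ∈ polyCore n)
    (hw₀ : w₀.re < r) (h : f i z₀ = p w₀)
    (hout : (∀ w : ℂ, w.re = r → Tendsto p (𝓝[{w | w.re < r}] w) (𝓝 x)) ∨
      ‖Complex.exp w₀‖ + ‖a i / α * (z - z₀)‖ < Real.exp r) :
    1 + a i / α * (z - z₀) / Complex.exp w₀ ∈ Complex.slitPlane ∧
      (w₀ + Complex.log (1 + a i / α * (z - z₀) / Complex.exp w₀)).re < r ∧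
      f i z = p (w₀ + Complex.log (1 + a i / α * (z - z₀) / Complex.exp w₀)) := by
  set b := Complex.exp w₀ with hb
  have hb0 : b ≠ 0 := Complex.exp_ne_zero w₀
  set δ := a i / α * (z - z₀) / b with hδ
  have hbδ : b * δ = a i / α * (z - z₀) := by rw [hδ]; field_simp
  have hαδ : α * (b * δ) = a i * (z - z₀) := by
    have := hC.ne_zero
    rw [hbδ]; field_simp
  -- Clamping the parameter makes the path along the segment from `z₀` to `z` defined and continuous
  -- on all of `ℝ`.
  set c : ℝ → ℝ := fun t => max 0 (min t 1) with hc
  have hcc : Continuous c := by fun_prop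
  have hc01 : ∀ t, c t ∈ Icc (0 : ℝ) 1 := fun t =>
    ⟨le_max_left _ _, max_le zero_le_one (min_le_right _ _)⟩
  have hcid : ∀ t ∈ Icc (0 : ℝ) 1, c t = t := fun t ht => by
    simp [hc, min_eq_left ht.2, max_eq_right ht.1]
  have hseg : ∀ t : ℝ, (z₀ : ℂ) + (c t : ℂ) * (z - z₀) ∈ polyCore n := by
    intro t
    have := convex_polyCore.add_smul_sub_mem hz₀ hz (hc01 t)
    rwa [Complex.real_smul] at this
  let u : ℝ → regPoly n := fun t => ⟨z₀ + (c t : ℂ) * (z - z₀), (hseg t).1⟩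
  have huc : Continuous u := by
    refine Continuous.subtype_mk ?_ _
    fun_prop
  let d : ℝ → ℂ := fun t => 1 + (c t : ℂ) * δ
  have hdc : Continuous d := by fun_prop
  let W : ℝ → ℂ := fun t => w₀ + Complex.log (d t)
  have hWexp : ∀ t, d t ∈ Complex.slitPlane → Complex.exp (W t) = b * d t := by
    intro t ht
    rw [Complex.exp_add, Complex.exp_log (Complex.slitPlane_ne_zero ht)]
  have hWc : ∀ t, d t ∈ Complex.slitPlane → ContinuousAt W t := fun t ht =>
    continuousAt_const.add (hdc.continuousAt.clog ht)
  -- `W t` is the continued logarithm of the developed position `exp w₀ * d t`. Agreement is open,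
  -- as both sides have the same development. At a limit time, `d t = 0` would give the singular
  -- value `x`, and the outer end is excluded by `hout`.
  have key : ∀ t ∈ Icc (0 : ℝ) 1, d t ∈ Complex.slitPlane ∧ (W t).re < r ∧ f i (u t) = p (W t) := by
    refine Icc_induction ?_ ?_ ?_
    · have hd0 : d 0 = 1 := by simp [d, hc]
      have hW0 : W 0 = w₀ := by simp [W, hd0]
      have hu0 : u 0 = z₀ := Subtype.ext (by simp [u, hc])
      rw [hd0, hW0, hu0]
      exact ⟨by simp, hw₀, h⟩
    · rintro t - ⟨h1, h2, h3⟩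
      refine Eventually.filter_mono nhdsWithin_le_nhds ?_
      have hd1 := (hf.dev i (u t) (hseg t)).comp (u := u) (η := t) huc.continuousAt rfl
      have hd2 := (hC.dev (W t) h2).comp (u := W) (η := t) (hWc t h1) rfl
      have hd1' : D.DevAt (f i ∘ u) (fun t => α * (b * d t)) t := by
        refine hd1.congr (Eventually.of_forall fun t' => ?_)
        simp only [Function.comp_apply, u, d]
        linear_combination ((c t' : ℂ) - c t) * hαδ
      have hslit : ∀ᶠ t' in 𝓝 t, d t' ∈ Complex.slitPlane :=
        hdc.continuousAt.eventually (Complex.isOpen_slitPlane.mem_nhds h1)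
      have hd2' : D.DevAt (p ∘ W) (fun t => α * (b * d t)) t := by
        refine hd2.congr ?_
        filter_upwards [hslit] with t' ht'
        simp only [Function.comp_apply]
        rw [hWexp t' ht', hWexp t h1]
      filter_upwards [hslit, (hWc t h1).eventually ((isOpen_re_lt r).mem_nhds h2),
        hd1'.eventuallyEq hd2' h3] with t' h1 h2 h3
      exact ⟨h1, h2, h3⟩
    · intro t ht hlt
      have htI : t ∈ Icc (0 : ℝ) 1 := ⟨ht.1.le, ht.2⟩
      have hdt : d t = 1 + (t : ℂ) * δ := by simp only [d]; rw [hcid t htI]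
      have hne : (𝓝[Ico 0 t] t).NeBot := by
        rw [← mem_closure_iff_nhdsWithin_neBot, closure_Ico ht.1.ne]
        exact ⟨ht.1.le, le_rfl⟩
      have hflim : Tendsto (fun t' => f i (u t')) (𝓝[Ico 0 t] t) (𝓝 (f i (u t))) :=
        (((f i).continuous.comp huc).tendsto t).mono_left nhdsWithin_le_nhds
      have hplim : ∀ y, Tendsto (fun t' => p (W t')) (𝓝[Ico 0 t] t) (𝓝 y) → f i (u t) = y := by
        intro y hy
        refine tendsto_nhds_unique hflim (hy.congr' ?_)
        filter_upwards [self_mem_nhdsWithin] with t' ht'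
        exact (hlt t' ht').2.2.symm
      have hfx : f i (u t) ≠ x := fun he => hf.notMem_sing (i := i) (z := u t) (hseg t) (he ▸ hx)
      have hd0 : d t ≠ 0 := by
        intro hd0
        refine hfx (hplim x (hC.tendsto.comp ?_))
        rw [tendsto_comap_iff]
        have h1 : Tendsto (fun t' => ‖d t'‖) (𝓝[Ico 0 t] t) (𝓝[>] 0) := by
          refine tendsto_nhdsWithin_iff.2 ⟨?_, ?_⟩
          · have := (hdc.norm.tendsto t).mono_left (nhdsWithin_le_nhds (s := Ico 0 t))
            rwa [hd0, norm_zero] at this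
          · filter_upwards [self_mem_nhdsWithin] with t' ht'
            exact norm_pos_iff.2 (Complex.slitPlane_ne_zero (hlt t' ht').1)
        have h2 := tendsto_atBot_add_const_left _ w₀.re (Real.tendsto_log_nhdsGT_zero.comp h1)
        refine h2.congr fun t' => ?_
        simp [W, Complex.log_re]
      have hslit : d t ∈ Complex.slitPlane := by
        rw [hdt] at hd0 ⊢
        refine mem_slitPlane_of_forall_lt ht.1 (fun t' ht' => ?_) hd0
        have := (hlt t' ht').1
        simp only [d] at this
        rwa [hcid t' ⟨ht'.1, ht'.2.le.trans ht.2⟩] at this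
      have hWlim : Tendsto W (𝓝[Ico 0 t] t) (𝓝 (W t)) := (hWc t hslit).mono_left nhdsWithin_le_nhds
      have hre : (W t).re ≤ r := by
        refine le_of_tendsto ((Complex.continuous_re.tendsto _).comp hWlim) ?_
        filter_upwards [self_mem_nhdsWithin] with t' ht'
        exact (hlt t' ht').2.1.le
      have hre' : (W t).re < r := by
        refine lt_of_le_of_ne hre fun heq => ?_
        rcases hout with hout | hout
        · refine hfx (hplim x ((hout _ heq).comp (tendsto_nhdsWithin_iff.2 ⟨hWlim, ?_⟩)))
          filter_upwards [self_mem_nhdsWithin] with t' ht'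
          exact (hlt t' ht').2.1
        · have h1 : ‖Complex.exp (W t)‖ = Real.exp r := by rw [Complex.norm_exp, heq]
          have h2 : Complex.exp (W t) = b + (c t : ℂ) * (a i / α * (z - z₀)) := by
            rw [hWexp t hslit, ← hbδ]; simp only [d]; ring
          rw [h2] at h1
          have h3 := norm_add_le b ((c t : ℂ) * (a i / α * (z - z₀)))
          rw [norm_mul (c t : ℂ), Complex.norm_real, Real.norm_of_nonneg (hc01 t).1] at h3
          have h4 := mul_le_of_le_one_left (norm_nonneg (a i / α * ((z : ℂ) - z₀))) (hc01 t).2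
          linarith
      exact ⟨hslit, hre', hplim _ ((hC.continuousAt hre').tendsto.comp hWlim)⟩
  have h1 := key 1 ⟨zero_le_one, le_rfl⟩
  have hd1 : d 1 = 1 + δ := by simp [d, hc]
  have hu1 : u 1 = z := Subtype.ext (by simp [u, hc])
  have hW1 : W 1 = w₀ + Complex.log (1 + δ) := by simp only [W, hd1]
  rw [hd1, hW1, hu1] at h1
  exact h1

end Development

/-! ### Exclusion of the case that the outer end of the polar coordinates returns to the cone point.
-/

section ConeNeighbourhoods

set_option linter.unusedSectionVars false

variable {n : ℕ} [NeZero n]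

lemma re_mul_polyVertex (k : ZMod n) (μ : ℂ) :
    (μ * polyVertex n k).re = (μ * polyNormal n k).re * Real.cos (polyAngle n) +
      (μ * polyNormal n k).im * Real.sin (polyAngle n) := by
  rw [polyVertex_eq, ← mul_assoc, Complex.mul_re, Complex.exp_ofReal_mul_I_re,
    Complex.exp_ofReal_mul_I_im, Real.cos_neg, Real.sin_neg]
  ring

lemma re_mul_polyVertex_succ (k : ZMod n) (μ : ℂ) :
    (μ * polyVertex n (k + 1)).re = (μ * polyNormal n k).re * Real.cos (polyAngle n) -
      (μ * polyNormal n k).im * Real.sin (polyAngle n) := by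
  rw [polyVertex_succ, ← mul_assoc, Complex.mul_re, Complex.exp_ofReal_mul_I_re,
    Complex.exp_ofReal_mul_I_im]

/-- A circle through the vertices of a regular polygon has the same centre. -/
lemma eq_zero_of_norm_add_polyVertex (hn : 3 ≤ n) {c β : ℂ} (hβ : β ≠ 0) {R : ℝ}
    (h : ∀ k : ZMod n, ‖c + β * polyVertex n k‖ = R) : c = 0 := by
  set μ := (starRingEnd ℂ) c * β with hμ
  have h1 : ∀ k : ZMod n, (μ * polyVertex n k).re =
      (R ^ 2 - Complex.normSq c - Complex.normSq β) / 2 := by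
    intro k
    have h2 : Complex.normSq (c + β * polyVertex n k) = R ^ 2 := by
      rw [Complex.normSq_eq_norm_sq, h]
    have h3 : Complex.normSq (polyVertex n k) = 1 := by
      rw [Complex.normSq_eq_norm_sq, norm_polyVertex]; norm_num
    rw [Complex.normSq_add, Complex.normSq_mul, h3] at h2
    have h4 : (c * (starRingEnd ℂ) (β * polyVertex n k)).re = (μ * polyVertex n k).re := by
      rw [hμ, ← Complex.conj_re]
      simp [mul_assoc]
    rw [h4] at h2
    linarith
  -- Equal distances make `re (μ * v)` the same for all vertices `v`. As the vertices sum to zero it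
  -- vanishes, and two consecutive vertices span the plane.
  have hsum : ∑ k : ZMod n, (μ * polyVertex n k).re = 0 := by
    rw [← Complex.re_sum, ← Finset.mul_sum, sum_polyVertex hn]; simp
  have h0 : ∀ k : ZMod n, (μ * polyVertex n k).re = 0 := by
    intro k
    rw [Finset.sum_congr rfl fun k _ => h1 k, Finset.sum_const, nsmul_eq_mul] at hsum
    rw [h1 k]
    exact (mul_eq_zero.1 hsum).resolve_left (by simp [NeZero.ne n])
  have hc := cos_polyAngle_pos hn
  have hs := sin_polyAngle_pos hn
  have ha := h0 0
  have hb := h0 (0 + 1)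
  rw [re_mul_polyVertex] at ha
  rw [re_mul_polyVertex_succ] at hb
  have hre : (μ * polyNormal n 0).re = 0 :=
    (mul_eq_zero.1 (by linarith : (μ * polyNormal n 0).re * Real.cos (polyAngle n) = 0)).resolve_right
      hc.ne'
  have him : (μ * polyNormal n 0).im = 0 :=
    (mul_eq_zero.1 (by linarith : (μ * polyNormal n 0).im * Real.sin (polyAngle n) = 0)).resolve_right
      hs.ne'
  have hz : μ * polyNormal n 0 = 0 := Complex.ext hre him
  have hμ0 := (mul_eq_zero.1 hz).resolve_right (polyNormal_ne_zero _)
  have := (mul_eq_zero.1 hμ0).resolve_right hβ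
  simpa using this

variable {S : Type*} [TopologicalSpace S] {D : FlatAtlas S}
  {J : Type*} {f : J → C(regPoly n, S)} {a : J → ℂ} (hf : IsTiling D n f a)
  {x : S} {θ r : ℝ} {α : ℂ} {p : ℂ → S}

include hf

/-- If the outer end of the polar coordinates converges to the cone point, then the vertices of a
polygon are developed to the centre or to the outer circle. -/
lemma IsTiling.norm_vertex_of_outer [T2Space S] (hx : x ∈ D.sing)
    (hC : D.IsConeEnd x θ r α p)
    (hout : ∀ w : ℂ, w.re = r → Tendsto p (𝓝[{w | w.re < r}] w) (𝓝 x)) {i : J}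
    {z₀ : regPoly n} {w₀ : ℂ} (hz₀ : (z₀ : ℂ) ∈ polyCore n) (hw₀ : w₀.re < r) (h : f i z₀ = p w₀)
    (k : ZMod n) : Complex.exp w₀ + a i / α * (polyVertex n k - z₀) = 0 ∨
      ‖Complex.exp w₀ + a i / α * (polyVertex n k - z₀)‖ = Real.exp r := by
  set b := Complex.exp w₀ with hb
  have hb0 : b ≠ 0 := Complex.exp_ne_zero w₀
  let v : regPoly n := ⟨polyVertex n k, polyVertex_mem k⟩
  set δ := a i / α * (polyVertex n k - z₀) / b with hδ
  have hbδ : b * δ = a i / α * (polyVertex n k - z₀) := by rw [hδ]; field_simp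
  rw [← hbδ, show b + b * δ = b * (1 + δ) by ring]
  by_cases hd : 1 + δ = 0
  · left; rw [hd, mul_zero]
  right
  have hcore : ∀ t ∈ Ico (0 : ℝ) 1, (z₀ : ℂ) + (t : ℂ) * (polyVertex n k - z₀) ∈ polyCore n := by
    intro t ht
    have h1 := convex_regPoly.add_smul_sub_mem z₀.2 (polyVertex_mem k) ⟨ht.1, ht.2.le⟩
    rw [Complex.real_smul] at h1
    refine ⟨h1, ?_⟩
    rw [mem_ball_zero_iff]
    have h2 : ‖(z₀ : ℂ)‖ < 1 := mem_ball_zero_iff.1 hz₀.2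
    calc ‖(z₀ : ℂ) + (t : ℂ) * (polyVertex n k - z₀)‖
        = ‖((1 - t : ℝ) : ℂ) * z₀ + (t : ℂ) * polyVertex n k‖ := by congr 1; push_cast; ring
      _ ≤ (1 - t) * ‖(z₀ : ℂ)‖ + t * 1 := by
          refine (norm_add_le _ _).trans (le_of_eq ?_)
          rw [norm_mul, norm_mul, Complex.norm_real, Complex.norm_real, norm_polyVertex,
            Real.norm_of_nonneg ht.1, Real.norm_of_nonneg (by linarith [ht.2])]
      _ < 1 := by nlinarith [ht.2]
  have hkey : ∀ t ∈ Ico (0 : ℝ) 1, ∀ hm : (z₀ : ℂ) + (t : ℂ) * (polyVertex n k - z₀) ∈ regPoly n,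
      1 + (t : ℂ) * δ ∈ Complex.slitPlane ∧
      (w₀ + Complex.log (1 + (t : ℂ) * δ)).re < r ∧
      f i ⟨z₀ + (t : ℂ) * (polyVertex n k - z₀), hm⟩ = p (w₀ + Complex.log (1 + (t : ℂ) * δ)) := by
    intro t ht hm
    have := hf.dev_cone hx hC (z := ⟨_, hm⟩) hz₀ (hcore t ht) hw₀ h (Or.inl hout)
    have he : a i / α * ((z₀ : ℂ) + (t : ℂ) * (polyVertex n k - z₀) - z₀) / b = (t : ℂ) * δ := by
      rw [hδ]; ring
    rwa [he] at this
  have hslit : 1 + δ ∈ Complex.slitPlane := by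
    have := mem_slitPlane_of_forall_lt (δ := δ) (t := 1) one_pos
      (fun t ht => (hkey t ht (hcore t ht).1).1) (by simpa using hd)
    simpa using this
  have hne : (𝓝[Ico (0 : ℝ) 1] 1).NeBot := by
    rw [← mem_closure_iff_nhdsWithin_neBot, closure_Ico zero_ne_one]
    exact ⟨zero_le_one, le_rfl⟩
  have hc1 : Tendsto (fun t : ℝ => 1 + (t : ℂ) * δ) (𝓝[Ico (0 : ℝ) 1] 1) (𝓝 (1 + δ)) := by
    have : Continuous fun t : ℝ => 1 + (t : ℂ) * δ := by fun_prop
    simpa using (this.tendsto 1).mono_left (nhdsWithin_le_nhds (s := Ico (0 : ℝ) 1))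
  have hW : Tendsto (fun t : ℝ => w₀ + Complex.log (1 + (t : ℂ) * δ)) (𝓝[Ico (0 : ℝ) 1] 1)
      (𝓝 (w₀ + Complex.log (1 + δ))) :=
    tendsto_const_nhds.add (hc1.clog hslit)
  have hre : (w₀ + Complex.log (1 + δ)).re ≤ r := by
    refine le_of_tendsto ((Complex.continuous_re.tendsto _).comp hW) ?_
    filter_upwards [self_mem_nhdsWithin] with t ht
    exact (hkey t ht (hcore t ht).1).2.1.le
  -- A limit inside the disc would identify the vertex with a point of the form `p w`, which is not
  -- singular.
  have hre' : (w₀ + Complex.log (1 + δ)).re = r := by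
    by_contra hne'
    have hlt := lt_of_le_of_ne hre hne'
    classical
    let u : ℝ → regPoly n := fun t =>
      if hm : (z₀ : ℂ) + (t : ℂ) * (polyVertex n k - z₀) ∈ regPoly n then ⟨_, hm⟩ else v
    have hu : ∀ t ∈ Ico (0 : ℝ) 1, (u t : ℂ) = z₀ + (t : ℂ) * (polyVertex n k - z₀) ∧
        f i (u t) = p (w₀ + Complex.log (1 + (t : ℂ) * δ)) := by
      intro t ht
      have hm := (hcore t ht).1
      have : u t = ⟨_, hm⟩ := dif_pos hm
      rw [this]
      exact ⟨rfl, (hkey t ht hm).2.2⟩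
    have hut : Tendsto u (𝓝[Ico (0 : ℝ) 1] 1) (𝓝 v) := by
      rw [tendsto_subtype_rng]
      have h1 : Tendsto (fun t : ℝ => (z₀ : ℂ) + (t : ℂ) * (polyVertex n k - z₀))
          (𝓝[Ico (0 : ℝ) 1] 1) (𝓝 (polyVertex n k)) := by
        have : Continuous fun t : ℝ => (z₀ : ℂ) + (t : ℂ) * (polyVertex n k - z₀) := by fun_prop
        simpa using (this.tendsto 1).mono_left (nhdsWithin_le_nhds (s := Ico (0 : ℝ) 1))
      refine h1.congr' ?_
      filter_upwards [self_mem_nhdsWithin] with t ht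
      exact (hu t ht).1.symm
    have h1 : Tendsto (fun t => f i (u t)) (𝓝[Ico (0 : ℝ) 1] 1) (𝓝 (f i v)) :=
      ((f i).continuous.tendsto v).comp hut
    have h2 : f i v = p (w₀ + Complex.log (1 + δ)) := by
      refine tendsto_nhds_unique h1 (((hC.continuousAt hlt).tendsto.comp hW).congr' ?_)
      filter_upwards [self_mem_nhdsWithin] with t ht
      exact (hu t ht).2.symm
    refine hC.notMem _ hlt ?_
    rw [← h2, hf.vertices]
    exact mem_range_self k
  have hexp : Complex.exp (w₀ + Complex.log (1 + δ)) = b * (1 + δ) := by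
    rw [Complex.exp_add, Complex.exp_log (Complex.slitPlane_ne_zero hslit)]
  rw [← hexp, Complex.norm_exp, hre']

/-- If the outer end of the polar coordinates converges to the cone point, then each polygon has a
vertex that is developed to the centre. -/
lemma IsTiling.exists_vertex_of_outer [T2Space S] (hx : x ∈ D.sing)
    (hC : D.IsConeEnd x θ r α p)
    (hout : ∀ w : ℂ, w.re = r → Tendsto p (𝓝[{w | w.re < r}] w) (𝓝 x)) {i : J}
    {z₀ : regPoly n} {w₀ : ℂ} (hz₀ : (z₀ : ℂ) ∈ polyCore n) (hw₀ : w₀.re < r) (h : f i z₀ = p w₀) :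
    ∃ k : ZMod n, Complex.exp w₀ + a i / α * (polyVertex n k - z₀) = 0 := by
  by_contra hcon
  push Not at hcon
  have hn := hf.three_le
  have hβ : a i / α ≠ 0 := div_ne_zero (hf.a_ne_zero i) hC.ne_zero
  -- Otherwise all vertices are developed to the circle of radius `exp r`, and then the centre of
  -- the polygon is developed to the origin. But a point that is not a vertex is never developed to
  -- the origin.
  have h1 : Complex.exp w₀ - a i / α * z₀ = 0 := by
    refine eq_zero_of_norm_add_polyVertex hn hβ (R := Real.exp r) fun k => ?_
    rw [← (hf.norm_vertex_of_outer hx hC hout hz₀ hw₀ h k).resolve_left (hcon k)]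
    congr 1
    ring
  have h2 := (hf.dev_cone hx hC (z := ⟨0, zero_mem_regPoly hn⟩) hz₀ (zero_mem_polyCore hn) hw₀ h
    (Or.inl hout)).1
  refine Complex.slitPlane_ne_zero h2 ?_
  have hb0 : Complex.exp w₀ ≠ 0 := Complex.exp_ne_zero w₀
  field_simp
  linear_combination h1

/-- The outer end of the polar coordinates does not converge to the cone point. -/
lemma IsTiling.not_outer [T2Space S] (hx : x ∈ D.sing) (hC : D.IsConeEnd x θ r α p) :
    ¬ ∀ w : ℂ, w.re = r → Tendsto p (𝓝[{w | w.re < r}] w) (𝓝 x) := by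
  intro hout
  have hn := hf.three_le
  have hw₀ : ((r - 1 : ℝ) : ℂ).re < r := by simp
  set w₀ : ℂ := ((r - 1 : ℝ) : ℂ)
  obtain ⟨i, z₀, h⟩ := hf.cover _ (hC.notMem w₀ hw₀)
  have hz₀ : (z₀ : ℂ) ∈ polyCore n := by
    rw [mem_polyCore_iff, ← hf.vertices i z₀, h]; exact hC.notMem w₀ hw₀
  obtain ⟨k₀, hk₀⟩ := hf.exists_vertex_of_outer hx hC hout hz₀ hw₀ h
  -- As `n ≥ 3`, side `k₀ + 1` does not contain vertex `k₀`. The polygon glued there also has a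
  -- vertex developed to the origin, yet the two polygons lie on opposite sides of the line of this
  -- side, and vertex `k₀` lies off that line.
  set k := k₀ + 1 with hk
  let m : regPoly n := ⟨polyMid n k, polySide_subset k (polyMid_mem_polySide k)⟩
  have hm : (m : ℂ) ∈ polyCore n := (mem_polyCore_iff m).2 (polyMid_notMem_range hn k)
  obtain ⟨hs1, hr1, he1⟩ := hf.dev_cone hx hC (z := m) hz₀ hm hw₀ h (Or.inl hout)
  set w₁ := w₀ + Complex.log (1 + a i / α * (m - z₀) / Complex.exp w₀) with hw₁
  have hexp : Complex.exp w₁ = a i / α * (polyMid n k - polyVertex n k₀) := by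
    rw [hw₁, Complex.exp_add, Complex.exp_log (Complex.slitPlane_ne_zero hs1), mul_add, mul_one,
      mul_div_cancel₀ _ (Complex.exp_ne_zero w₀)]
    linear_combination hk₀
  obtain ⟨j, l, hnormal, hglue⟩ := hf.exists_glued i k
  obtain ⟨m', hm', hmm', hpos, -⟩ := hglue m (polyMid_mem_polySide k)
  have hm'l : (m' : ℂ) = polyMid n l := by
    have h0 : a j * ((m' : ℂ) - polyMid n l) = 0 := by rw [hpos]; simp [m]
    exact sub_eq_zero.1 ((mul_eq_zero.1 h0).resolve_left (hf.a_ne_zero j))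
  obtain ⟨l₀, hl₀⟩ := hf.exists_vertex_of_outer hx hC hout (hf.mem_core_of_eq hmm' hm) hr1
    (hmm'.symm.trans he1)
  rw [hexp, hm'l] at hl₀
  have heq : a i * (polyMid n k - polyVertex n k₀) = a j * (polyMid n l - polyVertex n l₀) := by
    have := hC.ne_zero
    field_simp at hl₀
    linear_combination hl₀
  have hdec : ∀ (k v : ZMod n), polyMid n k - polyVertex n v = polyNormal n k *
      ((starRingEnd ℂ) (polyNormal n k) * (polyMid n k - polyVertex n v)) := fun k v => by
    rw [mul_left_comm, conj_polyNormal_mul]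
  have hre : ∀ (k v : ZMod n), ((starRingEnd ℂ) (polyNormal n k) *
      (polyMid n k - polyVertex n v)).re =
      Real.cos (polyAngle n) - polyHeight n k (polyVertex n v) := fun k v => by
    rw [← polyHeight_apply, map_sub, polyHeight_of_mem_polySide (polyMid_mem_polySide k)]
  rw [hdec k k₀, hdec l l₀] at heq
  have heq' : (starRingEnd ℂ) (polyNormal n k) * (polyMid n k - polyVertex n k₀) =
      -((starRingEnd ℂ) (polyNormal n l) * (polyMid n l - polyVertex n l₀)) := by
    refine mul_left_cancel₀ (mul_ne_zero (hf.a_ne_zero i) (polyNormal_ne_zero k)) ?_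
    linear_combination heq +
      ((starRingEnd ℂ) (polyNormal n l) * (polyMid n l - polyVertex n l₀)) * hnormal
  have h3 := congrArg Complex.re heq'
  rw [Complex.neg_re, hre, hre] at h3
  have h4 := polyHeight_vertex_le l l₀
  have h5 : polyHeight n k (polyVertex n k₀) < Real.cos (polyAngle n) := by
    refine polyHeight_vertex_lt k k₀ (fun h => ?_) (fun h => ?_)
    · exact zmod_one_ne_zero hn (by simpa [hk] using h)
    · rw [hk, add_assoc] at h
      exact zmod_two_ne_zero hn (by simpa using h)
  linarith

end ConeNeighbourhoods

/-! ### Neighbourhoods of cone points, connectedness off the singular set, and finiteness of the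
tiling. -/

section TilingConsequences

set_option linter.unusedSectionVars false

variable {n : ℕ} [NeZero n] {S : Type*} [TopologicalSpace S] {D : FlatAtlas S}
  {J : Type*} {f : J → C(regPoly n, S)} {a : J → ℂ} (hf : IsTiling D n f a)
  (hD : D.IsTranslationSurface)

include hf hD

namespace IsTiling

/-- The cone condition only makes the disc of the one radius `r` a neighbourhood. With the outer
case excluded all smaller discs are neighbourhoods too, and by `tendsto` they shrink to `x`. -/
lemma exists_cone_nhds {x : S} (hx : x ∈ D.sing) : ∃ θ r α p, D.IsConeEnd x θ r α p ∧
    ∀ r' < r, insert x (p '' {w | w.re < r'}) ∈ 𝓝 x := by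
  have := hD.isConeSurface.hausdorff
  have := hD.isConeSurface.compact
  obtain ⟨θ, r, α, p, hC⟩ := hD.exists_isConeEnd hx
  exact ⟨θ, r, α, p, hC,
    (hC.nhds_or_outer hD.isTranslational hx).resolve_right (hf.not_outer hx hC)⟩

lemma neBot_punctured_nhds {x : S} (hx : x ∈ D.sing) : (𝓝[≠] x).NeBot := by
  obtain ⟨θ, r, α, p, hC, hn⟩ := hf.exists_cone_nhds hD hx
  rw [← mem_closure_iff_nhdsWithin_neBot, mem_closure_iff_nhds]
  intro s hs
  obtain ⟨t, ht, hts⟩ := mem_comap.1 (hC.tendsto hs)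
  obtain ⟨c, hc⟩ := mem_atBot_sets.1 ht
  set w : ℂ := ((min c (r - 1) : ℝ) : ℂ)
  have hw : w.re < r := by simp [w]
  refine ⟨p w, hts (show w.re ∈ t from hc _ (by simp [w])), fun h => ?_⟩
  exact hC.notMem w hw (by rw [show p w = x from h]; exact hx)

lemma exists_preconnected_punctured_nhds {x : S} (hx : x ∈ D.sing) {s : Set S} (hs : s ∈ 𝓝[≠] x) :
    ∃ t ∈ 𝓝[≠] x, t ⊆ s ∧ IsPreconnected t := by
  obtain ⟨θ, r, α, p, hC, hn⟩ := hf.exists_cone_nhds hD hx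
  obtain ⟨u, hu, hus⟩ := mem_nhdsWithin_iff_exists_mem_nhds_inter.1 hs
  obtain ⟨t, ht, htu⟩ := mem_comap.1 (hC.tendsto hu)
  obtain ⟨c, hc⟩ := mem_atBot_sets.1 ht
  have hcr : min c (r - 1) < r := (min_le_right _ _).trans_lt (by linarith)
  refine ⟨p '' {w | w.re ∈ Iio (min c (r - 1))}, ?_, ?_,
    hC.isPreconnected_image (convex_Iio _) fun t ht => lt_trans ht hcr⟩
  · filter_upwards [mem_nhdsWithin_of_mem_nhds (hn _ hcr), self_mem_nhdsWithin] with y h1 h2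
    exact h1.resolve_left h2
  · rintro _ ⟨w, hw, rfl⟩
    have hw' : w.re < min c (r - 1) := hw
    refine hus ⟨htu (show w.re ∈ t from hc _ (hw'.le.trans (min_le_left _ _))), fun h => ?_⟩
    exact hC.notMem w (hw'.trans hcr) (by rw [show p w = x from h]; exact hx)

/-- The complement of the singular set is connected. -/
lemma isPreconnected_compl_sing [PreconnectedSpace S] : IsPreconnected D.singᶜ := by
  refine isPreconnected_compl_of_punctured_nhds hD.isTranslational.isClosed_sing fun x hx => ?_
  obtain ⟨θ, r, α, p, hC⟩ := hD.exists_isConeEnd hx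
  refine ⟨p '' {w | w.re ∈ Iio r}, hC.isPreconnected_image (convex_Iio _) fun t ht => ht,
    ⟨p ((r - 1 : ℝ) : ℂ), mem_image_of_mem p (by simp)⟩, ?_, hC.nhds⟩
  rintro _ ⟨w, hw, rfl⟩
  exact hC.notMem w hw

/-- Near a regular point there is at most one centre of a polygon. -/
lemma exists_nhds_center_of_notMem {x : S} (hx : x ∉ D.sing) (o : regPoly n) (ho : (o : ℂ) = 0) :
    ∃ N ∈ 𝓝 x, ∀ i j, f i o ∈ N → f j o ∈ N → i = j := by
  have hT := hD.isTranslational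
  have := hD.isConeSurface.hausdorff
  have hn := hf.three_le
  obtain ⟨s, hs, hsa⟩ := hf.norm_eq
  obtain ⟨φ, hφ, hxφ⟩ := hT.cover x hx
  obtain ⟨ε, hε, hball⟩ := Metric.isOpen_iff.1 φ.open_target _ (φ.map_source hxφ)
  have hcos := cos_polyAngle_pos hn
  -- `3 * η ≤ ε` keeps the development of polygon `i` inside the chart, and `2 * η` is at most the
  -- inradius `s * cos (π / n)`, so the centre of polygon `j` is an interior point of polygon `i`.
  set η : ℝ := min (ε / 3) (s * Real.cos (polyAngle n) / 2) with hη
  have hη0 : 0 < η := lt_min (by linarith) (by positivity)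
  have hη1 : 3 * η ≤ ε := by
    have := min_le_left (ε / 3) (s * Real.cos (polyAngle n) / 2)
    linarith
  have hη2 : 2 * η / s ≤ Real.cos (polyAngle n) := by
    have := min_le_right (ε / 3) (s * Real.cos (polyAngle n) / 2)
    rw [div_le_iff₀ hs]
    linarith
  refine ⟨φ.source ∩ φ ⁻¹' Metric.ball (φ x) η, inter_mem (φ.open_source.mem_nhds hxφ)
    ((φ.continuousAt hxφ).preimage_mem_nhds (Metric.ball_mem_nhds _ hη0)), fun i j hi hj => ?_⟩
  set ci := φ (f i o) with hci
  set cj := φ (f j o) with hcj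
  have hi2 : dist ci (φ x) < η := hi.2
  have hj2 : dist cj (φ x) < η := hj.2
  have hij : ‖cj - ci‖ < 2 * η := by
    rw [← dist_eq_norm]
    have := dist_triangle_right cj ci (φ x)
    linarith
  let X := Metric.ball (0 : ℂ) (2 * η / s)
  have hXint : ∀ z ∈ X, z ∈ interior (regPoly n) := fun z hz =>
    mem_interior_of_norm_lt hn ((mem_ball_zero_iff.1 hz).trans_le hη2)
  have hXcore : ∀ z ∈ X, z ∈ polyCore n := by
    intro z hz
    refine ⟨interior_subset (hXint z hz), ?_⟩
    rw [mem_ball_zero_iff]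
    exact ((mem_ball_zero_iff.1 hz).trans_le hη2).trans (cos_polyAngle_lt_one hn)
  have hXt : ∀ z ∈ X, ci + a i * z ∈ φ.target := by
    intro z hz
    apply hball
    rw [Metric.mem_ball]
    have h1 : ‖a i * z‖ < 2 * η := by
      rw [norm_mul, hsa, mul_comm]
      exact (lt_div_iff₀ hs).1 (mem_ball_zero_iff.1 hz)
    calc dist (ci + a i * z) (φ x) ≤ dist (ci + a i * z) ci + dist ci (φ x) := dist_triangle _ _ _
      _ < 2 * η + η := by
          refine add_lt_add ?_ hi2
          rwa [dist_eq_norm, add_sub_cancel_left]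
      _ ≤ ε := by linarith
  have : PreconnectedSpace X := Subtype.preconnectedSpace (convex_ball (0 : ℂ) _).isPreconnected
  let u : C(X, regPoly n) := ⟨fun z => ⟨z, (hXcore z z.2).1⟩, by fun_prop⟩
  have hG : Continuous fun z : X => φ.symm (ci + a i * z) :=
    φ.continuousOn_symm.comp_continuous (by fun_prop) fun z => hXt z z.2
  have hX0 : (0 : ℂ) ∈ X := by simp only [X, Metric.mem_ball, dist_self]; positivity
  have hu0 : u ⟨0, hX0⟩ = o := Subtype.ext ho.symm
  have heq := eq_of_devAt (D := D) (X := X) (F := fun z => f i (u z))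
    (G := fun z => φ.symm (ci + a i * z)) (by fun_prop) hG (δ := fun z => a i * (z : ℂ))
    (fun z => (hf.dev i (u z) (hXcore z z.2)).comp (u := u) u.continuous.continuousAt rfl)
    (fun z => hT.devAt_of_chart hφ (φ.map_target (hXt z z.2)) hG.continuousAt (b := ci)
      (Eventually.of_forall fun y => by rw [φ.right_inv (hXt y y.2)]; ring))
    (ξ := ⟨0, hX0⟩) (by
      rw [hu0, mul_zero, add_zero, hci, φ.left_inv hi.1])
  have hz : (cj - ci) / a i ∈ X := by
    rw [mem_ball_zero_iff, norm_div, hsa]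
    exact div_lt_div_of_pos_right hij hs
  have h2 : φ.symm (ci + a i * ((cj - ci) / a i)) = f j o := by
    rw [mul_div_cancel₀ _ (hf.a_ne_zero i), add_sub_cancel]; exact φ.left_inv hj.1
  have h1 : f i (u ⟨_, hz⟩) = f j o := (congrFun heq ⟨_, hz⟩).trans h2
  exact (hf.interior_disjoint i j _ _ (hXint _ hz) h1).1

/-- Near a singular point there is no centre of a polygon. -/
lemma exists_nhds_center_of_mem {x : S} (hx : x ∈ D.sing) (o : regPoly n) (ho : (o : ℂ) = 0) :
    ∃ N ∈ 𝓝 x, ∀ i, f i o ∉ N := by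
  have := hD.isConeSurface.hausdorff
  have hn := hf.three_le
  obtain ⟨s, hs, hsa⟩ := hf.norm_eq
  obtain ⟨θ, r, α, p, hC, hnh⟩ := hf.exists_cone_nhds hD hx
  have hcos := cos_polyAngle_pos hn
  have hα : 0 < ‖α‖ := norm_pos_iff.2 hC.ne_zero
  have hoc : (o : ℂ) ∈ polyCore n := ho ▸ zero_mem_polyCore hn
  -- Half of `exp r` keeps the developed segment inside the disc; the other bound is the inradius in
  -- the scale of the development. The point `z` below would be an interior point of the polygon
  -- developed to the apex.
  set ρ : ℝ := min (Real.exp r / 2) (s * Real.cos (polyAngle n) / ‖α‖) with hρ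
  have hρ0 : 0 < ρ := lt_min (by positivity) (by positivity)
  have hlog : Real.log ρ < r := by
    rw [Real.log_lt_iff_lt_exp hρ0]
    exact (min_le_left _ _).trans_lt (half_lt_self (Real.exp_pos r))
  refine ⟨_, hnh _ hlog, ?_⟩
  rintro i (hi | ⟨w, hw, hi⟩)
  · exact hf.notMem_sing hoc (hi ▸ hx)
  have hw' : w.re < Real.log ρ := hw
  have hnorm : ‖Complex.exp w‖ < ρ := by
    rw [Complex.norm_exp]; exact (Real.lt_log_iff_exp_lt hρ0).1 hw'
  set z : ℂ := -(Complex.exp w * α / a i) with hz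
  have hzn : ‖z‖ < Real.cos (polyAngle n) := by
    rw [hz, norm_neg, norm_div, norm_mul, hsa, div_lt_iff₀ hs]
    have := hnorm.trans_le (min_le_right _ _)
    rw [lt_div_iff₀ hα] at this
    linarith
  have hzc : z ∈ polyCore n := ⟨interior_subset (mem_interior_of_norm_lt hn hzn), by
    rw [mem_ball_zero_iff]; exact hzn.trans (cos_polyAngle_lt_one hn)⟩
  have ha := hf.a_ne_zero i
  have hα0 := hC.ne_zero
  have hb0 := Complex.exp_ne_zero w
  have hmul : a i / α * (z - (o : ℂ)) = -Complex.exp w := by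
    rw [ho, hz]; field_simp; ring
  have h1 := (hf.dev_cone hx hC (z := ⟨z, hzc.1⟩) hoc hzc (hw'.trans hlog) hi.symm (Or.inr (by
    rw [hmul, norm_neg]
    have := hnorm.trans_le (min_le_left _ _)
    linarith))).1
  rw [hmul] at h1
  refine Complex.slitPlane_ne_zero h1 ?_
  field_simp
  ring

/-- Each point has a neighbourhood with at most one centre of a polygon, and the surface is compact.
-/
lemma finite : Finite J := by
  have := hD.isConeSurface.compact
  have hn := hf.three_le
  let o : regPoly n := ⟨0, zero_mem_regPoly hn⟩
  have hex : ∀ x, ∃ N ∈ 𝓝 x, {i | f i o ∈ N}.Subsingleton := by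
    intro x
    by_cases hx : x ∈ D.sing
    · obtain ⟨N, hN, h⟩ := hf.exists_nhds_center_of_mem hD hx o rfl
      exact ⟨N, hN, fun i hi => absurd hi (h i)⟩
    · obtain ⟨N, hN, h⟩ := hf.exists_nhds_center_of_notMem hD hx o rfl
      exact ⟨N, hN, fun i hi j hj => h i j hi hj⟩
  choose N hN hsub using hex
  obtain ⟨t, ht⟩ := CompactSpace.elim_nhds_subcover N hN
  have hfin : (⋃ x ∈ t, {i | f i o ∈ N x}).Finite :=
    t.finite_toSet.biUnion fun x _ => (hsub x).finite
  refine finite_univ_iff.1 (hfin.subset fun i _ => ?_)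
  obtain ⟨x, hx, hi⟩ := mem_iUnion₂.1 (ht ▸ mem_univ (f i o) : f i o ∈ ⋃ x ∈ t, N x)
  exact mem_biUnion hx hi

/-- The polygons cover the whole surface. -/
lemma cover_all (x : S) : ∃ i z, f i z = x := by
  by_cases hx : x ∈ D.sing
  · have := hf.finite hD
    have := hD.isConeSurface.hausdorff
    have hcl : IsClosed (⋃ i, range (f i)) :=
      isClosed_iUnion_of_finite fun i => (isCompact_range (f i).continuous).isClosed
    have := hf.neBot_punctured_nhds hD hx
    have h1 : x ∈ ⋃ i, range (f i) := by
      refine hcl.mem_of_frequently_of_tendsto (b := 𝓝[≠] x) (f := id) ?_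
        (tendsto_id.mono_left nhdsWithin_le_nhds)
      refine Eventually.frequently ?_
      have hfin := hD.isConeSurface.finite_sing
      have h2 : (D.sing \ {x})ᶜ ∈ 𝓝 x :=
        (hfin.subset sdiff_subset).isClosed.isOpen_compl.mem_nhds (by simp)
      filter_upwards [mem_nhdsWithin_of_mem_nhds h2, self_mem_nhdsWithin] with y hy hyx
      obtain ⟨i, z, h⟩ := hf.cover y fun h => hy ⟨h, hyx⟩
      exact mem_iUnion.2 ⟨i, z, h⟩
    obtain ⟨i, z, h⟩ := mem_iUnion.1 h1
    exact ⟨i, z, h⟩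
  · exact hf.cover x hx

end IsTiling

end TilingConsequences

/-! ### Lifting isometries to the unfolding -/

section IsometryLifts

set_option linter.unusedSectionVars false

variable {S S' : Type*} [TopologicalSpace S] [TopologicalSpace S'] {D : FlatAtlas S}
  {D' : FlatAtlas S'} {p : C(S', S)}

lemma FlatAtlas.IsIsometry.symm {g : S ≃ₜ S} (hg : D.IsIsometry g) : D.IsIsometry g.symm where
  map_sing x := by rw [← hg.map_sing, g.apply_symm_apply]
  isometry x hx φ hφ hxφ ψ hψ hxψ := by
    have hx' : g.symm x ∉ D.sing := by rwa [← hg.map_sing, g.apply_symm_apply]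
    obtain ⟨A, hA⟩ := hg.isometry _ hx' ψ hψ hxψ φ hφ (by rwa [g.apply_symm_apply])
    refine ⟨A.symm, ?_⟩
    filter_upwards [g.symm.continuous.continuousAt.eventually hA] with y hy
    rw [g.apply_symm_apply] at hy
    rw [hy, A.symm_apply_apply]

/-- In a translation surface, a connected complement of the singular set is path connected. -/
lemma FlatAtlas.IsTranslational.joinedIn_compl_sing (hT : D.IsTranslational)
    (hc : IsPreconnected D.singᶜ) {x y : S} (hx : x ∉ D.sing) (hy : y ∉ D.sing) :
    JoinedIn D.singᶜ x y := by
  refine hc.induction₂ (fun x y => JoinedIn D.singᶜ x y) (fun x hx => ?_)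
    (fun _ _ _ _ _ _ h1 h2 => h1.trans h2) (fun _ _ _ _ h => h.symm) hx hy
  obtain ⟨φ, hφ, hxφ⟩ := hT.cover x hx
  obtain ⟨ε, hε, hball⟩ := Metric.isOpen_iff.1 φ.open_target _ (φ.map_source hxφ)
  have hpc : IsPathConnected (φ.symm '' Metric.ball (φ x) ε) :=
    ((convex_ball _ _).isPathConnected ⟨_, Metric.mem_ball_self hε⟩).image'
      (φ.continuousOn_symm.mono hball)
  refine mem_nhdsWithin_of_mem_nhds ?_
  filter_upwards [φ.open_source.mem_nhds hxφ,
    (φ.continuousAt hxφ).preimage_mem_nhds (Metric.ball_mem_nhds _ hε)] with y hy hyb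
  refine (hpc.joinedIn x ⟨φ x, Metric.mem_ball_self hε, φ.left_inv hxφ⟩ y
    ⟨φ y, hyb, φ.left_inv hy⟩).mono ?_
  rintro _ ⟨z, hz, rfl⟩
  exact hT.source_subset φ hφ (φ.map_target (hball hz))

namespace IsUnfolding

variable (hp : IsUnfolding D D' p) (hC : D.IsConeSurface)

include hp

lemma isTranslational : D'.IsTranslational := hp.isTranslationSurface.isTranslational

lemma exists_derivative {x : S'} (hx : x ∉ D'.sing) {φ : OpenPartialHomeomorph S ℂ}
    (hφ : φ ∈ D.charts) (hxφ : p x ∈ φ.source) : ∃ a : ℂ, a ≠ 0 ∧ ‖a‖ = 1 ∧ ∀ᶠ x' in 𝓝 x,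
      ∀ᶠ t in 𝓝 (0 : ℂ), φ (p (D'.move x' t)) = φ (p x') + a * t := by
  obtain ⟨φ', hφ', hxφ'⟩ := hp.isTranslational.cover x hx
  obtain ⟨a, b, ha, hab⟩ := hp.isometry x hx φ' hφ' hxφ' φ hφ hxφ
  refine ⟨a, by rw [← norm_ne_zero_iff, ha]; exact one_ne_zero, ha, ?_⟩
  filter_upwards [eventually_eventually_nhds.2 hab, φ'.open_source.mem_nhds hxφ'] with x' h1 h2
  have hx' := hp.isTranslational.source_subset φ' hφ' h2
  filter_upwards [(hp.isTranslational.tendsto_move hx').eventually h1,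
    hp.isTranslational.chart_move hφ' h2] with t h3 h4
  rw [h3, h4.2, h1.self_of_nhds]
  ring

lemma derivative_unique {x : S'} {φ : OpenPartialHomeomorph S ℂ} {a b : ℂ}
    (ha : ∀ᶠ t in 𝓝 (0 : ℂ), φ (p (D'.move x t)) = φ (p x) + a * t)
    (hb : ∀ᶠ t in 𝓝 (0 : ℂ), φ (p (D'.move x t)) = φ (p x) + b * t) : a = b := by
  have h : ∀ᶠ t in 𝓝[≠] (0 : ℂ), a * t = b * t := by
    filter_upwards [mem_nhdsWithin_of_mem_nhds ha, mem_nhdsWithin_of_mem_nhds hb] with t h1 h2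
    exact add_left_cancel (h1.symm.trans h2)
  obtain ⟨t, h1, h2⟩ := (h.and self_mem_nhdsWithin).exists
  exact mul_right_cancel₀ h2 h1

lemma tendsto_map_move {x : S'} (hx : x ∉ D'.sing) :
    Tendsto (fun t => p (D'.move x t)) (𝓝 0) (𝓝 (p x)) :=
  (p.continuous.tendsto x).comp (hp.isTranslational.tendsto_move hx)

include hC

/-- The components of a parallel vector field with respect to the derivative of the covering. -/
lemma parallel_iff_of_chart {γ : C(unitInterval, S')} (hγ : ∀ t, γ t ∉ D'.sing)
    {v : unitInterval → OpenPartialHomeomorph S ℂ → ℂ} (hv : D.IsParallelAlong (p.comp γ) v)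
    {t : unitInterval} {φ : OpenPartialHomeomorph S ℂ} (hφ : φ ∈ D.charts)
    (htφ : p (γ t) ∈ φ.source) {a : ℂ}
    (ha : ∀ᶠ τ in 𝓝 (0 : ℂ), φ (p (D'.move (γ t) τ)) = φ (p (γ t)) + a * τ) (c : ℂ) :
    (∀ ψ ∈ D.charts, p (γ t) ∈ ψ.source → ∀ b : ℂ,
      (∀ᶠ τ in 𝓝 (0 : ℂ), ψ (p (D'.move (γ t) τ)) = ψ (p (γ t)) + b * τ) → v t ψ = b * c) ↔
    v t φ = a * c := by
  refine ⟨fun h => h φ hφ htφ a ha, fun h ψ hψ htψ b hb => ?_⟩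
  obtain ⟨α, β, hα, hαβ⟩ := hC.transition φ hφ ψ hψ _ ⟨htφ, htψ⟩
  have hb' : b = α * a := by
    refine hp.derivative_unique (φ := ψ) hb ?_
    filter_upwards [ha, (hp.tendsto_map_move (hγ t)).eventually hαβ] with τ h1 h2
    rw [h2, h1, hαβ.self_of_nhds]
    ring
  rw [hv.change t φ hφ ψ hψ htφ htψ α β hαβ, h, hb']
  ring

/-- A point of the unfolding is determined by the germ of the covering at this point. -/
lemma eq_of_map_move_eq (hc : IsPreconnected D'.singᶜ) {x y : S'} (hx : x ∉ D'.sing)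
    (hy : y ∉ D'.sing) (h : ∀ᶠ t in 𝓝 (0 : ℂ), p (D'.move x t) = p (D'.move y t)) : x = y := by
  have hT := hp.isTranslational
  have hxy : p x = p y := by
    have := h.self_of_nhds
    rwa [hT.move_zero hx, hT.move_zero hy] at this
  obtain ⟨γ, hγ⟩ := hT.joinedIn_compl_sing hc hx hy
  have hγ0 : (γ : C(unitInterval, S')) 0 = x := γ.source
  have hγ1 : (γ : C(unitInterval, S')) 1 = y := γ.target
  suffices (γ : C(unitInterval, S')) 0 = (γ : C(unitInterval, S')) 1 by rwa [hγ0, hγ1] at this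
  rw [hp.closed_iff γ hγ (by rw [hγ0, hγ1, hxy])]
  intro v hv φ hφ hφ0
  have hφ0' : p ((γ : C(unitInterval, S')) 0) ∈ φ.source := hφ0
  rw [hγ0] at hφ0'
  -- `B t c` says that the parallel field has component `c` in the frame pushed down from the
  -- translation surface. This component is constant along the path. Equal germs at the endpoints
  -- mean equal frames, so parallel transport is trivial and `closed_iff` applies.
  let B : unitInterval → ℂ → Prop := fun t c => ∀ ψ ∈ D.charts, p (γ t) ∈ ψ.source → ∀ b : ℂ,
      (∀ᶠ τ in 𝓝 (0 : ℂ), ψ (p (D'.move (γ t) τ)) = ψ (p (γ t)) + b * τ) → v t ψ = b * c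
  have hB : ∀ s t, ∀ c, B s c ↔ B t c := by
    intro s t
    refine isPreconnected_univ.induction₂ (fun s t => ∀ c, B s c ↔ B t c) (fun t _ => ?_)
      (fun _ _ _ _ _ _ h1 h2 c => (h1 c).trans (h2 c)) (fun _ _ _ _ h c => (h c).symm)
      (mem_univ s) (mem_univ t)
    obtain ⟨ψ, hψ, htψ⟩ := hC.cover (p (γ t)) (by rw [hp.map_mem_sing_iff]; exact hγ t)
    obtain ⟨a, ha0, ha1, ha⟩ := hp.exists_derivative (hγ t) hψ htψ
    rw [nhdsWithin_univ]
    filter_upwards [γ.continuous.continuousAt.eventually ha, hv.locally_const t ψ hψ htψ,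
      (p.continuous.comp γ.continuous).continuousAt.preimage_mem_nhds
        (ψ.open_source.mem_nhds htψ)] with s h1 h2 h3 c
    exact (hp.parallel_iff_of_chart (γ := γ) hC hγ hv hψ htψ ha.self_of_nhds c).trans
      ((Eq.congr_left h2).symm.trans
        (hp.parallel_iff_of_chart (γ := γ) hC hγ hv hψ h3 h1 c).symm)
  obtain ⟨a, ha0, ha1, ha⟩ := hp.exists_derivative hx hφ hφ0'
  have ha' := ha.self_of_nhds
  have h0 := (hp.parallel_iff_of_chart (γ := γ) hC hγ hv (t := 0) hφ (by simpa using hφ0')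
    (a := a) (by simpa using ha') (v 0 φ / a)).2 (by field_simp)
  have h1 := (hB 0 1 _).1 h0 φ hφ (by simpa [← hxy] using hφ0') a (by
    simp only [Path.target, ← hxy]
    filter_upwards [ha', h] with t h2 h3
    rw [← h3, h2])
  rw [h1]
  field_simp

end IsUnfolding

end IsometryLifts

/-! ### Local lifts of an isometry and their continuation along paths. -/

section IsometryLifts

set_option linter.unusedSectionVars false

variable {S S' : Type*} [TopologicalSpace S] [TopologicalSpace S'] {D : FlatAtlas S}
  {D' : FlatAtlas S'} {p : C(S', S)}

/-- The map `g` lifts near `x` to the affine map with linear part `L` that sends `x` to `y`. -/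
def LiftsAt (D' : FlatAtlas S') (p : C(S', S)) (g : S ≃ₜ S) (L : ℂ ≃ₗᵢ[ℝ] ℂ) (x y : S') : Prop :=
  ∀ᶠ t in 𝓝 (0 : ℂ), g (p (D'.move x t)) = p (D'.move y (L t))

lemma LinearIsometryEquiv.tendsto_zero (L : ℂ ≃ₗᵢ[ℝ] ℂ) : Tendsto L (𝓝 0) (𝓝 0) := by
  simpa using L.continuous.tendsto 0

lemma LinearMap.eq_of_eventuallyEq {L L' : ℂ →ₗ[ℝ] ℂ} (h : ∀ᶠ t in 𝓝 (0 : ℂ), L t = L' t) :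
    L = L' := by
  obtain ⟨ε, hε, hb⟩ := Metric.eventually_nhds_iff_ball.1 h
  refine LinearMap.ext fun z => ?_
  have hz : (0 : ℝ) < ‖z‖ + 1 := by positivity
  set r : ℝ := ε / (‖z‖ + 1) with hr
  have hr0 : 0 < r := by positivity
  have h1 := hb (r • z) (by
    rw [mem_ball_zero_iff, norm_smul, Real.norm_of_nonneg hr0.le, hr, div_mul_eq_mul_div,
      div_lt_iff₀ hz]
    nlinarith)
  rw [map_smul, map_smul] at h1
  exact smul_right_injective ℂ hr0.ne' h1

/-- By the theorem of Mazur and Ulam, isometries of the plane are real affine. -/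
lemma IsometryEquiv.exists_linear (G : ℂ ≃ᵢ ℂ) :
    ∃ M : ℂ ≃ₗᵢ[ℝ] ℂ, ∀ u w, G (u + w) = G u + M w := by
  refine ⟨G.toRealAffineIsometryEquiv.linearIsometryEquiv, fun u w => ?_⟩
  have := G.toRealAffineIsometryEquiv.map_vadd u w
  simpa [add_comm] using this

namespace IsUnfolding

variable (hp : IsUnfolding D D' p) (hC : D.IsConeSurface) {g : S ≃ₜ S} (hg : D.IsIsometry g)
  {L : ℂ ≃ₗᵢ[ℝ] ℂ} {x y : S'}

include hp

lemma map_eq_of_liftsAt (hx : x ∉ D'.sing) (hy : y ∉ D'.sing) (h : LiftsAt D' p g L x y) :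
    g (p x) = p y := by
  have := h.self_of_nhds
  rwa [map_zero, hp.isTranslational.move_zero hx, hp.isTranslational.move_zero hy] at this

lemma liftsAt_symm (h : LiftsAt D' p g L x y) : LiftsAt D' p g.symm L.symm y x := by
  filter_upwards [L.symm.tendsto_zero.eventually h] with t ht
  rw [g.symm_apply_eq, ht, L.apply_symm_apply]

lemma liftsAt_move (hx : x ∉ D'.sing) (hy : y ∉ D'.sing) (h : LiftsAt D' p g L x y) :
    ∀ᶠ s in 𝓝 (0 : ℂ), LiftsAt D' p g L (D'.move x s) (D'.move y (L s)) := by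
  have hT := hp.isTranslational
  filter_upwards [eventually_eventually_nhds.2 h, hT.move_move hx,
    L.tendsto_zero.eventually (hT.move_move hy)] with s h1 h2 h3
  have hs : Tendsto (fun t => s + t) (𝓝 0) (𝓝 s) := by
    have : Continuous fun t : ℂ => s + t := by fun_prop
    simpa using this.tendsto 0
  filter_upwards [hs.eventually h1, h2, L.tendsto_zero.eventually h3] with t h4 h5 h6
  rw [h5, h6, h4, map_add]

include hC

lemma exists_injOn_map_move (hx : x ∉ D'.sing) :
    ∃ U ∈ 𝓝 (0 : ℂ), InjOn (fun t => p (D'.move x t)) U := by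
  obtain ⟨φ, hφ, hxφ⟩ := hC.cover (p x) (by rwa [hp.map_mem_sing_iff])
  obtain ⟨a, ha0, -, ha⟩ := hp.exists_derivative hx hφ hxφ
  refine ⟨_, ha.self_of_nhds, fun s hs t ht h => ?_⟩
  have h1 : φ (p (D'.move x s)) = φ (p x) + a * s := hs
  have h2 : φ (p (D'.move x t)) = φ (p x) + a * t := ht
  rw [show p (D'.move x s) = p (D'.move x t) from h, h2] at h1
  exact (mul_left_cancel₀ ha0 (add_left_cancel h1)).symm

/-- The covering is injective near a regular point. -/
lemma exists_injOn_nhds (hx : x ∉ D'.sing) : ∃ N ∈ 𝓝 x, InjOn p N := by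
  obtain ⟨U, hU, hinj⟩ := hp.exists_injOn_map_move hC hx
  refine ⟨D'.move x '' U, hp.isTranslational.map_move_nhds hx ▸ image_mem_map hU, ?_⟩
  rintro _ ⟨s, hs, rfl⟩ _ ⟨t, ht, rfl⟩ h
  rw [hinj hs ht h]

lemma liftsAt_linear_unique {L' : ℂ ≃ₗᵢ[ℝ] ℂ} (hy : y ∉ D'.sing) (h : LiftsAt D' p g L x y)
    (h' : LiftsAt D' p g L' x y) : L = L' := by
  obtain ⟨U, hU, hinj⟩ := hp.exists_injOn_map_move hC hy
  refine LinearIsometryEquiv.toLinearEquiv_injective (LinearEquiv.toLinearMap_injective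
    (LinearMap.eq_of_eventuallyEq ?_))
  filter_upwards [h, h', L.tendsto_zero hU, L'.tendsto_zero hU] with t h1 h2 h3 h4
  exact hinj h3 h4 (h1.symm.trans h2)

/-- This replaces a lifting criterion in terms of fundamental groups: once the linear part is
prescribed, the value of a lift cannot depend on the path of continuation. -/
lemma liftsAt_unique (hc : IsPreconnected D'.singᶜ) {y' : S'} (hy : y ∉ D'.sing)
    (hy' : y' ∉ D'.sing) (h : LiftsAt D' p g L x y) (h' : LiftsAt D' p g L x y') : y = y' := by
  refine hp.eq_of_map_move_eq hC hc hy hy' ?_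
  filter_upwards [L.symm.tendsto_zero.eventually h, L.symm.tendsto_zero.eventually h']
    with t h1 h2
  rw [L.apply_symm_apply] at h1 h2
  rw [← h1, h2]

-- In charts `g` is an isometry of the plane with linear part `M`, and `p` is a rotation near `x`
-- and near `y`; `L` is composed of these.
include hg in
lemma exists_liftsAt (hx : x ∉ D'.sing) (hy : y ∉ D'.sing) (h : g (p x) = p y) :
    ∃ L, LiftsAt D' p g L x y := by
  have hpx : p x ∉ D.sing := by rwa [hp.map_mem_sing_iff]
  have hpy : p y ∉ D.sing := by rwa [hp.map_mem_sing_iff]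
  obtain ⟨φ, hφ, hxφ⟩ := hC.cover _ hpx
  obtain ⟨ψ, hψ, hyψ⟩ := hC.cover _ hpy
  obtain ⟨a, ha0, ha1, ha⟩ := hp.exists_derivative hx hφ hxφ
  obtain ⟨b, hb0, hb1, hb⟩ := hp.exists_derivative hy hψ hyψ
  obtain ⟨G, hG⟩ := hg.isometry _ hpx φ hφ hxφ ψ hψ (by rwa [h])
  let Ra : ℂ ≃ₗᵢ[ℝ] ℂ := rotation ⟨a, by simpa [Submonoid.unitSphere] using ha1⟩
  let Rb : ℂ ≃ₗᵢ[ℝ] ℂ := rotation ⟨b, by simpa [Submonoid.unitSphere] using hb1⟩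
  obtain ⟨M, hM⟩ := G.exists_linear
  refine ⟨(Ra.trans M).trans Rb.symm, ?_⟩
  have hRb : ∀ w, b * Rb.symm w = w := fun w => Rb.apply_symm_apply w
  set L := (Ra.trans M).trans Rb.symm with hL
  have hψs : ψ.source ∈ 𝓝 (p y) := ψ.open_source.mem_nhds hyψ
  have ht1 : Tendsto (fun t => g (p (D'.move x t))) (𝓝 0) (𝓝 (p y)) := by
    rw [← h]
    exact (g.continuous.tendsto _).comp (hp.tendsto_map_move hx)
  filter_upwards [ha.self_of_nhds, L.tendsto_zero.eventually hb.self_of_nhds,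
    (hp.tendsto_map_move hx).eventually hG, ht1 hψs,
    ((hp.tendsto_map_move hy).comp L.tendsto_zero) hψs] with t h1 h2 h3 h4 h5
  refine ψ.injOn h4 h5 ?_
  rw [h3, h1, hM, ← hG.self_of_nhds, h]
  exact (h2.trans (by rw [hL]; exact congrArg _ (hRb _))).symm

/-- Local lifts vary continuously. -/
lemma eventually_liftsAt (hx : x ∉ D'.sing) (hy : y ∉ D'.sing) (h : LiftsAt D' p g L x y) :
    ∀ᶠ z in 𝓝 (x, y), g (p z.1) = p z.2 → LiftsAt D' p g L z.1 z.2 := by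
  have hT := hp.isTranslational
  obtain ⟨N, hN, hinj⟩ := hp.exists_injOn_nhds hC hy
  have h1 : ∀ᶠ z in 𝓝 x, ∃ s, D'.move x s = z ∧ g (p z) = p (D'.move y (L s)) ∧
      D'.move y (L s) ∈ N ∧ LiftsAt D' p g L z (D'.move y (L s)) := by
    rw [← hT.map_move_nhds hx, eventually_map]
    filter_upwards [h, ((hT.tendsto_move hy).comp L.tendsto_zero) hN, hp.liftsAt_move hx hy h]
      with s h1 h2 h3
    exact ⟨s, rfl, h1, h2, h3⟩
  rw [nhds_prod_eq]
  filter_upwards [h1.prod_mk hN] with z ⟨⟨s, h1, h2, h3, h4⟩, h5⟩ h6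
  rwa [hinj h5 h3 (h6.symm.trans h2)]

-- The path `g ∘ p ∘ γ` is lifted from `y₀`. Local lifts persist nearby and have a unique linear
-- part, so the linear part is locally constant along the path and remains `L`.
include hg in
lemma exists_liftsAt_of_liftsAt (hc : IsPreconnected D'.singᶜ) {x₀ y₀ : S'} (hx₀ : x₀ ∉ D'.sing)
    (hy₀ : y₀ ∉ D'.sing) (h : LiftsAt D' p g L x₀ y₀) (hx : x ∉ D'.sing) :
    ∃ y, y ∉ D'.sing ∧ LiftsAt D' p g L x y := by
  have hT := hp.isTranslational
  obtain ⟨γ, hγ⟩ := hT.joinedIn_compl_sing hc hx₀ hx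
  let Γ : C(unitInterval, S) := ⟨fun t => g (p (γ t)), by fun_prop⟩
  have hΓ : ∀ t, Γ t ∈ D.singᶜ := fun t => by
    change g (p (γ t)) ∉ D.sing
    rw [hg.map_sing, hp.map_mem_sing_iff]; exact hγ t
  have : ContractibleSpace unitInterval :=
    (convex_Icc (0 : ℝ) 1).contractibleSpace ⟨0, by norm_num, by norm_num⟩
  have : LocallyPathConnectedSpace unitInterval := (convex_Icc (0 : ℝ) 1).locallyPathConnectedSpace
  obtain ⟨γ', ⟨hγ'0, hγ'⟩, -⟩ := hp.covering.existsUnique_continuousMap_lifts Γ (a₀ := 0)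
    (e₀ := y₀) (by
      change p y₀ = g (p (γ 0))
      rw [γ.source, hp.map_eq_of_liftsAt hx₀ hy₀ h]) hΓ
  have hpγ' : ∀ t, g (p (γ t)) = p (γ' t) := fun t => (congrFun hγ' t).symm
  have hγ's : ∀ t, γ' t ∉ D'.sing := fun t => by
    rw [← hp.map_mem_sing_iff, ← hpγ']; exact hΓ t
  have key : ∀ s t, LiftsAt D' p g L (γ s) (γ' s) ↔ LiftsAt D' p g L (γ t) (γ' t) := by
    intro s t
    refine isPreconnected_univ.induction₂
      (fun s t => LiftsAt D' p g L (γ s) (γ' s) ↔ LiftsAt D' p g L (γ t) (γ' t)) (fun t _ => ?_)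
      (fun _ _ _ _ _ _ h1 h2 => h1.trans h2) (fun _ _ _ _ h => h.symm) (mem_univ s) (mem_univ t)
    obtain ⟨L', hL'⟩ := hp.exists_liftsAt hC hg (hγ t) (hγ's t) (hpγ' t)
    rw [nhdsWithin_univ]
    have hcont : Tendsto (fun s => (γ s, γ' s)) (𝓝 t) (𝓝 (γ t, γ' t)) :=
      (γ.continuous.prodMk γ'.continuous).tendsto t
    filter_upwards [hcont.eventually (hp.eventually_liftsAt hC (hγ t) (hγ's t) hL')] with s hs
    have hs' := hs (hpγ' s)
    constructor
    · intro h1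
      rwa [hp.liftsAt_linear_unique hC (hγ's t) h1 hL']
    · intro h1
      rwa [hp.liftsAt_linear_unique hC (hγ's s) h1 hs']
  refine ⟨γ' 1, hγ's 1, ?_⟩
  have h1 := (key 0 1).1 (by rwa [γ.source, hγ'0])
  rwa [γ.target] at h1

end IsUnfolding

end IsometryLifts

/-! ### Global lifts of isometries. -/

section IsometryLifts

set_option linter.unusedSectionVars false

variable {S S' : Type*} [TopologicalSpace S] [TopologicalSpace S'] {D : FlatAtlas S}
  {D' : FlatAtlas S'} {p : C(S', S)}

variable {n : ℕ} [NeZero n] {J : Type*} {f : J → C(regPoly n, S')} {a : J → ℂ}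

lemma IsTiling.dense_compl_sing (hf : IsTiling D' n f a) (hD : D'.IsTranslationSurface) :
    Dense D'.singᶜ := by
  have := hD.isConeSurface.hausdorff
  intro x
  by_cases hx : x ∈ D'.sing
  · have := hf.neBot_punctured_nhds hD hx
    rw [mem_closure_iff_nhds]
    intro s hs
    have h1 : (D'.sing \ {x})ᶜ ∈ 𝓝 x :=
      (hD.isConeSurface.finite_sing.subset sdiff_subset).isClosed.isOpen_compl.mem_nhds (by simp)
    have h2 : (s ∩ (D'.sing \ {x})ᶜ) ∩ {x}ᶜ ∈ 𝓝[≠] x :=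
      inter_mem (mem_nhdsWithin_of_mem_nhds (inter_mem hs h1)) self_mem_nhdsWithin
    obtain ⟨y, ⟨hys, hy⟩, hyx⟩ := Filter.nonempty_of_mem h2
    exact ⟨y, hys, fun h => hy ⟨h, hyx⟩⟩
  · exact subset_closure hx

namespace IsUnfolding

variable (hp : IsUnfolding D D' p) (hC : D.IsConeSurface) (hf : IsTiling D' n f a) {g : S ≃ₜ S}
  (hg : D.IsIsometry g) {L : ℂ ≃ₗᵢ[ℝ] ℂ} {x₀ y₀ : S'}

include hp hC hf

-- By `liftsAt_unique` the values `h₀ x` are forced, so the local lifts fit together off the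
-- singular set. Connected punctured neighbourhoods and finite fibres give the limits at singular
-- points.
include hg in
lemma exists_continuousMap_liftsAt (hx₀ : x₀ ∉ D'.sing) (hy₀ : y₀ ∉ D'.sing)
    (h : LiftsAt D' p g L x₀ y₀) : ∃ h : C(S', S'), (∀ x, p (h x) = g (p x)) ∧
      ∀ x ∉ D'.sing, LiftsAt D' p g L x (h x) := by
  have := hp.t2Space
  have := hp.compactSpace
  have := hC.hausdorff
  have := hp.connected
  have hT := hp.isTranslational
  have hD' := hp.isTranslationSurface
  have hc := hf.isPreconnected_compl_sing hD'
  have : Nonempty S' := ⟨x₀⟩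
  choose! h₀ h₀s h₀L using fun (x : S') (hx : x ∉ D'.sing) =>
    hp.exists_liftsAt_of_liftsAt hC hg hc hx₀ hy₀ h hx
  have hmove : ∀ x ∉ D'.sing, ∀ᶠ s in 𝓝 (0 : ℂ), h₀ (D'.move x s) = D'.move (h₀ x) (L s) := by
    intro x hx
    filter_upwards [hp.liftsAt_move hx (h₀s x hx) (h₀L x hx), hT.eventually_move_notMem hx,
      L.tendsto_zero.eventually (hT.eventually_move_notMem (h₀s x hx))] with s h1 h2 h3
    exact hp.liftsAt_unique hC hc (h₀s _ h2) h3 (h₀L _ h2) h1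
  have hcont : ∀ x ∉ D'.sing, ContinuousAt h₀ x := by
    intro x hx
    rw [ContinuousAt, ← hT.map_move_nhds hx, tendsto_map'_iff]
    refine ((hT.tendsto_move (h₀s x hx)).comp L.tendsto_zero).congr' ?_
    filter_upwards [hmove x hx] with s hs
    exact hs.symm
  have hph₀ : ∀ x ∉ D'.sing, p (h₀ x) = g (p x) := fun x hx =>
    (hp.map_eq_of_liftsAt hx (h₀s x hx) (h₀L x hx)).symm
  have hlim : ∀ x ∈ D'.sing, ∃ y, Tendsto h₀ (𝓝[≠] x) (𝓝 y) := by
    intro x hx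
    have := hf.neBot_punctured_nhds hD' hx
    have hsc : D'.singᶜ ∈ 𝓝[≠] x := by
      have h1 : (D'.sing \ {x})ᶜ ∈ 𝓝 x :=
        (hD'.isConeSurface.finite_sing.subset sdiff_subset).isClosed.isOpen_compl.mem_nhds
          (by simp)
      filter_upwards [mem_nhdsWithin_of_mem_nhds h1, self_mem_nhdsWithin] with y h2 h3
      exact fun h => h2 ⟨h, h3⟩
    have hfin : (p ⁻¹' {g (p x)}).Finite := by
      refine hD'.isConeSurface.finite_sing.subset fun y hy => ?_
      rw [← hp.map_mem_sing_iff, show p y = g (p x) from hy, hg.map_sing, hp.map_mem_sing_iff]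
      exact hx
    have htend : Tendsto (p ∘ h₀) (𝓝[≠] x) (𝓝 (g (p x))) := by
      refine (((g.continuous.comp p.continuous).tendsto x).mono_left nhdsWithin_le_nhds).congr' ?_
      filter_upwards [hsc] with y hy
      exact (hph₀ y hy).symm
    obtain ⟨y, -, hy⟩ := exists_tendsto_of_tendsto_nhdsSet_finite
      (fun s hs => hf.exists_preconnected_punctured_nhds hD' hx hs) hsc
      (fun y hy => (hcont y hy).continuousWithinAt) hfin
      (p.continuous.isClosedMap.tendsto_nhdsSet_preimage htend)
    exact ⟨y, hy⟩
  obtain ⟨h, hh⟩ := exists_continuousMap_of_tendsto hD'.isConeSurface.finite_sing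
    (fun y hy => (hcont y hy).continuousWithinAt) hlim
  refine ⟨h, fun x => ?_, fun x hx => hh hx ▸ h₀L x hx⟩
  have hext := Continuous.ext_on (hf.dense_compl_sing hD')
    (p.continuous.comp h.continuous) (g.continuous.comp p.continuous) fun x hx => by
      change p (h x) = g (p x)
      rw [hh hx, hph₀ x hx]
  exact congrFun hext x

include hg in
/-- Isometries lift to the unfolding, with arbitrary choice of the image of a regular point. -/
lemma exists_isometry_lift (hx₀ : x₀ ∉ D'.sing) (h : g (p x₀) = p y₀) :
    ∃ h : S' ≃ₜ S', D'.IsIsometry h ∧ (∀ x, p (h x) = g (p x)) ∧ h x₀ = y₀ := by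
  have := hp.t2Space
  have := hp.connected
  have hT := hp.isTranslational
  have hD' := hp.isTranslationSurface
  have hc := hf.isPreconnected_compl_sing hD'
  have hy₀ : y₀ ∉ D'.sing := by
    rwa [← hp.map_mem_sing_iff, ← h, hg.map_sing, hp.map_mem_sing_iff]
  obtain ⟨L, hL⟩ := hp.exists_liftsAt hC hg hx₀ hy₀ h
  obtain ⟨u, hpu, hu⟩ := hp.exists_continuousMap_liftsAt hC hf hg hx₀ hy₀ hL
  obtain ⟨v, hpv, hv⟩ := hp.exists_continuousMap_liftsAt hC hf hg.symm hy₀ hx₀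
    (hp.liftsAt_symm hL)
  have hus : ∀ x, u x ∈ D'.sing ↔ x ∈ D'.sing := fun x => by
    rw [← hp.map_mem_sing_iff, hpu, hg.map_sing, hp.map_mem_sing_iff]
  have hvs : ∀ x, v x ∈ D'.sing ↔ x ∈ D'.sing := fun x => by
    rw [← hp.map_mem_sing_iff, hpv, hg.symm.map_sing, hp.map_mem_sing_iff]
  -- Both `v (u x)` and `x` are values at `u x` of local lifts of `g.symm` with linear part
  -- `L.symm`.
  have hvu : ∀ x, v (u x) = x := by
    refine congrFun (Continuous.ext_on (hf.dense_compl_sing hD')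
      (v.continuous.comp u.continuous) continuous_id fun x hx => ?_)
    have hux := (hus x).not.2 hx
    exact hp.liftsAt_unique hC hc ((hvs _).not.2 hux) hx (hv _ hux) (hp.liftsAt_symm (hu x hx))
  have huv : ∀ x, u (v x) = x := by
    refine congrFun (Continuous.ext_on (hf.dense_compl_sing hD')
      (u.continuous.comp v.continuous) continuous_id fun x hx => ?_)
    have hvx := (hvs x).not.2 hx
    exact hp.liftsAt_unique hC hc ((hus _).not.2 hvx) hx (hu _ hvx) (hp.liftsAt_symm (hv x hx))
  refine ⟨⟨⟨u, v, hvu, huv⟩, u.continuous, v.continuous⟩, ⟨hus, ?_⟩, hpu, ?_⟩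
  · intro x hx φ hφ hxφ ψ hψ hxψ
    have hux := (hus x).not.2 hx
    have hmove : ∀ᶠ s in 𝓝 (0 : ℂ), u (D'.move x s) = D'.move (u x) (L s) := by
      filter_upwards [hp.liftsAt_move hx hux (hu x hx), hT.eventually_move_notMem hx,
        L.tendsto_zero.eventually (hT.eventually_move_notMem hux)] with s h1 h2 h3
      exact hp.liftsAt_unique hC hc ((hus _).not.2 h2) h3 (hu _ h2) h1
    refine ⟨((IsometryEquiv.subRight (φ x)).trans L.toIsometryEquiv).trans
      (IsometryEquiv.addLeft (ψ (u x))), ?_⟩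
    have h1 : Tendsto (fun y => φ y - φ x) (𝓝 x) (𝓝 0) :=
      tendsto_sub_nhds_zero_iff.2 (φ.continuousAt hxφ)
    filter_upwards [hT.move_chart hφ hxφ, h1.eventually hmove,
      h1.eventually (L.tendsto_zero.eventually (hT.chart_move hψ hxψ))] with y h2 h3 h4
    rw [h2] at h3
    change ψ (u y) = ψ (u x) + L (φ y - φ x)
    rw [h3]
    exact h4.2
  · change u x₀ = y₀
    exact hp.liftsAt_unique hC hc ((hus x₀).not.2 hx₀) hy₀ (hu x₀ hx₀) hL

end IsUnfolding

end IsometryLifts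

/-! ### The unfolding of a Platonic surface is Platonic. -/

section LiftedPlatonic

variable {n : ℕ} [NeZero n] {S S' ι : Type*} [TopologicalSpace S] [TopologicalSpace S']
  {D : FlatAtlas S} {D' : FlatAtlas S'} {p : C(S', S)} {P : ι → C(regPoly n, S)}

lemma IsTiling.isRegularDecomposition {J : Type*} {f : J → C(regPoly n, S')} {a : J → ℂ}
    (hf : IsTiling D' n f a) (hD : D'.IsTranslationSurface) : D'.IsRegularDecomposition n f where
  three_le := hf.three_le
  polygon i := by
    obtain ⟨s, hs, ha⟩ := hf.norm_eq
    refine ⟨s, hs, fun z hz φ hφ hzφ => ⟨a i, φ (f i z) - a i * z, ha i, ?_⟩⟩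
    rw [hf.vertices, ← mem_polyCore_iff] at hz
    filter_upwards [(hf.dev i z hz).chart hD.isTranslational (by fun_prop) hφ hzφ] with w hw
    rw [hw.2]
    ring
  interior_disjoint := hf.interior_disjoint
  cover := hf.cover_all hD
  vertices := hf.vertices
  edge_to_edge := hf.edge_to_edge

/-- An isometry matching the flags below is lifted with a prescribed value at the centre of the
first polygon. Its composite with this polygon and the second polygon after the symmetry lift the
same map and agree at the centre, hence coincide. -/
theorem IsUnfolding.isPlatonic (hp : IsUnfolding D D' p) (hD : D.IsPlatonic n P) :
    D'.IsPlatonic n (liftedDecomposition p P) := by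
  obtain ⟨a, hf⟩ := hp.exists_isTiling hD
  have hn := hf.three_le
  refine ⟨hp.connected, hp.isTranslationSurface.isConeSurface,
    hf.isRegularDecomposition hp.isTranslationSurface, ?_⟩
  rintro ⟨F, k, v, hkv⟩ ⟨F', k', v', hkv'⟩
  obtain ⟨i, hi⟩ := F.2
  obtain ⟨j, hj⟩ := F'.2
  obtain ⟨g, hg, A, hA, hk, hv⟩ := hD.transitive ⟨i, k, v, hkv⟩ ⟨j, k', v', hkv'⟩
  let z₀ : regPoly n := ⟨0, zero_mem_regPoly hn⟩
  have hz₀ : (z₀ : ℂ) ∈ polyCore n := zero_mem_polyCore hn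
  have hFi : ∀ z, p (F.1 z) = P i z := fun z => by rw [← hi]; rfl
  have hFj : ∀ z, p (F'.1 z) = P j z := fun z => by rw [← hj]; rfl
  have hgA : ∀ z, g (P i z) = P j (polySymm hA.1 z) := fun z => hA.2 z _ rfl
  obtain ⟨h, hh, hph, hhx⟩ := hp.exists_isometry_lift hD.isConeSurface hf hg
    (x₀ := F.1 z₀) (y₀ := F'.1 (polySymm hA.1 z₀)) (hf.notMem_sing (i := F) hz₀) (by
      rw [hFi, hFj, hgA])
  refine ⟨h, hh, A, ⟨hA.1, ?_⟩, hk, hv⟩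
  have key := hp.lift_ext hD (F := (g : C(S, S)).comp (P i))
    (fun z => (hg.map_sing _).trans (hD.decomposition.vertices i z))
    (f := (h : C(S', S')).comp F.1) (g := F'.1.comp (polySymm hA.1))
    (ContinuousMap.ext fun z => (hph _).trans (congrArg g (hFi z)))
    (ContinuousMap.ext fun z => (hFj _).trans (hgA z).symm) hz₀ hhx
  intro z w hw
  have h1 : w = polySymm hA.1 z := Subtype.ext hw
  rw [h1]
  exact congrFun (congrArg DFunLike.coe key) z

end LiftedPlatonic

/-! ### The surface `Π_n` -/

section Veech

set_option linter.unusedSectionVars false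

variable {n : ℕ}

lemma veechSign_eq_or (j : Fin (veechCount n)) :
    veechSign j = 1 ∨ veechSign j = -1 := neg_one_pow_eq_or ℂ j

lemma veechSign_mul_self (j : Fin (veechCount n)) : veechSign j * veechSign j = 1 := by
  rcases veechSign_eq_or j with h | h <;> simp [h]

lemma veechSign_ne_zero (j : Fin (veechCount n)) : veechSign j ≠ 0 :=
  left_ne_zero_of_mul_eq_one (veechSign_mul_self j)

lemma norm_veechSign (j : Fin (veechCount n)) : ‖veechSign j‖ = 1 := by
  rcases veechSign_eq_or j with h | h <;> simp [h]

lemma veech_eq_of_even (h : Even n) (i j : Fin (veechCount n)) : i = j := by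
  have h1 : veechCount n = 1 := if_pos h
  exact Fin.ext (by omega)

lemma veechSign_eq_neg (h : ¬ Even n) {i j : Fin (veechCount n)} (hij : i ≠ j) :
    veechSign i = -veechSign j := by
  have h1 : veechCount n = 2 := if_neg h
  have h2 : (i : ℕ) ≠ j := fun h => hij (Fin.ext h)
  have : ((i : ℕ) = 0 ∧ (j : ℕ) = 1) ∨ ((i : ℕ) = 1 ∧ (j : ℕ) = 0) := by omega
  rcases this with ⟨h3, h4⟩ | ⟨h3, h4⟩ <;> simp [veechSign, h3, h4]

variable [NeZero n]

lemma polyRot_pow_card (k : ZMod n) : polyRot n k ^ n = 1 := by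
  rw [polyRot, ← AddChar.map_nsmul_eq_pow]
  simp

/-- The rotations are `n`-th roots of unity, while for odd `n` their negatives have `n`-th power
`-1`. -/
lemma polyNormal_ne_neg (h : ¬ Even n) (k l : ZMod n) : polyNormal n k ≠ -polyNormal n l := by
  intro he
  have h1 : polyRot n k = -polyRot n l :=
    mul_left_cancel₀ (neg_ne_zero.2 Complex.I_ne_zero) (by rw [← polyNormal, he, polyNormal]; ring)
  have h2 := polyRot_pow_card k
  rw [h1, (Nat.not_even_iff_odd.1 h).neg_pow, polyRot_pow_card] at h2
  norm_num at h2

/-- Each outward normal occurs only once among all sides of the polygons of `Π_n`, so a side has at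
most one partner. -/
lemma veechSign_mul_normal_inj {i j : Fin (veechCount n)} {k l : ZMod n}
    (h : veechSign i * polyNormal n k = veechSign j * polyNormal n l) : i = j ∧ k = l := by
  by_cases hij : i = j
  · subst hij
    exact ⟨rfl, polyNormal_injective (mul_left_cancel₀ (veechSign_ne_zero i) h)⟩
  · have hn : ¬ Even n := fun hn => hij (veech_eq_of_even hn i j)
    rw [veechSign_eq_neg hn hij, neg_mul, ← mul_neg] at h
    have h1 := mul_left_cancel₀ (veechSign_ne_zero j) h
    exact absurd (by rw [← h1, neg_neg]) (polyNormal_ne_neg hn k l)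

/-- The partner is the side `n / 2` steps further for even `n`, and the side with the same index of
the other polygon for odd `n`. -/
lemma exists_veechSign_mul_normal_eq_neg (i : Fin (veechCount n)) (k : ZMod n) :
    ∃ (j : Fin (veechCount n)) (l : ZMod n),
      veechSign j * polyNormal n l = -(veechSign i * polyNormal n k) := by
  by_cases hn : Even n
  · obtain ⟨m, hm⟩ := hn
    refine ⟨i, k + ((m : ℤ) : ZMod n), ?_⟩
    have h1 : (2 * Real.pi * (m : ℤ) / n : ℝ) = Real.pi := by
      have : (m : ℝ) ≠ 0 := by
        have := NeZero.ne n
        exact_mod_cast (by omega : m ≠ 0)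
      rw [hm]; push_cast; field_simp; norm_num
    rw [polyNormal_add, polyRot_intCast, h1, Complex.exp_pi_mul_I]
    ring
  · have h1 : veechCount n = 2 := if_neg hn
    obtain ⟨j, hj⟩ : ∃ j : Fin (veechCount n), j ≠ i := by
      have : Nontrivial (Fin (veechCount n)) := Fin.nontrivial_iff_two_le.2 h1.ge
      exact exists_ne i
    exact ⟨j, k, by rw [veechSign_eq_neg hn hj]; ring⟩

/-- With unit normals and positions relative to midpoints, the gluing takes the same form as
adjacency in `IsTiling.glued_of_eq`. -/
lemma veechGlue_iff (hn : 3 ≤ n) (x y : Fin (veechCount n) × regPoly n) : veechGlue n x y ↔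
    ∃ k l : ZMod n, (x.2 : ℂ) ∈ polySide n k ∧ (y.2 : ℂ) ∈ polySide n l ∧
      veechSign y.1 * polyNormal n l = -(veechSign x.1 * polyNormal n k) ∧
      veechSign y.1 * (y.2 - polyMid n l) = veechSign x.1 * (x.2 - polyMid n k) := by
  have hc : (Real.cos (polyAngle n) : ℂ) ≠ 0 := Complex.ofReal_ne_zero.2 (cos_polyAngle_pos hn).ne'
  refine exists_congr fun k => exists_congr fun l => and_congr_right fun _ =>
    and_congr_right fun _ => and_congr ?_ ?_
  · rw [polyMid_eq, polyMid_eq, ← mul_assoc, ← mul_assoc, ← neg_mul]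
    exact ⟨fun h => mul_right_cancel₀ hc h, fun h => by rw [h]⟩
  · constructor <;> intro h <;> linear_combination h

lemma veechGlue.symm (hn : 3 ≤ n) {x y : Fin (veechCount n) × regPoly n} (h : veechGlue n x y) :
    veechGlue n y x := by
  rw [veechGlue_iff hn] at h ⊢
  obtain ⟨k, l, hk, hl, h1, h2⟩ := h
  exact ⟨l, k, hl, hk, by rw [h1, neg_neg], h2.symm⟩

lemma norm_sq_of_mem_polySide {z : ℂ} {k : ZMod n} (hz : z ∈ polySide n k) :
    ‖z‖ ^ 2 = Real.cos (polyAngle n) ^ 2 + ‖z - polyMid n k‖ ^ 2 := by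
  rw [polySide, segment_eq_image_lineMap] at hz
  obtain ⟨t, -, rfl⟩ := hz
  rw [lineMap_sub_polyMid, polySide_param, norm_mul, norm_mul, norm_polyNormal, one_mul, one_mul,
    norm_mul, Complex.norm_I, mul_one, Complex.norm_real, Real.norm_eq_abs, sq_abs,
    ← Complex.normSq_eq_norm_sq, Complex.normSq_apply]
  ring

/-- Gluing preserves the distance to the midpoint of the side, hence by Pythagoras the distance to
the centre. In particular vertices are glued only to vertices. -/
lemma veechGlue.norm_eq (hn : 3 ≤ n) {x y : Fin (veechCount n) × regPoly n}
    (h : veechGlue n x y) : ‖(x.2 : ℂ)‖ = ‖(y.2 : ℂ)‖ := by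
  rw [veechGlue_iff hn] at h
  obtain ⟨k, l, hk, hl, -, h2⟩ := h
  have h3 := congrArg norm h2
  rw [norm_mul, norm_mul, norm_veechSign, norm_veechSign, one_mul, one_mul] at h3
  have h4 := norm_sq_of_mem_polySide hk
  rw [← h3, ← norm_sq_of_mem_polySide hl] at h4
  exact (sq_eq_sq₀ (norm_nonneg _) (norm_nonneg _)).1 h4

lemma veechGlue.mem_range_iff (hn : 3 ≤ n) {x y : Fin (veechCount n) × regPoly n}
    (h : veechGlue n x y) :
    (x.2 : ℂ) ∈ range (polyVertex n) ↔ (y.2 : ℂ) ∈ range (polyVertex n) := by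
  rw [mem_range_polyVertex_iff x.2.2, mem_range_polyVertex_iff y.2.2, h.norm_eq hn]

/-- A point that is not a vertex lies on at most one side, which has only one partner, so gluing
twice leads back. -/
lemma veechGlue.eq_of_trans (hn : 3 ≤ n) {x y z : Fin (veechCount n) × regPoly n}
    (h : veechGlue n x y) (h' : veechGlue n y z) (hy : (y.2 : ℂ) ∉ range (polyVertex n)) :
    x = z := by
  rw [veechGlue_iff hn] at h h'
  obtain ⟨k, l, hk, hl, h1, h2⟩ := h
  obtain ⟨l', m, hl', hm, h3, h4⟩ := h'
  obtain rfl := polySide_unique hn hy hl hl'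
  rw [h1, neg_neg] at h3
  obtain ⟨h5, rfl⟩ := veechSign_mul_normal_inj h3
  rw [h2, h5] at h4
  have h6 := mul_left_cancel₀ (veechSign_ne_zero _) h4
  exact Prod.ext h5.symm (Subtype.ext (sub_left_injective h6.symm))

/-- Two points of the polygons are identified in `Π_n` only if they are equal, glued, or vertices. -/
lemma veech_eq_or (hn : 3 ≤ n) {x y : Fin (veechCount n) × regPoly n}
    (h : Quot.mk (veechGlue n) x = Quot.mk (veechGlue n) y) : x = y ∨ veechGlue n x y ∨
      ((x.2 : ℂ) ∈ range (polyVertex n) ∧ (y.2 : ℂ) ∈ range (polyVertex n)) := by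
  have h' := Quot.eqvGen_exact h
  clear h
  induction h' with
  | rel x y h => exact Or.inr (Or.inl h)
  | refl x => exact Or.inl rfl
  | symm x y _ ih =>
    rcases ih with rfl | ih | ih
    · exact Or.inl rfl
    · exact Or.inr (Or.inl (ih.symm hn))
    · exact Or.inr (Or.inr ih.symm)
  | trans x y z _ _ ih1 ih2 =>
    rcases ih1 with rfl | ih1 | ih1
    · exact ih2
    · rcases ih2 with rfl | ih2 | ih2
      · exact Or.inr (Or.inl ih1)
      · by_cases hy : (y.2 : ℂ) ∈ range (polyVertex n)
        · exact Or.inr (Or.inr ⟨(ih1.mem_range_iff hn).2 hy, (ih2.mem_range_iff hn).1 hy⟩)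
        · exact Or.inl (ih1.eq_of_trans hn ih2 hy)
      · exact Or.inr (Or.inr ⟨(ih1.mem_range_iff hn).2 ih2.1, ih2.2⟩)
    · rcases ih2 with rfl | ih2 | ih2
      · exact Or.inr (Or.inr ih1)
      · exact Or.inr (Or.inr ⟨ih1.1, (ih2.mem_range_iff hn).1 ih1.2⟩)
      · exact Or.inr (Or.inr ⟨ih1.1, ih2.2⟩)

lemma veech_mem_range_iff (hn : 3 ≤ n) {i j : Fin (veechCount n)} {z w : regPoly n}
    (h : veechPoly n i z = veechPoly n j w) :
    (z : ℂ) ∈ range (polyVertex n) ↔ (w : ℂ) ∈ range (polyVertex n) := by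
  rcases veech_eq_or hn h with h | h | h
  · rw [show z = w from congrArg Prod.snd h]
  · exact h.mem_range_iff hn
  · exact iff_of_true h.1 h.2

lemma veechPoly_mem_sing_iff (hn : 3 ≤ n) (i : Fin (veechCount n)) (z : regPoly n) :
    veechPoly n i z ∈ (veechAtlas n).sing ↔ (z : ℂ) ∈ range (polyVertex n) := by
  constructor
  · rintro ⟨j, w, hw, h⟩
    exact (veech_mem_range_iff hn h).1 hw
  · exact fun h => ⟨i, z, h, rfl⟩

lemma finite_veech_sing : (veechAtlas n).sing.Finite := by
  have : (⋃ j, veechPoly n j '' {z : regPoly n | (z : ℂ) ∈ range (polyVertex n)}).Finite :=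
    finite_iUnion fun j => finite_vertices.image _
  refine this.subset ?_
  rintro x ⟨j, z, hz, rfl⟩
  exact mem_iUnion.2 ⟨j, mem_image_of_mem _ hz⟩

lemma exists_veechPoly_eq (x : VeechSurface n) : ∃ j z, veechPoly n j z = x := by
  obtain ⟨⟨j, z⟩, rfl⟩ := Quot.exists_rep x
  exact ⟨j, z, rfl⟩

lemma isClosed_polySide (k : ZMod n) : IsClosed (polySide n k) := by
  rw [polySide, segment_eq_image_lineMap]
  exact (isCompact_Icc.image AffineMap.lineMap_continuous).isClosed

/-- By `veech_eq_or` the identification is the union of the diagonal, the closed gluing relation and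
a finite set of pairs of vertices. -/
lemma t2Space_veechSurface (hn : 3 ≤ n) : T2Space (VeechSurface n) := by
  refine isQuotientMap_quot_mk.t2Space_of_isClosed
    (X := Fin (veechCount n) × regPoly n) (f := Quot.mk (veechGlue n)) ?_
  set V : Set (Fin (veechCount n) × regPoly n) := {x | (x.2 : ℂ) ∈ range (polyVertex n)} with hV
  have hVf : V.Finite := by
    refine (Set.finite_univ.prod (finite_vertices (n := n))).subset fun x hx => ⟨mem_univ _, hx⟩
  have heq : {a : (Fin (veechCount n) × regPoly n) × (Fin (veechCount n) × regPoly n) |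
      Quot.mk (veechGlue n) a.1 = Quot.mk (veechGlue n) a.2} =
      diagonal _ ∪ {a | veechGlue n a.1 a.2} ∪
      ((V ×ˢ V) ∩ {a | Quot.mk (veechGlue n) a.1 = Quot.mk (veechGlue n) a.2}) := by
    ext ⟨x, y⟩
    constructor
    · intro h
      rcases veech_eq_or hn h with h1 | h1 | h1
      · exact Or.inl (Or.inl h1)
      · exact Or.inl (Or.inr h1)
      · exact Or.inr ⟨h1, h⟩
    · rintro ((h | h) | h)
      · exact congrArg _ h
      · exact Quot.sound h
      · exact h.2
  rw [heq]
  refine (isClosed_diagonal.union ?_).union ((hVf.prod hVf).subset inter_subset_left).isClosed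
  have hs : Continuous fun j : Fin (veechCount n) => veechSign j := continuous_of_discreteTopology
  have : {a : (Fin (veechCount n) × regPoly n) × (Fin (veechCount n) × regPoly n) |
      veechGlue n a.1 a.2} = ⋃ k : ZMod n, ⋃ l : ZMod n,
      {a | (a.1.2 : ℂ) ∈ polySide n k} ∩ ({a | (a.2.2 : ℂ) ∈ polySide n l} ∩
      ({a | veechSign a.2.1 * polyMid n l = -(veechSign a.1.1 * polyMid n k)} ∩
      {a | veechSign a.2.1 * (a.2.2 : ℂ) - veechSign a.1.1 * (a.1.2 : ℂ) =
        veechSign a.2.1 * polyMid n l - veechSign a.1.1 * polyMid n k})) := by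
    ext a
    simp only [mem_iUnion]
    rfl
  rw [this]
  have hs1 : Continuous fun a : (Fin (veechCount n) × regPoly n) × (Fin (veechCount n) × regPoly n) =>
    veechSign a.1.1 := hs.comp (by fun_prop)
  have hs2 : Continuous fun a : (Fin (veechCount n) × regPoly n) × (Fin (veechCount n) × regPoly n) =>
    veechSign a.2.1 := hs.comp (by fun_prop)
  refine isClosed_iUnion_of_finite fun k => isClosed_iUnion_of_finite fun l => ?_
  refine ((isClosed_polySide k).preimage (by fun_prop)).inter
    (((isClosed_polySide l).preimage (by fun_prop)).inter
      ((isClosed_eq ?_ ?_).inter (isClosed_eq ?_ ?_)))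
  all_goals fun_prop

end Veech

/-! ### Charts of `Π_n` around regular points. -/

section VeechCharts

variable {n : ℕ} [NeZero n]

/-- A chart of `Π_n` assembled from (at most) two pieces of polygons around the points `z` and `w`
that are identified in `Π_n`. -/
lemma exists_veechChart_of_pieces {j j' : Fin (veechCount n)} {z w : regPoly n} {r : ℝ} (hr : 0 < r)
    (hcov : ∀ t ∈ Metric.ball (0 : ℂ) r,
      (z : ℂ) + veechSign j * t ∈ regPoly n ∨ (w : ℂ) + veechSign j' * t ∈ regPoly n)
    (heq : ∀ t ∈ Metric.ball (0 : ℂ) r, ∀ (h : (z : ℂ) + veechSign j * t ∈ regPoly n)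
      (h' : (w : ℂ) + veechSign j' * t ∈ regPoly n), veechPoly n j ⟨_, h⟩ = veechPoly n j' ⟨_, h'⟩)
    (hfib : ∀ t ∈ Metric.ball (0 : ℂ) r, ∀ (h : (z : ℂ) + veechSign j * t ∈ regPoly n) i x,
      veechPoly n i x = veechPoly n j ⟨_, h⟩ → (i = j ∧ (x : ℂ) = z + veechSign j * t) ∨
        (i = j' ∧ (x : ℂ) = w + veechSign j' * t))
    (hfib' : ∀ t ∈ Metric.ball (0 : ℂ) r, ∀ (h : (w : ℂ) + veechSign j' * t ∈ regPoly n) i x,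
      veechPoly n i x = veechPoly n j' ⟨_, h⟩ → (i = j ∧ (x : ℂ) = z + veechSign j * t) ∨
        (i = j' ∧ (x : ℂ) = w + veechSign j' * t))
    (hv : ∀ t ∈ Metric.ball (0 : ℂ) r, (z : ℂ) + veechSign j * t ∉ range (polyVertex n) ∧
      (w : ℂ) + veechSign j' * t ∉ range (polyVertex n))
    (hsep : ∀ t ∈ Metric.ball (0 : ℂ) r, ∀ t' ∈ Metric.ball (0 : ℂ) r, j = j' →
      (z : ℂ) + veechSign j * t = w + veechSign j' * t' → t = t') :
    ∃ φ ∈ (veechAtlas n).charts, veechPoly n j z ∈ φ.source := by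
  classical
  -- `e` is the inverse of the chart: the displacement `t` is read in the piece at `z` or, where
  -- this leaves the polygon, in the piece at `w`. Since `veechSign` squares to one, it converts
  -- displacements both ways.
  set e : ℂ → VeechSurface n := fun t =>
    if h : (z : ℂ) + veechSign j * t ∈ regPoly n then veechPoly n j ⟨_, h⟩ else
    if h' : (w : ℂ) + veechSign j' * t ∈ regPoly n then veechPoly n j' ⟨_, h'⟩ else
    veechPoly n j z with he
  have heA : ∀ t, ∀ h : (z : ℂ) + veechSign j * t ∈ regPoly n, e t = veechPoly n j ⟨_, h⟩ :=
    fun t h => dif_pos h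
  have heB : ∀ t ∈ Metric.ball (0 : ℂ) r, ∀ h : (w : ℂ) + veechSign j' * t ∈ regPoly n,
      e t = veechPoly n j' ⟨_, h⟩ := by
    intro t ht h'
    by_cases h : (z : ℂ) + veechSign j * t ∈ regPoly n
    · rw [heA t h, heq t ht h h']
    · rw [he]; simp only [dif_neg h, dif_pos h']
  have hefib : ∀ t ∈ Metric.ball (0 : ℂ) r, ∀ i x, veechPoly n i x = e t →
      (i = j ∧ (x : ℂ) = z + veechSign j * t) ∨ (i = j' ∧ (x : ℂ) = w + veechSign j' * t) := by
    intro t ht i x hx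
    rcases hcov t ht with h | h
    · exact hfib t ht h i x (by rw [hx, heA t h])
    · exact hfib' t ht h i x (by rw [hx, heB t ht h])
  have hsolve : ∀ (j : Fin (veechCount n)) (z x : ℂ), z + veechSign j * (veechSign j * (x - z)) = x :=
    fun j z x => by rw [← mul_assoc, veechSign_mul_self]; ring
  have hsolve' : ∀ (j : Fin (veechCount n)) (z t : ℂ), veechSign j * (z + veechSign j * t - z) = t :=
    fun j z t => by rw [add_sub_cancel_left, ← mul_assoc, veechSign_mul_self, one_mul]
  have heA' : ∀ x : regPoly n, e (veechSign j * (x - z)) = veechPoly n j x := by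
    intro x
    rw [heA _ (by rw [hsolve]; exact x.2)]
    congr 1
    exact Subtype.ext (hsolve _ _ _)
  have heB' : ∀ x : regPoly n, veechSign j' * (x - w) ∈ Metric.ball (0 : ℂ) r →
      e (veechSign j' * (x - w)) = veechPoly n j' x := by
    intro x hx
    rw [heB _ hx (by rw [hsolve]; exact x.2)]
    congr 1
    exact Subtype.ext (hsolve _ _ _)
  have hmem : ∀ V ⊆ Metric.ball (0 : ℂ) r, ∀ i (x : regPoly n), veechPoly n i x ∈ e '' V ↔
      (i = j ∧ veechSign j * ((x : ℂ) - z) ∈ V) ∨ (i = j' ∧ veechSign j' * ((x : ℂ) - w) ∈ V) := by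
    intro V hV i x
    constructor
    · rintro ⟨t, ht, hx⟩
      rcases hefib t (hV ht) i x hx.symm with ⟨h1, h2⟩ | ⟨h1, h2⟩
      · exact Or.inl ⟨h1, by rwa [h2, hsolve']⟩
      · exact Or.inr ⟨h1, by rwa [h2, hsolve']⟩
    · rintro (⟨rfl, h⟩ | ⟨rfl, h⟩)
      · exact ⟨_, h, heA' x⟩
      · exact ⟨_, h, heB' x (hV h)⟩
  have hinj : InjOn e (Metric.ball (0 : ℂ) r) := by
    intro t ht t' ht' h
    have hcancel : ∀ (i : Fin (veechCount n)) (z : ℂ), z + veechSign i * t' = z + veechSign i * t →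
        t = t' := fun i z h => (mul_left_cancel₀ (veechSign_ne_zero i) (add_left_cancel h)).symm
    rcases hcov t' ht' with h1 | h1
    · rcases hefib t ht j ⟨_, h1⟩ (by rw [h, heA t' h1]) with ⟨-, h2⟩ | ⟨h2, h3⟩
      · exact hcancel _ _ h2
      · exact (hsep t' ht' t ht h2 h3).symm
    · rcases hefib t ht j' ⟨_, h1⟩ (by rw [h, heB t' ht' h1]) with ⟨h2, h3⟩ | ⟨-, h2⟩
      · exact hsep t ht t' ht' h2.symm h3.symm
      · exact hcancel _ _ h2
  have hclosed : ∀ (i : Fin (veechCount n)) (z : ℂ),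
      IsClosed {t : ℂ | z + veechSign i * t ∈ regPoly n} := fun i z =>
    isCompact_regPoly.isClosed.preimage (by fun_prop)
  have hpiece : ∀ (i : Fin (veechCount n)) (z : ℂ) (B : Set ℂ),
      (∀ t ∈ B, ∀ h : z + veechSign i * t ∈ regPoly n, e t = veechPoly n i ⟨_, h⟩) →
      ContinuousOn e (B ∩ {t : ℂ | z + veechSign i * t ∈ regPoly n}) := by
    intro i z B hB
    rw [continuousOn_iff_continuous_domRestrict]
    have : (B ∩ {t : ℂ | z + veechSign i * t ∈ regPoly n}).domRestrict e =
        fun t : ↥(B ∩ {t : ℂ | z + veechSign i * t ∈ regPoly n}) =>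
          veechPoly n i ⟨z + veechSign i * (t : ℂ), t.2.2⟩ :=
      funext fun t => hB t t.2.1 t.2.2
    rw [this]
    exact (veechPoly n i).continuous.comp (by fun_prop)
  have hcont : ContinuousOn e (Metric.ball (0 : ℂ) r) := by
    intro t ht
    have hsub : Metric.ball (0 : ℂ) r ⊆
        (Metric.ball (0 : ℂ) r ∩ {t : ℂ | (z : ℂ) + veechSign j * t ∈ regPoly n}) ∪
        (Metric.ball (0 : ℂ) r ∩ {t : ℂ | (w : ℂ) + veechSign j' * t ∈ regPoly n}) := by
      intro t ht
      rcases hcov t ht with h | h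
      · exact Or.inl ⟨ht, h⟩
      · exact Or.inr ⟨ht, h⟩
    refine ContinuousWithinAt.mono (ContinuousWithinAt.union ?_ ?_) hsub
    · by_cases h : (z : ℂ) + veechSign j * t ∈ regPoly n
      · exact hpiece j z _ (fun t _ h => heA t h) t ⟨ht, h⟩
      · refine continuousWithinAt_of_notMem_closure fun hc => h ?_
        exact (hclosed j z).closure_subset_iff.2 inter_subset_right hc
    · by_cases h : (w : ℂ) + veechSign j' * t ∈ regPoly n
      · exact hpiece j' w _ heB t ⟨ht, h⟩
      · refine continuousWithinAt_of_notMem_closure fun hc => h ?_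
        exact (hclosed j' w).closure_subset_iff.2 inter_subset_right hc
  have hopen : IsOpenMap ((Metric.ball (0 : ℂ) r).domRestrict e) := by
    intro U hU
    have hV : IsOpen (Subtype.val '' U) := Metric.isOpen_ball.isOpenMap_subtype_val U hU
    have hVr : Subtype.val '' U ⊆ Metric.ball (0 : ℂ) r := by rintro _ ⟨t, -, rfl⟩; exact t.2
    have himg : (Metric.ball (0 : ℂ) r).domRestrict e '' U = e '' (Subtype.val '' U) := by
      rw [image_image]; rfl
    rw [himg, ← isQuotientMap_quot_mk.isOpen_preimage]
    have hpre : Quot.mk (veechGlue n) ⁻¹' (e '' (Subtype.val '' U)) =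
        ({a | a.1 = j} ∩ {a | veechSign j * ((a.2 : ℂ) - z) ∈ Subtype.val '' U}) ∪
        ({a | a.1 = j'} ∩ {a | veechSign j' * ((a.2 : ℂ) - w) ∈ Subtype.val '' U}) := by
      ext ⟨i, x⟩
      exact hmem _ hVr i x
    rw [hpre]
    refine IsOpen.union (IsOpen.inter ?_ ?_) (IsOpen.inter ?_ ?_)
    · exact (isOpen_discrete {j}).preimage continuous_fst
    · exact hV.preimage (by fun_prop)
    · exact (isOpen_discrete {j'}).preimage continuous_fst
    · exact hV.preimage (by fun_prop)
  let E := OpenPartialHomeomorph.ofContinuousOpenRestrict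
    (BijOn.toPartialEquiv e _ _ hinj.bijOn_image) hcont hopen Metric.isOpen_ball
  have hEsrc : E.symm.source = e '' Metric.ball (0 : ℂ) r := rfl
  have hEe : ∀ t ∈ Metric.ball (0 : ℂ) r, E.symm (e t) = t := fun t ht => E.left_inv ht
  refine ⟨E.symm, ⟨?_, ?_⟩, ?_⟩
  · intro i x hx hxs
    rw [hEsrc, hmem _ Subset.rfl] at hxs
    rcases hxs with ⟨rfl, h⟩ | ⟨rfl, h⟩
    · exact (hv _ h).1 (by rwa [hsolve])
    · exact (hv _ h).2 (by rwa [hsolve])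
  · intro i x hxs
    rw [hEsrc, hmem _ Subset.rfl] at hxs
    rcases hxs with ⟨rfl, h⟩ | ⟨rfl, h⟩
    · refine ⟨-(veechSign i * z), ?_⟩
      have hc : Continuous fun x : regPoly n => veechSign i * ((x : ℂ) - z) := by fun_prop
      filter_upwards [hc.continuousAt.preimage_mem_nhds (Metric.isOpen_ball.mem_nhds h)] with x hx
      rw [← heA' x, hEe _ hx]
      ring
    · refine ⟨-(veechSign i * w), ?_⟩
      have hc : Continuous fun x : regPoly n => veechSign i * ((x : ℂ) - w) := by fun_prop
      filter_upwards [hc.continuousAt.preimage_mem_nhds (Metric.isOpen_ball.mem_nhds h)] with x hx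
      rw [← heB' x hx, hEe _ hx]
      ring
  · rw [hEsrc, hmem _ Subset.rfl]
    exact Or.inl ⟨rfl, by simpa using hr⟩

/-- A boundary point of the piece lies on side `k`, so its only partner is its translate on side
`l`. -/
lemma veech_fiber_near (hn : 3 ≤ n) {j j' : Fin (veechCount n)} {z w : ℂ} {k l : ZMod n}
    (hnormal : veechSign j' * polyNormal n l = -(veechSign j * polyNormal n k))
    (hpos : veechSign j' * (w - polyMid n l) = veechSign j * (z - polyMid n k))
    {t : ℂ} (hu : z + veechSign j * t ∈ regPoly n)
    (huv : z + veechSign j * t ∉ range (polyVertex n))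
    (hside : z + veechSign j * t ∉ interior (regPoly n) → z + veechSign j * t ∈ polySide n k)
    {i : Fin (veechCount n)} {x : regPoly n} (h : veechPoly n i x = veechPoly n j ⟨_, hu⟩) :
    (i = j ∧ (x : ℂ) = z + veechSign j * t) ∨ (i = j' ∧ (x : ℂ) = w + veechSign j' * t) := by
  rcases veech_eq_or hn h with h | h | h
  · obtain ⟨rfl, rfl⟩ := Prod.mk.inj h
    exact Or.inl ⟨rfl, rfl⟩
  · right
    rw [veechGlue_iff hn] at h
    obtain ⟨k', l', hk', hl', h1, h2⟩ := h
    obtain rfl := polySide_unique hn huv hl' (hside (notMem_interior_of_mem_polySide hn hl'))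
    dsimp only at h1 h2
    rw [h1, neg_neg] at hnormal
    obtain ⟨rfl, rfl⟩ := veechSign_mul_normal_inj hnormal
    refine ⟨rfl, ?_⟩
    have h3 := veechSign_mul_self j
    refine mul_left_cancel₀ (veechSign_ne_zero j') ?_
    linear_combination -h2 - hpos + t * h3 - t * veechSign_mul_self j'
  · exact absurd h.2 huv

/-- `Π_n` has charts around all points that are not vertices. -/
lemma exists_veechChart (hn : 3 ≤ n) (j : Fin (veechCount n)) {z : regPoly n}
    (hz : (z : ℂ) ∈ polyCore n) : ∃ φ ∈ (veechAtlas n).charts, veechPoly n j z ∈ φ.source := by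
  have hvopen : IsOpen (range (polyVertex n))ᶜ := (finite_range _).isClosed.isOpen_compl
  have hlim : ∀ (i : Fin (veechCount n)) (z : ℂ),
      Tendsto (fun t => z + veechSign i * t) (𝓝 0) (𝓝 z) := fun i z => by
    have : Continuous fun t : ℂ => z + veechSign i * t := by fun_prop
    simpa using this.tendsto 0
  have hlim' : ∀ i : Fin (veechCount n), Tendsto (fun t => veechSign i * t) (𝓝 0) (𝓝 0) :=
    fun i => by simpa using hlim i 0
  have hzv := (mem_polyCore_iff z).1 hz
  -- At an interior point one piece suffices and plays both roles.
  by_cases hzi : (z : ℂ) ∈ interior (regPoly n)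
  · obtain ⟨r, hr, hb⟩ := Metric.eventually_nhds_iff_ball.1
      (((hlim j z).eventually (isOpen_interior.mem_nhds hzi)).and
        ((hlim j z).eventually (hvopen.mem_nhds hzv)))
    have hfib : ∀ t ∈ Metric.ball (0 : ℂ) r, ∀ (h : (z : ℂ) + veechSign j * t ∈ regPoly n) i x,
        veechPoly n i x = veechPoly n j ⟨_, h⟩ → (i = j ∧ (x : ℂ) = z + veechSign j * t) ∨
        (i = j ∧ (x : ℂ) = z + veechSign j * t) := by
      intro t ht h i x hx
      rcases veech_eq_or hn hx with h1 | h1 | h1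
      · obtain ⟨rfl, rfl⟩ := Prod.mk.inj h1
        exact Or.inl ⟨rfl, rfl⟩
      · obtain ⟨k, l, -, hl, -⟩ := h1
        exact absurd (hb t ht).1 (notMem_interior_of_mem_polySide hn hl)
      · exact absurd h1.2 (hb t ht).2
    exact exists_veechChart_of_pieces hr (fun t ht => Or.inl (interior_subset (hb t ht).1))
      (fun _ _ _ _ => rfl) hfib hfib (fun t ht => ⟨(hb t ht).2, (hb t ht).2⟩)
      fun t _ t' _ _ h => mul_left_cancel₀ (veechSign_ne_zero j) (add_left_cancel h)
  obtain ⟨k, hk⟩ := exists_mem_polySide hn z.2 hzi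
  obtain ⟨j', l, hnormal⟩ := exists_veechSign_mul_normal_eq_neg j k
  obtain ⟨w, hwl, hpos⟩ : ∃ w ∈ polySide n l,
      veechSign j' * (w - polyMid n l) = veechSign j * (z - polyMid n k) := by
    have hk' := hk
    rw [polySide, segment_eq_image_lineMap] at hk'
    obtain ⟨t, ht, hzt⟩ := hk'
    refine ⟨AffineMap.lineMap (polyVertex n (l + 1)) (polyVertex n l) t, ?_, ?_⟩
    · rw [polySide, segment_symm, segment_eq_image_lineMap]
      exact mem_image_of_mem _ ht
    · rw [lineMap_reverse_sub_polyMid, ← hzt, lineMap_sub_polyMid, mul_neg, ← mul_assoc, hnormal]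
      ring
  have hwv : w ∉ range (polyVertex n) := by
    have hg : veechGlue n (j, z) (j', ⟨w, polySide_subset l hwl⟩) :=
      (veechGlue_iff hn _ _).2 ⟨k, l, hk, hwl, hnormal, hpos⟩
    exact (hg.mem_range_iff hn).not.1 hzv
  -- Sides `k` and `l` have opposite normals, so the two pieces are complementary half discs that
  -- meet along the glued side.
  have hheight : ∀ t, polyHeight n l (veechSign j' * t) = -polyHeight n k (veechSign j * t) := by
    intro t
    have h1 : ∀ i : Fin (veechCount n), (starRingEnd ℂ) (veechSign i) = veechSign i := fun i => by
      rcases veechSign_eq_or i with h | h <;> simp [h]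
    have h2 := congrArg (starRingEnd ℂ) hnormal
    rw [map_mul, map_neg, map_mul, h1, h1] at h2
    rw [polyHeight_apply, polyHeight_apply, ← Complex.neg_re]
    congr 1
    linear_combination t * h2
  have hpos' : veechSign j * (z - polyMid n k) = veechSign j' * (w - polyMid n l) := hpos.symm
  -- Two pieces in the same polygon must not overlap there. They stay within half the distance from
  -- `z` to `w`, which differ because no side is its own partner.
  obtain ⟨δ, hδ, hδw⟩ : ∃ δ : ℝ, 0 < δ ∧ (j = j' → 2 * δ ≤ ‖(z : ℂ) - w‖) := by
    by_cases hjj : j = j'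
    · subst hjj
      refine ⟨‖(z : ℂ) - w‖ / 2, half_pos (norm_pos_iff.2 fun h0 => ?_), fun _ => by linarith⟩
      have hzw : (z : ℂ) = w := sub_eq_zero.1 h0
      rw [← hzw] at hwl
      obtain rfl := polySide_unique hn hzv hk hwl
      have h1 := self_eq_neg.1 hnormal
      exact mul_ne_zero (veechSign_ne_zero j) (polyNormal_ne_zero k) h1
    · exact ⟨1, one_pos, fun h => absurd h hjj⟩
  obtain ⟨r₀, hr₀, hb⟩ := Metric.eventually_nhds_iff_ball.1
    ((((hlim' j).eventually (eventually_mem_interior_iff hn hk hzv)).and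
      ((hlim' j').eventually (eventually_mem_interior_iff hn hwl hwv))).and
      (((hlim j z).eventually (hvopen.mem_nhds hzv)).and
        ((hlim j' w).eventually (hvopen.mem_nhds hwv))))
  have hb' : ∀ t ∈ Metric.ball (0 : ℂ) (min r₀ δ), t ∈ Metric.ball (0 : ℂ) r₀ := fun t ht =>
    Metric.ball_subset_ball (min_le_left _ _) ht
  have hsideA : ∀ t ∈ Metric.ball (0 : ℂ) (min r₀ δ), (z : ℂ) + veechSign j * t ∈ regPoly n →
      (z : ℂ) + veechSign j * t ∉ interior (regPoly n) →
      (z : ℂ) + veechSign j * t ∈ polySide n k := by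
    intro t ht h h'
    rw [(hb t (hb' t ht)).1.1.1, not_lt] at h'
    have h'' := (hb t (hb' t ht)).1.1.2.1 h
    rw [mem_polySide_iff hn h, map_add, polyHeight_of_mem_polySide hk, le_antisymm h'' h', add_zero]
  have hsideB : ∀ t ∈ Metric.ball (0 : ℂ) (min r₀ δ), w + veechSign j' * t ∈ regPoly n →
      w + veechSign j' * t ∉ interior (regPoly n) → w + veechSign j' * t ∈ polySide n l := by
    intro t ht h h'
    rw [(hb t (hb' t ht)).1.2.1, not_lt] at h'
    have h'' := (hb t (hb' t ht)).1.2.2.1 h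
    rw [mem_polySide_iff hn h, map_add, polyHeight_of_mem_polySide hwl, le_antisymm h'' h', add_zero]
  refine exists_veechChart_of_pieces (j' := j') (w := ⟨w, polySide_subset l hwl⟩)
    (lt_min hr₀ hδ) (fun t ht => ?_) (fun t ht h h' => ?_)
    (fun t ht h i x hx => veech_fiber_near hn hnormal hpos h (hb t (hb' t ht)).2.1
      (hsideA t ht h) hx)
    (fun t ht h i x hx => (veech_fiber_near hn (by rw [hnormal, neg_neg]) hpos' h
      (hb t (hb' t ht)).2.2 (hsideB t ht h) hx).symm)
    (fun t ht => (hb t (hb' t ht)).2) fun t ht t' ht' hjj h => ?_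
  · have h1 := (hb t (hb' t ht)).1.1.2
    have h2 := (hb t (hb' t ht)).1.2.2
    rw [hheight] at h2
    rcases le_total (polyHeight n k (veechSign j * t)) 0 with h | h
    · exact Or.inl (h1.2 h)
    · exact Or.inr (h2.2 (by linarith))
  · have h1 := (hb t (hb' t ht)).1.1.2.1 h
    have h2 := (hb t (hb' t ht)).1.2.2.1 h'
    rw [hheight] at h2
    have h3 : polyHeight n k (veechSign j * t) = 0 := by linarith
    refine Quot.sound ((veechGlue_iff hn _ _).2 ⟨k, l, ?_, ?_, hnormal, ?_⟩)
    · rw [mem_polySide_iff hn h, map_add, polyHeight_of_mem_polySide hk, h3, add_zero]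
    · rw [mem_polySide_iff hn h', map_add, polyHeight_of_mem_polySide hwl, hheight, h3, neg_zero,
        add_zero]
    · dsimp only
      linear_combination hpos + t * veechSign_mul_self j' - t * veechSign_mul_self j
  · exfalso
    have h1 := hδw hjj
    rw [← hjj] at h
    have h2 : (z : ℂ) - w = veechSign j * (t' - t) := by
      dsimp only at h
      linear_combination h
    rw [h2, norm_mul, norm_veechSign, one_mul] at h1
    have h3 := norm_sub_le t' t
    have h4 := (mem_ball_zero_iff.1 ht).trans_le (min_le_right _ _)
    have h5 := (mem_ball_zero_iff.1 ht').trans_le (min_le_right _ _)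
    linarith

end VeechCharts

/-! ### The natural covering of `Π_n` -/

section NaturalCovering

set_option linter.unusedSectionVars false

variable {n : ℕ} [NeZero n]

/-- The rotations of the regular polygon, as self-maps. -/
def regPolyRot (m : ZMod n) : C(regPoly n, regPoly n) where
  toFun z := ⟨polyRot n m * z, rot_mem_regPoly m z.2⟩
  continuous_toFun := by fun_prop

lemma regPolyRot_neg (m : ZMod n) (z : regPoly n) : regPolyRot m (regPolyRot (-m) z) = z := by
  refine Subtype.ext ?_
  change polyRot n m * (polyRot n (-m) * z) = z
  rw [← mul_assoc, polyRot_mul_neg, one_mul]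

lemma regPolyRot_mem_polyCore_iff (m : ZMod n) (z : regPoly n) :
    (regPolyRot m z : ℂ) ∈ polyCore n ↔ (z : ℂ) ∈ polyCore n := by
  rw [mem_polyCore_iff, mem_polyCore_iff]
  exact (rot_mem_range_polyVertex_iff m z).not

variable {S : Type*} [TopologicalSpace S] {D : FlatAtlas S} {J : Type*} {f : J → C(regPoly n, S)}
  {a : J → ℂ} (hf : IsTiling D n f a)

lemma FlatAtlas.IsTranslational.isLocalHomeomorphOn_of_derivative (hT : D.IsTranslational) {T : Type*} [TopologicalSpace T] {E : FlatAtlas T}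
    {q : C(S, T)} (hpre : q ⁻¹' E.sing = D.sing) {c : ℂ} (hc : c ≠ 0)
    (h : ∀ x ∉ D.sing, ∀ φ ∈ D.charts, x ∈ φ.source → (∃ ψ ∈ E.charts, q x ∈ ψ.source) ∧
      ∀ ψ ∈ E.charts, q x ∈ ψ.source → ∃ b : ℂ, ∀ᶠ y in 𝓝 x, ψ (q y) = c * φ y + b) :
    IsLocalHomeomorphOn q (q ⁻¹' E.singᶜ) := by
  refine IsLocalHomeomorphOn.mk _ _ fun x hx => ?_
  have hx' : x ∉ D.sing := by rw [← hpre]; exact hx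
  obtain ⟨φ, hφ, hxφ⟩ := hT.cover x hx'
  obtain ⟨⟨ψ, hψ, hxψ⟩, h2⟩ := h x hx' φ hφ hxφ
  obtain ⟨b, hb⟩ := h2 ψ hψ hxψ
  obtain ⟨U, hUs, hU, hxU⟩ := mem_nhds_iff.1
    (hb.and (q.continuous.continuousAt.preimage_mem_nhds (ψ.open_source.mem_nhds hxψ)))
  let m : ℂ ≃ₜ ℂ := (Homeomorph.mulLeft₀ c hc).trans (Homeomorph.addRight b)
  let e := ((φ.restrOpen U hU).trans m.toOpenPartialHomeomorph).trans ψ.symm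
  have he : ∀ y ∈ φ.source ∩ U, (m (φ y) ∈ ψ.target ∧ e y = q y) := by
    intro y hy
    have h1 : m (φ y) = ψ (q y) := (hUs hy.2).1.symm
    refine ⟨h1 ▸ ψ.map_source (hUs hy.2).2, ?_⟩
    change ψ.symm (m (φ y)) = q y
    rw [h1, ψ.left_inv (hUs hy.2).2]
  refine ⟨e, ?_, ?_⟩
  · have h1 := (he x ⟨hxφ, hxU⟩).1
    simp only [e, OpenPartialHomeomorph.trans_source, OpenPartialHomeomorph.symm_source]
    refine ⟨⟨?_, mem_univ _⟩, h1⟩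
    simp [hxφ, hxU]
  · intro y hy
    simp only [e, OpenPartialHomeomorph.trans_source, OpenPartialHomeomorph.symm_source] at hy
    have hy' : y ∈ φ.source ∩ U := by
      have := hy.1.1
      simpa using this
    exact (he y hy').2.symm

namespace IsTiling

include hf

/-- Up to a common similarity, the polygons are translates of the polygons of `Π_n`. -/
lemma exists_derivative_eq (hD : D.IsTranslationSurface) [ConnectedSpace S] (i₀ : J) (i : J) :
    ∃ (j : Fin (veechCount n)) (m : ZMod n), (a i₀)⁻¹ * a i = veechSign j * polyRot n m := by
  have hn := hf.three_le
  have := hf.finite hD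
  have := hD.isConeSurface.hausdorff
  let G : J → Prop := fun i => ∃ (j : Fin (veechCount n)) (m : ZMod n),
    (a i₀)⁻¹ * a i = veechSign j * polyRot n m
  have hG₀ : G i₀ := ⟨⟨0, by rw [veechCount]; split <;> norm_num⟩, 0, by
    simp [veechSign, inv_mul_cancel₀ (hf.a_ne_zero i₀)]⟩
  -- Normals are opposite across a common side, and each side of `Π_n` has a partner with opposite
  -- normal, so the property passes to neighbours.
  have hstep : ∀ i i' k l, a i' * polyNormal n l = -(a i * polyNormal n k) → G i → G i' := by
    rintro i i' k l h ⟨j, m, hj⟩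
    obtain ⟨j', l', hl'⟩ := exists_veechSign_mul_normal_eq_neg j (k + m)
    refine ⟨j', l' - l, mul_right_cancel₀ (polyNormal_ne_zero l) ?_⟩
    rw [mul_assoc, h, mul_assoc, ← polyNormal_add, add_sub_cancel, hl', polyNormal_add]
    linear_combination -polyNormal n k * hj
  by_contra hi
  -- The polygons with the property and those without have closed unions. If both kinds existed, the
  -- unions would meet at a regular point by connectedness, and the two polygons glued there
  -- contradict `hstep`.
  have hcl : ∀ T : Set J, IsClosed (⋃ i ∈ T, range (f i)) := fun T =>
    (toFinite T).isClosed_biUnion fun i _ => (isCompact_range (f i).continuous).isClosed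
  have hmem : ∀ T : Set J, ∀ i ∈ T, (D.singᶜ ∩ ⋃ i ∈ T, range (f i)).Nonempty := fun T i hi =>
    ⟨_, hf.notMem_sing (z := ⟨0, zero_mem_regPoly hn⟩) (zero_mem_polyCore hn),
      mem_biUnion hi (mem_range_self _)⟩
  obtain ⟨x, hx, hx1, hx2⟩ := isPreconnected_closed_iff.1 (hf.isPreconnected_compl_sing hD)
    (⋃ i ∈ {i | G i}, range (f i)) (⋃ i ∈ {i | ¬ G i}, range (f i)) (hcl _) (hcl _)
    (fun x _ => by
      obtain ⟨i, z, rfl⟩ := hf.cover_all hD x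
      by_cases h : G i
      · exact Or.inl (mem_biUnion (show i ∈ {i | G i} from h) (mem_range_self z))
      · exact Or.inr (mem_biUnion (show i ∈ {i | ¬ G i} from h) (mem_range_self z)))
    (hmem _ i₀ hG₀) (hmem _ i hi)
  obtain ⟨i₁, h1, z, rfl⟩ := mem_iUnion₂.1 hx1
  obtain ⟨i₂, h2, w, hw⟩ := mem_iUnion₂.1 hx2
  rw [mem_compl_iff, hf.vertices, ← mem_polyCore_iff] at hx
  by_cases hne : i₁ = i₂ ∧ z = w
  · exact h2 (hne.1 ▸ h1)
  · obtain ⟨k, l, -, -, h, -⟩ := hf.glued_of_eq hw.symm hx hne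
    exact h2 (hstep i₁ i₂ k l h h1)

/-- The covering of `Π_n`, on the level of polygons. -/
lemma exists_map_veech (hD : D.IsTranslationSurface) {j : J → Fin (veechCount n)} {m : J → ZMod n}
    {c : ℂ} (hjm : ∀ i, c * a i = veechSign (j i) * polyRot n (m i)) :
    ∃ q : C(S, VeechSurface n), ∀ i z, q (f i z) = veechPoly n (j i) (regPolyRot (m i) z) := by
  have hn := hf.three_le
  have := hf.finite hD
  have := hD.isConeSurface.hausdorff
  have := t2Space_veechSurface (n := n) hn
  choose I Z hIZ using hf.cover_all hD
  let q₀ : S → VeechSurface n := fun x => veechPoly n (j (I x)) (regPolyRot (m (I x)) (Z x))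
  -- The value is independent of the polygon chosen: polygons sharing a regular point are glued, and
  -- `hjm` turns this into a gluing of `Π_n`.
  have hq₀ : ∀ i, ∀ z : regPoly n, (z : ℂ) ∈ polyCore n →
      q₀ (f i z) = veechPoly n (j i) (regPolyRot (m i) z) := by
    intro i z hz
    set i' := I (f i z) with hi'
    set w := Z (f i z) with hw
    have h : f i z = f i' w := (hIZ _).symm
    change veechPoly n (j i') (regPolyRot (m i') w) = _
    by_cases hne : i = i' ∧ z = w
    · rw [← hne.1, ← hne.2]
    · obtain ⟨k, l, hk, hl, h1, h2⟩ := hf.glued_of_eq h hz hne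
      refine (Quot.sound ((veechGlue_iff hn _ _).2
        ⟨k + m i, l + m i', rot_mem_polySide _ _ hk, rot_mem_polySide _ _ hl, ?_, ?_⟩)).symm
      · dsimp only
        rw [polyNormal_add, polyNormal_add, ← mul_assoc, ← mul_assoc, ← hjm, ← hjm, mul_assoc, h1]
        ring
      · change veechSign (j i') * (polyRot n (m i') * w - _) =
          veechSign (j i) * (polyRot n (m i) * z - _)
        rw [polyMid_add, polyMid_add, ← mul_sub, ← mul_sub, ← mul_assoc, ← mul_assoc, ← hjm, ← hjm,
          mul_assoc, h2, mul_assoc]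
  have hcore : ∀ z : regPoly n, (z : ℂ) ∈ polyCore n → ∀ᶠ z' : regPoly n in 𝓝 z, (z' : ℂ) ∈ polyCore n := by
    intro z hz
    filter_upwards [(finite_vertices (n := n)).isClosed.isOpen_compl.mem_nhds
      ((mem_polyCore_iff z).1 hz)] with w hw
    exact (mem_polyCore_iff w).2 hw
  have hcont : ContinuousOn q₀ D.singᶜ := by
    intro x hx
    refine ContinuousAt.continuousWithinAt fun V hV => ?_
    refine eventually_nhds_of_finite_cover f (hf.cover_all hD) (P := fun y => q₀ y ∈ V) ?_
    rintro i z rfl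
    have hz : (z : ℂ) ∈ polyCore n := by rw [mem_polyCore_iff, ← hf.vertices i]; exact hx
    rw [hq₀ i z hz] at hV
    filter_upwards [hcore z hz, ((veechPoly n (j i)).comp
      (regPolyRot (m i))).continuous.continuousAt.preimage_mem_nhds hV] with w hw hw'
    rw [hq₀ i w hw]
    exact hw'
  -- Near a singular point `q₀` approaches the finite singular set of `Π_n`, so it converges along
  -- connected punctured neighbourhoods.
  have hlim : ∀ x ∈ D.sing, ∃ y, Tendsto q₀ (𝓝[≠] x) (𝓝 y) := by
    intro x hx
    have := hf.neBot_punctured_nhds hD hx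
    have hsc : D.singᶜ ∈ 𝓝[≠] x := by
      have h1 : (D.sing \ {x})ᶜ ∈ 𝓝 x :=
        (hD.isConeSurface.finite_sing.subset sdiff_subset).isClosed.isOpen_compl.mem_nhds (by simp)
      filter_upwards [mem_nhdsWithin_of_mem_nhds h1, self_mem_nhdsWithin] with y h2 h3
      exact fun h => h2 ⟨h, h3⟩
    obtain ⟨y, -, hy⟩ := exists_tendsto_of_tendsto_nhdsSet_finite
      (fun s hs => hf.exists_preconnected_punctured_nhds hD hx hs) hsc hcont
      (finite_veech_sing (n := n)) (fun V hV => by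
        have h1 : ∀ᶠ y in 𝓝 x, y ∉ D.sing → q₀ y ∈ V := by
          refine eventually_nhds_of_finite_cover f (hf.cover_all hD) ?_
          rintro i z rfl
          rw [hf.vertices] at hx
          have hV' : V ∈ 𝓝 (veechPoly n (j i) (regPolyRot (m i) z)) := by
            refine mem_nhdsSet_iff_forall.1 hV _ ((veechPoly_mem_sing_iff hn _ _).2 ?_)
            exact (rot_mem_range_polyVertex_iff _ _).2 hx
          filter_upwards [((veechPoly n (j i)).comp
            (regPolyRot (m i))).continuous.continuousAt.preimage_mem_nhds hV'] with w hw hws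
          rw [hf.vertices, ← mem_polyCore_iff] at hws
          rw [hq₀ i w hws]
          exact hw
        change ∀ᶠ y in 𝓝[≠] x, q₀ y ∈ V
        filter_upwards [mem_nhdsWithin_of_mem_nhds h1, hsc] with y h2 h3
        exact h2 h3)
    exact ⟨y, hy⟩
  obtain ⟨q, hq⟩ := exists_continuousMap_of_tendsto hD.isConeSurface.finite_sing hcont hlim
  refine ⟨q, fun i z => ?_⟩
  have h := eq_of_eqOn_polyCore hn (F := q.comp (f i))
    (G := (veechPoly n (j i)).comp (regPolyRot (m i))) fun z hz => by
      change q (f i z) = _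
      rw [hq (hf.notMem_sing hz), hq₀ i z hz]
      rfl
  exact congrFun (congrArg DFunLike.coe h) z

theorem exists_isNaturalCovering (hD : D.IsTranslationSurface) [ConnectedSpace S] :
    ∃ q : C(S, VeechSurface n), IsNaturalCovering D f q := by
  have hn := hf.three_le
  have := hf.finite hD
  have := hD.isConeSurface.hausdorff
  have := hD.isConeSurface.compact
  have := t2Space_veechSurface (n := n) hn
  obtain ⟨i₀, -, -⟩ := hf.cover_all hD (Classical.arbitrary S)
  choose j m hjm using hf.exists_derivative_eq hD i₀
  set c := (a i₀)⁻¹ with hc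
  have hc0 : c ≠ 0 := inv_ne_zero (hf.a_ne_zero i₀)
  obtain ⟨q, hq⟩ := hf.exists_map_veech hD hjm
  have hpre : q ⁻¹' (veechAtlas n).sing = D.sing := by
    ext x
    obtain ⟨i, z, rfl⟩ := hf.cover_all hD x
    rw [mem_preimage, hq, veechPoly_mem_sing_iff hn, hf.vertices]
    exact rot_mem_range_polyVertex_iff _ _
  have hder : ∀ x ∉ D.sing, ∀ φ ∈ D.charts, x ∈ φ.source →
      (∃ ψ ∈ (veechAtlas n).charts, q x ∈ ψ.source) ∧ ∀ ψ ∈ (veechAtlas n).charts,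
        q x ∈ ψ.source → ∃ b : ℂ, ∀ᶠ y in 𝓝 x, ψ (q y) = c * φ y + b := by
    intro x hx φ hφ hxφ
    constructor
    · obtain ⟨i, z, rfl⟩ := hf.cover_all hD x
      rw [hf.vertices, ← mem_polyCore_iff] at hx
      rw [hq]
      exact exists_veechChart hn _ ((regPolyRot_mem_polyCore_iff _ _).2 hx)
    · intro ψ hψ hxψ
      refine ⟨ψ (q x) - c * φ x, eventually_nhds_of_finite_cover f (hf.cover_all hD) ?_⟩
      rintro i z rfl
      rw [hf.vertices, ← mem_polyCore_iff] at hx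
      rw [hq] at hxψ ⊢
      obtain ⟨b, hb⟩ := hψ.2 _ _ hxψ
      filter_upwards [(regPolyRot (m i)).continuous.continuousAt.eventually hb,
        (hf.dev i z hx).chart hD.isTranslational (by fun_prop) hφ hxφ] with w h1 h2
      rw [hq, h1, h2.2, hb.self_of_nhds]
      change veechSign (j i) * (polyRot n (m i) * w) + b =
        _ + (veechSign (j i) * (polyRot n (m i) * z) + b - _)
      rw [← mul_assoc, ← mul_assoc, ← hjm]
      ring
  refine ⟨q, ⟨?_, ?_, hpre, c, hc0, hder⟩, fun i => ⟨j i, ?_⟩⟩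
  · have hj : ∀ j', ∃ i, j i = j' := by
      intro j'
      by_cases hne : Even n
      · exact ⟨i₀, veech_eq_of_even hne _ _⟩
      -- For odd `n` a neighbour of `i₀` is mapped to the other polygon of `Π_n`, since no two
      -- normals of one polygon are opposite.
      obtain ⟨i₁, l, h1, -⟩ := hf.exists_glued i₀ 0
      have hji : j i₁ ≠ j i₀ := by
        intro he
        have h2 : veechSign (j i₁) * polyNormal n (l + m i₁) =
            -(veechSign (j i₀) * polyNormal n (0 + m i₀)) := by
          rw [polyNormal_add, polyNormal_add, ← mul_assoc, ← mul_assoc, ← hjm, ← hjm, mul_assoc, h1]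
          ring
        rw [he, ← mul_neg] at h2
        exact polyNormal_ne_neg hne _ _ (mul_left_cancel₀ (veechSign_ne_zero _) h2)
      by_cases h0 : j i₀ = j'
      · exact ⟨i₀, h0⟩
      refine ⟨i₁, Fin.ext ?_⟩
      have h2 : veechCount n = 2 := if_neg hne
      have h3 : (j i₁ : ℕ) ≠ j i₀ := fun h => hji (Fin.ext h)
      have h4 : (j i₀ : ℕ) ≠ j' := fun h => h0 (Fin.ext h)
      omega
    intro x
    obtain ⟨j', z, rfl⟩ := exists_veechPoly_eq x
    obtain ⟨i, rfl⟩ := hj j'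
    exact ⟨f i (regPolyRot (-m i) z), by rw [hq, regPolyRot_neg]⟩
  · exact IsCoveringMapOn.of_isLocalHomeomorphOn q.continuous
      (hD.isTranslational.isLocalHomeomorphOn_of_derivative hpre hc0 hder)
  · let R : ℂ ≃ᵢ ℂ := (rotation ⟨polyRot n (m i), by
      simpa [Submonoid.unitSphere] using norm_polyRot (m i)⟩).toIsometryEquiv
    have hR : ∀ z, R z = polyRot n (m i) * z := fun z => rfl
    refine ⟨R, ?_, fun z w hw => ?_⟩
    · apply Subset.antisymm
      · rintro _ ⟨z, hz, rfl⟩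
        rw [hR]
        exact rot_mem_regPoly _ hz
      · intro z hz
        refine ⟨polyRot n (-m i) * z, rot_mem_regPoly _ hz, ?_⟩
        rw [hR, ← mul_assoc, polyRot_mul_neg, one_mul]
    · change q (f i z) = _
      rw [hq]
      congr 1
      exact Subtype.ext (by rw [hw, hR]; rfl)

end IsTiling

end NaturalCovering

/-! ### Regularity of the natural covering -/

section Regularity

set_option linter.unusedSectionVars false

variable {n : ℕ} [NeZero n]

/-- Symmetries of the regular polygon fix its centre. -/
lemma symm_zero (hn : 3 ≤ n) {A : ℂ ≃ᵢ ℂ} (hA : A '' regPoly n = regPoly n) : A 0 = 0 := by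
  have h1 : ∀ k : ZMod n, ‖polyVertex n k - A 0‖ ^ 2 ≤ 1 := by
    intro k
    obtain ⟨z, hz, hzk⟩ : polyVertex n k ∈ A '' regPoly n := hA.ge (polyVertex_mem k)
    rw [← hzk, ← dist_eq_norm, A.dist_eq, dist_zero_right]
    have := norm_le_of_mem_regPoly hz
    nlinarith [norm_nonneg z]
  have h2 : ∀ k : ZMod n, ‖A 0‖ ^ 2 ≤ 2 * ((starRingEnd ℂ) (A 0) * polyVertex n k).re := by
    intro k
    have h3 := h1 k
    have h4 := norm_polyVertex (n := n) k
    have h5 : ‖polyVertex n k‖ ^ 2 = 1 := by rw [h4, one_pow]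
    rw [← Complex.normSq_eq_norm_sq, Complex.normSq_apply] at h3 h5 ⊢
    simp only [Complex.sub_re, Complex.sub_im, Complex.mul_re, Complex.conj_re,
      Complex.conj_im] at h3 ⊢
    nlinarith
  -- The vertices sum to zero, so summation yields `n * ‖A 0‖ ^ 2 ≤ 0`.
  have h3 := Finset.sum_le_sum fun k (_ : k ∈ (Finset.univ : Finset (ZMod n))) => h2 k
  rw [← Finset.mul_sum, ← Complex.re_sum, ← Finset.mul_sum, sum_polyVertex hn, mul_zero,
    Complex.zero_re, mul_zero, Finset.sum_const, Finset.card_univ, ZMod.card, nsmul_eq_mul] at h3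
  have hn0 : (0 : ℝ) < n := by exact_mod_cast (by omega : 0 < n)
  have h4 : ‖A 0‖ ^ 2 ≤ 0 := by
    by_contra h
    push Not at h
    nlinarith [mul_pos hn0 h]
  exact norm_eq_zero.1 (pow_eq_zero_iff two_ne_zero |>.1 (le_antisymm h4 (by positivity)))

lemma symm_exists_linear (hn : 3 ≤ n) {A : ℂ ≃ᵢ ℂ} (hA : A '' regPoly n = regPoly n) :
    ∃ M : ℂ ≃ₗᵢ[ℝ] ℂ, ∀ z, A z = M z := by
  obtain ⟨M, hM⟩ := A.exists_linear
  refine ⟨M, fun z => ?_⟩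
  have := hM 0 z
  rwa [symm_zero hn hA, zero_add, zero_add] at this

lemma symm_vertex (hn : 3 ≤ n) {A : ℂ ≃ᵢ ℂ} (hA : A '' regPoly n = regPoly n) (k : ZMod n) :
    A (polyVertex n k) ∈ range (polyVertex n) := by
  rw [mem_range_polyVertex_iff (hA.le (mem_image_of_mem A (polyVertex_mem k)))]
  have := A.dist_eq (polyVertex n k) 0
  rwa [symm_zero hn hA, dist_zero_right, dist_zero_right, norm_polyVertex] at this

/-- A symmetry of the regular polygon is a rotation if it carries a side with its initial point to a
side with its initial point. -/
lemma symm_eq_rot (hn : 3 ≤ n) {A : ℂ ≃ᵢ ℂ} (hA : A '' regPoly n = regPoly n) {k : ZMod n}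
    (hside : A '' polySide n 0 = polySide n k) (hv : A (polyVertex n 0) = polyVertex n k) (z : ℂ) :
    A z = polyRot n k * z := by
  obtain ⟨M, hM⟩ := symm_exists_linear hn hA
  have hv1 : A (polyVertex n 1) = polyVertex n (k + 1) := by
    obtain ⟨l, hl⟩ := symm_vertex hn hA 1
    have h1 : polyVertex n l ∈ polySide n k := by
      rw [hl, ← hside]
      refine mem_image_of_mem A ?_
      have : polyVertex n (0 + 1) ∈ polySide n 0 := right_mem_segment ℝ _ _
      rwa [zero_add] at this
    have h2 := polyHeight_of_mem_polySide h1
    by_cases hlk : l = k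
    · rw [hlk, ← hv] at hl
      exact absurd (polyVertex_injective (A.injective hl)).symm (zmod_one_ne_zero hn)
    by_cases hlk' : l = k + 1
    · rw [← hl, hlk']
    exact absurd h2 (polyHeight_vertex_lt k l hlk hlk').ne
  have e0 : polyVertex n k = polyRot n k * polyVertex n 0 := by rw [← polyVertex_add, zero_add]
  have e1 : polyVertex n (k + 1) = polyRot n k * polyVertex n 1 := by
    rw [← polyVertex_add, add_comm]
  have e01 : polyVertex n 1 = polyRot n 1 * polyVertex n 0 := by rw [← polyVertex_add, zero_add]
  rw [e0, hM] at hv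
  rw [e1, hM] at hv1
  have hne := polyVertex_ne_zero (n := n) 0
  rw [hM]
  obtain ⟨α, hα | hα⟩ := linear_isometry_complex M
  · rw [hα, rotation_apply] at hv ⊢
    rw [mul_right_cancel₀ hne hv]
  -- A reflection would force the rotation by one step to be its own inverse, that is, `2 = 0` in
  -- `ZMod n`.
  · exfalso
    have h3 : ∀ z, M z = α * (starRingEnd ℂ) z := fun z => by rw [hα]; rfl
    rw [h3] at hv hv1
    rw [e01, map_mul] at hv1
    have hr : (starRingEnd ℂ) (polyRot n 1) = polyRot n 1 := by
      refine mul_right_cancel₀ (mul_ne_zero (polyRot_ne_zero k) hne) ?_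
      linear_combination hv1 - (starRingEnd ℂ) (polyRot n 1) * hv
    rw [← polyRot_neg] at hr
    exact zmod_two_ne_zero hn (by rw [← neg_eq_iff_add_eq_zero]; exact polyRot_injective hr)

variable {S : Type*} [TopologicalSpace S] {D : FlatAtlas S} {J : Type*} {f : J → C(regPoly n, S)}
  {a : J → ℂ} (hf : IsTiling D n f a) (hD : D.IsTranslationSurface)

namespace IsTiling

include hf

/-- A natural covering is a rotation on each polygon. -/
lemma natural_eq_rot (hT : D.IsTranslational) {q : C(S, VeechSurface n)}
    (hq : IsNaturalCovering D f q) : ∃ (c : ℂ) (j : J → Fin (veechCount n)) (m : J → ZMod n),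
      (∀ i, c * a i = veechSign (j i) * polyRot n (m i)) ∧
      ∀ i z, q (f i z) = veechPoly n (j i) (regPolyRot (m i) z) := by
  have hn := hf.three_le
  obtain ⟨c, hc, hder⟩ := hq.isDilationCovering.derivative
  have key : ∀ i, ∃ (j : Fin (veechCount n)) (m : ZMod n), c * a i = veechSign j * polyRot n m ∧
      ∀ z, q (f i z) = veechPoly n j (regPolyRot m z) := by
    intro i
    obtain ⟨j, A, hA, hqA⟩ := hq.polygons i
    have hqA' : ∀ z, q (f i z) = veechPoly n j (polySymm hA z) := fun z => hqA z _ rfl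
    obtain ⟨M, hM⟩ := symm_exists_linear hn hA
    let o : regPoly n := ⟨0, zero_mem_regPoly hn⟩
    have ho : (o : ℂ) ∈ polyCore n := zero_mem_polyCore hn
    obtain ⟨φ, hφ, hxφ⟩ := hT.cover _ (hf.notMem_sing (i := i) ho)
    obtain ⟨⟨ψ, hψ, hxψ⟩, h2⟩ := hder _ (hf.notMem_sing (i := i) ho) φ hφ hxφ
    obtain ⟨b, hb⟩ := h2 ψ hψ hxψ
    obtain ⟨b', hb'⟩ := hψ.2 j (polySymm hA o) (by rwa [← hqA'])
    -- Comparing derivatives at the centre shows that the symmetry `A` is multiplication by a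
    -- complex number, hence a rotation.
    have hev : ∀ᶠ w : regPoly n in 𝓝 o,
        veechSign j * M w + b' = c * (φ (f i o) + a i * w) + b := by
      filter_upwards [(f i).continuous.continuousAt.eventually hb,
        (polySymm hA).continuous.continuousAt.eventually hb',
        (hf.dev i o ho).chart hT (by fun_prop) hφ hxφ] with w h1 h2 h3
      rw [hqA', h2, h3.2] at h1
      change veechSign j * A w + b' = c * (φ (f i o) + (a i * w - a i * 0)) + b at h1
      rwa [mul_zero, sub_zero, hM] at h1
    have h0 := hev.self_of_nhds
    have ho0 : (o : ℂ) = 0 := rfl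
    rw [ho0, map_zero, mul_zero, mul_zero, zero_add, add_zero] at h0
    have hev' : ∀ᶠ w in 𝓝 (0 : ℂ), M.toLinearEquiv.toLinearMap w =
        LinearMap.mulLeft ℝ (veechSign j * (c * a i)) w := by
      obtain ⟨u, hu, hus⟩ := (mem_nhds_subtype _ o _).1 hev
      filter_upwards [hu, mem_interior_iff_mem_nhds.1 (zero_mem_interior hn)] with w h1 h2
      have h3 : veechSign j * M w + b' = c * (φ (f i o) + a i * w) + b :=
        hus (show (⟨w, h2⟩ : regPoly n) ∈ Subtype.val ⁻¹' u from h1)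
      change M w = veechSign j * (c * a i) * w
      linear_combination (veechSign j) * h3 - (veechSign j) * h0 - M w * veechSign_mul_self j
    have hMe : ∀ z, M z = veechSign j * (c * a i) * z := fun z =>
      LinearMap.congr_fun (LinearMap.eq_of_eventuallyEq hev') z
    obtain ⟨m, hm⟩ := symm_vertex hn hA 0
    have hu : veechSign j * (c * a i) = polyRot n m := by
      refine mul_right_cancel₀ (polyVertex_ne_zero (n := n) 0) ?_
      rw [← hMe, ← hM, ← hm, ← polyVertex_add, zero_add]
    refine ⟨j, m, ?_, fun z => ?_⟩
    · rw [← hu, ← mul_assoc, veechSign_mul_self, one_mul]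
    · rw [hqA']
      congr 1
      refine Subtype.ext ?_
      change A z = polyRot n m * z
      rw [hM, hMe, hu]
  choose j m h1 h2 using key
  exact ⟨c, j, m, h1, h2⟩

/-- Gluings of `Π_n` lift along a natural covering. -/
lemma exists_of_veechGlue {c : ℂ} {j : J → Fin (veechCount n)} {m : J → ZMod n}
    (hjm : ∀ i, c * a i = veechSign (j i) * polyRot n (m i)) {i : J} {z : regPoly n}
    {y : Fin (veechCount n) × regPoly n} (h : veechGlue n (j i, regPolyRot (m i) z) y) :
    ∃ i' w, f i' w = f i z ∧ (j i', regPolyRot (m i') w) = y := by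
  have hn := hf.three_le
  rw [veechGlue_iff hn] at h
  obtain ⟨k, l, hk, -, h1, h2⟩ := h
  have hk' : (z : ℂ) ∈ polySide n (k - m i) := by
    have := rot_mem_polySide k (-m i) hk
    rw [← sub_eq_add_neg] at this
    change polyRot n (-m i) * (polyRot n (m i) * z) ∈ _ at this
    rwa [← mul_assoc, mul_comm (polyRot n (-m i)), polyRot_mul_neg, one_mul] at this
  obtain ⟨i', l', h3, hglue⟩ := hf.exists_glued i (k - m i)
  obtain ⟨w, -, hw, h4, -⟩ := hglue z hk'
  have h5 : veechSign (j i') * polyNormal n (l' + m i') = veechSign y.1 * polyNormal n l := by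
    have h6 : polyNormal n k = polyRot n (m i) * polyNormal n (k - m i) := by
      rw [← polyNormal_add, sub_add_cancel]
    rw [h1, polyNormal_add, ← mul_assoc, ← hjm, mul_assoc, h3, h6]
    dsimp only
    linear_combination -polyNormal n (k - m i) * hjm i
  obtain ⟨hj, hl⟩ := veechSign_mul_normal_inj h5
  refine ⟨i', w, hw.symm, Prod.ext hj (Subtype.ext ?_)⟩
  change polyRot n (m i') * w = y.2
  have h6 : polyMid n k = polyRot n (m i) * polyMid n (k - m i) := by
    rw [← polyMid_add, sub_add_cancel]
  have h7 : polyMid n l = polyRot n (m i') * polyMid n l' := by rw [← hl, polyMid_add]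
  have h8 : veechSign y.1 * ((y.2 : ℂ) - polyMid n l) =
      veechSign (j i) * (polyRot n (m i) * z - polyMid n k) := h2
  rw [h6, h7, ← hj] at h8
  refine mul_left_cancel₀ (veechSign_ne_zero (j i')) ?_
  linear_combination -h8 + c * h4 - (w - polyMid n l') * hjm i' +
    (z - polyMid n (k - m i)) * hjm i

/-- Gluings lift in both directions, so whether some polygon at `s` occupies a given position
depends only on the point of `Π_n`. This handles vertices, which are identified through chains of
gluings. -/
lemma exists_of_natural_eq {c : ℂ} {j : J → Fin (veechCount n)} {m : J → ZMod n}
    (hjm : ∀ i, c * a i = veechSign (j i) * polyRot n (m i)) {x y : Fin (veechCount n) × regPoly n}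
    (h : Quot.mk (veechGlue n) x = Quot.mk (veechGlue n) y) (s : S) :
    (∃ i z, f i z = s ∧ (j i, regPolyRot (m i) z) = x) ↔
      ∃ i z, f i z = s ∧ (j i, regPolyRot (m i) z) = y := by
  have hn := hf.three_le
  have h' := Quot.eqvGen_exact h
  clear h
  induction h' with
  | rel x y h =>
    constructor
    · rintro ⟨i, z, rfl, rfl⟩
      exact hf.exists_of_veechGlue hjm h
    · rintro ⟨i, z, rfl, rfl⟩
      exact hf.exists_of_veechGlue hjm (h.symm hn)
  | refl x => exact Iff.rfl
  | symm x y _ ih => exact ih.symm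
  | trans x y z _ _ ih1 ih2 => exact ih1.trans ih2

end IsTiling

/-- An isometry that is compatible with a dilation covering near one regular point is a deck
transformation away from the singularities. -/
lemma IsDilationCovering.comp_isometry_eq {T : Type*} [TopologicalSpace T] [T2Space T]
    {E : FlatAtlas T} {q : C(S, T)} (hq : IsDilationCovering D E q) (hT : D.IsTranslational)
    (hc : IsPreconnected D.singᶜ) {h : S ≃ₜ S} (hh : D.IsIsometry h) {x : S} (hx : x ∉ D.sing)
    (hxq : ∀ᶠ y in 𝓝 x, q (h y) = q y) {y : S} (hy : y ∉ D.sing) : q (h y) = q y := by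
  obtain ⟨c, hc0, hder⟩ := hq.derivative
  let G : S → Prop := fun y => ∀ᶠ y' in 𝓝 y, q (h y') = q y'
  suffices hG : G x ↔ G y from (hG.1 hxq).self_of_nhds
  refine hc.induction₂ (fun x y => G x ↔ G y) (fun y hy => mem_nhdsWithin_of_mem_nhds ?_)
    (fun _ _ _ _ _ _ h1 h2 => h1.trans h2) (fun _ _ _ _ h => h.symm) hx hy
  -- Agreement of germs is locally constant. Where the values agree, both maps are affine in a
  -- common chart, so agreement near one nearby point gives linear part `M = 1` and agreement
  -- throughout; where they differ, they differ nearby.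
  by_cases heq : q (h y) = q y
  · have hhy : h y ∉ D.sing := by rwa [hh.map_sing]
    obtain ⟨φ, hφ, hyφ⟩ := hT.cover y hy
    obtain ⟨φ₂, hφ₂, hyφ₂⟩ := hT.cover (h y) hhy
    obtain ⟨⟨ψ, hψ, hyψ⟩, hb⟩ := hder y hy φ hφ hyφ
    obtain ⟨b, hb⟩ := hb ψ hψ hyψ
    obtain ⟨b₂, hb₂⟩ := (hder (h y) hhy φ₂ hφ₂ hyφ₂).2 ψ hψ (by rwa [heq])
    obtain ⟨A, hA⟩ := hh.isometry y hy φ hφ hyφ φ₂ hφ₂ hyφ₂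
    obtain ⟨M, hM⟩ := A.exists_linear
    have hN : ∀ᶠ y' in 𝓝 y, (ψ (q y') = c * φ y' + b ∧ ψ (q (h y')) = c * A (φ y') + b₂) ∧
        (q y' ∈ ψ.source ∧ q (h y') ∈ ψ.source) := by
      filter_upwards [hb, h.continuous.continuousAt.eventually hb₂, hA,
        q.continuous.continuousAt.preimage_mem_nhds (ψ.open_source.mem_nhds hyψ),
        (q.continuous.comp h.continuous).continuousAt.preimage_mem_nhds
          (ψ.open_source.mem_nhds (by rwa [Function.comp_apply, heq]))] with y' h1 h2 h3 h4 h5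
      exact ⟨⟨h1, by rw [h2, h3]⟩, h4, h5⟩
    have hGy : ∀ᶠ y' in 𝓝 y, G y → G y' := by
      by_cases hG : G y
      · exact (eventually_eventually_nhds.2 hG).mono fun _ h _ => h
      · exact Eventually.of_forall fun _ h => absurd h hG
    filter_upwards [eventually_eventually_nhds.2 hN, φ.open_source.mem_nhds hyφ, hGy]
      with y' h1 h2 h3
    refine ⟨h3, fun hG => ?_⟩
    have hy' := hT.source_subset φ hφ h2
    have h0 := h1.self_of_nhds.1
    rw [← hG.self_of_nhds, h0.2] at h0
    have h0' := h0.1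
    have hM1 : M.toLinearEquiv.toLinearMap = LinearMap.id := by
      refine LinearMap.eq_of_eventuallyEq ?_
      filter_upwards [(hT.tendsto_move hy').eventually (h1.and hG), hT.chart_move hφ h2]
        with t ⟨⟨⟨h4, h5⟩, _⟩, h6⟩ h7
      rw [h6, h4, h7.2, hM] at h5
      change M t = t
      exact mul_left_cancel₀ hc0 (by linear_combination -h5 - h0')
    have hMt : ∀ τ, M τ = τ := LinearMap.congr_fun hM1
    filter_upwards [hN] with u ⟨⟨h4, h5⟩, h6, h7⟩
    refine ψ.injOn h7 h6 ?_
    rw [h4, h5, ← add_sub_cancel (φ y') (φ u), hM, hMt]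
    linear_combination h0'
  · have hopen : IsOpen {y | q (h y) ≠ q y} :=
      isOpen_ne_fun (q.continuous.comp h.continuous) q.continuous
    filter_upwards [hopen.mem_nhds heq] with y' hy'
    exact iff_of_false (fun hG => heq hG.self_of_nhds) fun hG => hy' hG.self_of_nhds

theorem IsTiling.isRegularCovering (hf : IsTiling D n f a) (hD : D.IsTranslationSurface)
    (hP : D.IsPlatonic n f) {q : C(S, VeechSurface n)} (hq : IsNaturalCovering D f q) :
    IsRegularCovering q := by
  have hn := hf.three_le
  have hT := hD.isTranslational
  have := hP.connected
  have := hD.isConeSurface.hausdorff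
  have := hf.finite hD
  have := t2Space_veechSurface (n := n) hn
  obtain ⟨c, j, m, hjm, hqf⟩ := hf.natural_eq_rot hT hq
  intro x y hxy
  obtain ⟨i, z, rfl⟩ := hf.cover_all hD x
  obtain ⟨i₁, w₁, rfl⟩ := hf.cover_all hD y
  rw [hqf, hqf] at hxy
  -- Polygon `i'` occupies at the second point the same position in `Π_n` as polygon `i` does at the
  -- first, even if the points are singular.
  obtain ⟨i', w, hw, hjw⟩ := (hf.exists_of_natural_eq hjm hxy (f i₁ w₁)).2 ⟨i₁, w₁, rfl, rfl⟩
  obtain ⟨hj, hwz⟩ := Prod.mk.inj hjw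
  have hwz' : polyRot n (m i') * w = polyRot n (m i) * z := congrArg Subtype.val hwz
  set k := m i - m i' with hk
  have hrot : ∀ u : ℂ, polyRot n (m i') * (polyRot n k * u) = polyRot n (m i) * u := fun u => by
    rw [← mul_assoc, ← polyRot_add, hk, add_sub_cancel]
  -- These flags force the symmetry to be the rotation by `k = m i - m i'`, the one that makes the
  -- isometry compatible with `q` on polygon `i`.
  obtain ⟨h, hh, A, hA, hside, hv⟩ := hP.transitive ⟨i, 0, 0, Or.inl rfl⟩ ⟨i', k, k, Or.inl rfl⟩
  have hAr := symm_eq_rot hn hA.1 hside hv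
  have hhf : ∀ u, h (f i u) = f i' (regPolyRot k u) := fun u => hA.2 u _ (hAr u).symm
  have hqh : ∀ u, q (h (f i u)) = q (f i u) := fun u => by
    rw [hhf, hqf, hqf, hj]
    congr 1
    exact Subtype.ext (hrot u)
  let o : regPoly n := ⟨0, zero_mem_regPoly hn⟩
  have ho : f i o ∉ D.sing := hf.notMem_sing (zero_mem_polyCore hn : (o : ℂ) ∈ polyCore n)
  have hev : ∀ᶠ y in 𝓝 (f i o), q (h y) = q y := by
    refine eventually_nhds_of_finite_cover f (hf.cover_all hD) fun i'' u hu => ?_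
    obtain ⟨rfl, -⟩ := hf.interior_disjoint i i'' o u (zero_mem_interior hn) hu.symm
    exact Eventually.of_forall hqh
  refine ⟨h, congrFun (Continuous.ext_on (hf.dense_compl_sing hD)
    (q.continuous.comp h.continuous) q.continuous fun y hy => ?_), ?_⟩
  · exact hq.isDilationCovering.comp_isometry_eq hT (hf.isPreconnected_compl_sing hD) hh ho hev hy
  · rw [hhf, ← hw]
    congr 1
    refine Subtype.ext (mul_left_cancel₀ (polyRot_ne_zero (m i')) ?_)
    rw [hwz']
    exact hrot z

end Regularity

end

theorem mainTheorem5 {S S' ι : Type*} [TopologicalSpace S] [TopologicalSpace S'] {n : ℕ}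
    (D : FlatAtlas S) (P : ι → C(regPoly n, S)) (hD : D.IsPlatonic n P)
    (D' : FlatAtlas S') (p : C(S', S)) (hp : IsUnfolding D D' p) :
    D'.IsPlatonic n (liftedDecomposition p P) ∧
    (∃ q : C(S', VeechSurface n), IsNaturalCovering D' (liftedDecomposition p P) q) ∧
    (∀ q : C(S', VeechSurface n), IsNaturalCovering D' (liftedDecomposition p P) q →
      IsRegularCovering q) := by
  have : NeZero n := ⟨by have := hD.decomposition.three_le; omega⟩
  have hP := hp.isPlatonic hD
  have hT := hp.isTranslationSurface
  have := hp.connected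
  obtain ⟨a, hf⟩ := hp.exists_isTiling hD
  exact ⟨hP, hf.exists_isNaturalCovering hT, fun q hq => hf.isRegularCovering hT hP hq⟩
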